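/- **Conventions.** A strict partition is a finite sequence $\lambda=(\lambda_1>\lambda_2>\dots>\lambda_\ell>0)$ with $\ell(\lambda)=\ell\ge 0$ parts; its shifted diagram is $\mathsf{SD}_\lambda=\{(i,j): 0<i\le j<i+\lambda_i\}$, and $|\lambda|=|\mathsf{SD}_\lambda|$. Write $\mu\subseteq\lambda$ if $\mu_i\le\lambda_i$ for all $i$, and then $\mathsf{SD}_{\lambda/\mu}=\mathsf{SD}_\lambda\setminus\mathsf{SD}_\mu$ and $|\lambda/\mu|=|\mathsf{SD}_{\lambda/\mu}|$. Fillings use the letters $1'<1<2'<2<\cdots$. A filling of a shifted diagram by letters, or by nonempty finite sets of letters (where $S$ before $S'$ requires $\max S\le\min S'$), is *semistandard* if its rows and columns are weakly increasing, no unprimed number occurs more than once in a column, and no primed number occurs more than once in a row. All series lie in $\mathbb Z[\beta][[x_1,x_2,\dots]]$. **The functions.** For a strict partition $\lambda$ let $GQ_\lambda=\sum_T\beta^{|T|-|\lambda|}x^T$, summed over all semistandard set-valued fillings $T$ of $\mathsf{SD}_\lambda$, where $|T|$ is the total number of letters in $T$ and the exponent of $x_i$ in $x^T$ is the number of occurrences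 of $i$ or $i'$; let $GP_\lambda$ be the same sum over those $T$ that have no primed number in a diagonal box $(j,j)$. Let $gp_\lambda$ and $gq_\lambda$ be the unique families, indexed by strict partitions, with $$\sum_\lambda GQ_\lambda(x)\,gp_\lambda(y)=\sum_\lambda GP_\lambda(x)\,gq_\lambda(y)=\prod_{i,j\ge1}\frac{1-\overline{x_i}\,y_j}{1-x_iy_j},\qquad \overline{x_i}=\frac{-x_i}{1+\beta x_i}.$$ Let $a_{\mu\nu}^\lambda,b_{\mu\nu}^\lambda\in\mathbb Z$ be the unique integers with $GP_\mu GP_\nu=\sum_\lambda a_{\mu\nu}^\lambda\beta^{|\lambda|-|\mu|-|\nu|}GP_\lambda$ and $GQ_\mu GQ_\nu=\sum_\lambda b_{\mu\nu}^\lambda\beta^{|\lambda|-|\mu|-|\nu|}GQ_\lambda$, and put $$gp_{\lambda/\mu}=\sum_\nu b_{\mu\nu}^\lambda\beta^{|\lambda|-|\mu|-|\nu|}gp_\nu,\qquad gq_{\lambda/\mu}=\sum_\nu a_{\mu\nu}^\lambda\beta^{|\lambda|-|\mu|-|\nu|}gq_\nu .$$ Finally let $jp_{\lambda/\mu}=\omega(gp_{\lambda/\mu})$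 and $jq_{\lambda/\mu}=\omega(gq_{\lambda/\mu})$, where $\omega$ sends a (possibly infinite) $\mathbb Z[\beta]$-linear combination $\sum_\lambda c_\lambda s_\lambda$ of Schur functions to $\sum_\lambda c_\lambda s_{\lambda^\top}$. **The tableaux.** Let $\mathrm{ShRPP}_Q(\lambda/\mu)$ be the set of fillings $T$ of $\mathsf{SD}_{\lambda/\mu}$ by letters with weakly increasing rows and columns, and $\mathrm{ShRPP}_P(\lambda/\mu)$ the subset of those whose diagonal entries are all primed. Put $x^{\mathrm{wt}(T)}=\prod_i x_i^{c_i+r_i}$ and $|\mathrm{wt}(T)|=\sum_i(c_i+r_i)$, where $c_i$ is the number of columns of $T$ containing $i$ and $r_i$ is the number of rows of $T$ containing $i'$. Let $\mathrm{ShBT}_Q(\lambda/\mu)$ be the set of pairs $T=(V,\Pi)$ where $V$ is a semistandard filling of $\mathsf{SD}_{\lambda/\mu}$ by letters and $\Pi$ is a partition of the set $\mathsf{SD}_{\lambda/\mu}$ into blocks each of which is a contiguous set of boxes in a single row or a single column having the same entry in $V$; let $\mathrm{ShBT}_P(\lambda/\mu)$ be the subset of those $T$ for which $V$ has no primed diagonal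 entry. Put $|T|=|\Pi|$ and $x^T=\prod_i x_i^{b_i}$, where $b_i$ is the number of blocks containing $i$ or $i'$. **Proposition.** Let $\mu\subseteq\lambda$ be strict partitions with $\ell(\lambda)\le1$. Then $$gp_{\lambda/\mu}=\sum_{T\in\mathrm{ShRPP}_P(\lambda/\mu)}(-\beta)^{|\lambda/\mu|-|\mathrm{wt}(T)|}x^{\mathrm{wt}(T)},\qquad gq_{\lambda/\mu}=\sum_{T\in\mathrm{ShRPP}_Q(\lambda/\mu)}(-\beta)^{|\lambda/\mu|-|\mathrm{wt}(T)|}x^{\mathrm{wt}(T)},$$ $$jp_{\lambda/\mu}=\sum_{T\in\mathrm{ShBT}_P(\lambda/\mu)}(-\beta)^{|\lambda/\mu|-|T|}x^{T},\qquad jq_{\lambda/\mu}=\sum_{T\in\mathrm{ShBT}_Q(\lambda/\mu)}(-\beta)^{|\lambda/\mu|-|T|}x^{T}.$$ -/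

import Mathlib

namespace KSchur

noncomputable section

/-- The ring of power series in `x₁, x₂, …` over `ℤ[β]`. The polynomial variable is `β` and
the index `i : ℕ` stands for the variable `x_{i+1}`. -/
abbrev PS : Type := MvPowerSeries ℕ (Polynomial ℤ)

/-- The parameter `β`. -/
abbrev β : Polynomial ℤ := Polynomial.X

/-! ### Strict partitions and shifted diagrams -/

/-- A strict partition `λ₁ > λ₂ > ⋯ > 0`. -/
@[ext]
structure StrictPartition where
  parts : List ℕ
  decreasing : parts.Pairwise (· > ·)
  pos : ∀ p ∈ parts, 0 < p

namespace StrictPartition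

/-- The number `ℓ(λ)` of parts. -/
def length (lam : StrictPartition) : ℕ := lam.parts.length

/-- The part with (zero-based) index `i`, which is `0` beyond the length. -/
def part (lam : StrictPartition) (i : ℕ) : ℕ := lam.parts.getD i 0

/-- Containment: `μ ⊆ λ` if `μᵢ ≤ λᵢ` for all `i`. -/
instance : HasSubset StrictPartition := ⟨fun mu lam => ∀ i, mu.part i ≤ lam.part i⟩

/-- The shifted diagram: the boxes `(i, j)` (row, column) with `i ≤ j < i + λᵢ`.
Rows and columns are numbered from zero. -/
def SD (lam : StrictPartition) : Finset (ℕ × ℕ) :=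
  (Finset.range lam.length).biUnion fun i => {i} ×ˢ Finset.Ico i (i + lam.part i)

/-- The skew shifted diagram of `λ/μ`. -/
def skewSD (lam mu : StrictPartition) : Finset (ℕ × ℕ) := lam.SD \ mu.SD

end StrictPartition

/-! ### Letters and generating functions -/

/-- The letters `1' < 1 < 2' < 2 < ⋯`. The pair `(i, false)` is the primed number `(i+1)'`
and `(i, true)` is the unprimed number `i+1`; the order is lexicographic. -/
abbrev Letter : Type := ℕ ×ₗ Bool

/-- The primed number of index `i`. -/
def primed (i : ℕ) : Letter := toLex (i, false)

/-- The unprimed number of index `i`. -/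
def unprimed (i : ℕ) : Letter := toLex (i, true)

/-- The index `i` of either of the two letters `primed i` and `unprimed i`. -/
def Letter.index (a : Letter) : ℕ := (ofLex a).1

/-- Being one of the primed numbers. -/
def Letter.IsPrimed (a : Letter) : Prop := (ofLex a).2 = false

/-- The formal sum `∑_T c(T) x^{wt(T)}`, as a power series. It is only used when each weight
occurs finitely often. -/
def genFun {τ : Type} (wt : τ → ℕ → ℕ) (c : τ → Polynomial ℤ) : PS :=
  fun α : ℕ →₀ ℕ => ∑ᶠ T : {T : τ // wt T = α}, c T.1

/-! ### Set-valued shifted tableaux; the functions `GP` and `GQ` -/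

/-- Semistandard set-valued fillings of a diagram `D`. -/
structure IsSetSemistandard (D : Finset (ℕ × ℕ)) (T : D → Finset Letter) : Prop where
  nonempty : ∀ b, (T b).Nonempty
  row_weak : ∀ b b' : D, b.1.1 = b'.1.1 → b.1.2 < b'.1.2 → ∀ a ∈ T b, ∀ a' ∈ T b', a ≤ a'
  col_weak : ∀ b b' : D, b.1.2 = b'.1.2 → b.1.1 < b'.1.1 → ∀ a ∈ T b, ∀ a' ∈ T b', a ≤ a'
  col_unprimed : ∀ b b' : D, b.1.2 = b'.1.2 → ∀ i, unprimed i ∈ T b → unprimed i ∈ T b' → b = b'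
  row_primed : ∀ b b' : D, b.1.1 = b'.1.1 → ∀ i, primed i ∈ T b → primed i ∈ T b' → b = b'

/-- The set-valued `Q`-shifted tableaux of shape `λ`. -/
def SetShYTQ (lam : StrictPartition) : Type :=
  {T : lam.SD → Finset Letter // IsSetSemistandard lam.SD T}

/-- The set-valued `P`-shifted tableaux of shape `λ`: no primed number on the diagonal. -/
def SetShYTP (lam : StrictPartition) : Type :=
  {T : lam.SD → Finset Letter // IsSetSemistandard lam.SD T ∧
    ∀ b : lam.SD, b.1.1 = b.1.2 → ∀ a ∈ T b, ¬ Letter.IsPrimed a}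

/-- The number of occurrences of `i` or `i'` in a set-valued filling. -/
def setWeight {D : Finset (ℕ × ℕ)} (T : D → Finset Letter) (i : ℕ) : ℕ :=
  ∑ b, ((T b).filter fun a => Letter.index a = i).card

/-- The total number `|T|` of letters in a set-valued filling. -/
def setSize {D : Finset (ℕ × ℕ)} (T : D → Finset Letter) : ℕ := ∑ b, (T b).card

/-- The `K`-theoretic Schur `P`-function. -/
def GP (lam : StrictPartition) : PS :=
  genFun (fun T : SetShYTP lam => setWeight T.1) fun T => β ^ (setSize T.1 - lam.SD.card)

/-- The `K`-theoretic Schur `Q`-function. -/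
def GQ (lam : StrictPartition) : PS :=
  genFun (fun T : SetShYTQ lam => setWeight T.1) fun T => β ^ (setSize T.1 - lam.SD.card)

/-! ### Expansions into families of power series -/

/-- The identity `f = ∑_l c_l G_l` of power series in `x₁, x₂, …`, where the coefficients `c_l`
and those of `f` lie in a `ℤ[β]`-algebra `M`. The families `G` in use are such that a given
monomial occurs in `G_l` for finitely many `l` only. -/
def IsExpansion {ι M : Type} [CommRing M] [Algebra (Polynomial ℤ) M]
    (G : ι → PS) (f : MvPowerSeries ℕ M) (c : ι → M) : Prop :=
  ∀ α : ℕ →₀ ℕ, MvPowerSeries.coeff α f = ∑ᶠ l, MvPowerSeries.coeff α (G l) • c l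

/-- The identity `f(x₁, …, x_n) = ∑_l c_l G_l(x₁, …, x_n)`. -/
def IsExpansionIn {ι M : Type} [CommRing M] [Algebra (Polynomial ℤ) M]
    (n : ℕ) (G : ι → PS) (f : MvPowerSeries ℕ M) (c : ι → M) : Prop :=
  ∀ α : ℕ →₀ ℕ, (∀ i ∈ α.support, i < n) →
    MvPowerSeries.coeff α f = ∑ᶠ l, MvPowerSeries.coeff α (G l) • c l

open Classical in
/-- The coefficient of `G_λ` in the expansion `f = ∑_ν c_ν G_ν` over all strict partitions,
for `G = GP` or `G = GQ`, whose expansions are unique. For completeness, a series without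
such an expansion is given the coefficient of `G_λ` in the expansion of `f(x₁, …, x_{ℓ(λ)})`,
and `0` if that does not exist either. -/
def coefficient {M : Type} [CommRing M] [Algebra (Polynomial ℤ) M]
    (G : StrictPartition → PS) (f : MvPowerSeries ℕ M) (lam : StrictPartition) : M :=
  if h : ∃ c : StrictPartition → M, IsExpansion G f c then h.choose lam
  else if h : ∃ c : StrictPartition → M, IsExpansionIn lam.length G f c then h.choose lam
  else 0

/-! ### The Cauchy kernel and the dual functions -/

/-- Power series in `x₁, x₂, …` whose coefficients are power series in `y₁, y₂, …`. -/
abbrev PS₂ : Type := MvPowerSeries ℕ PS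

/-- The variable `x_{i+1}`. -/
def xVar (i : ℕ) : PS₂ := MvPowerSeries.X i

/-- The variable `y_{j+1}`. -/
def yVar (j : ℕ) : PS₂ := MvPowerSeries.C (MvPowerSeries.X j)

/-- The element `-x / (1 + β x)` for `x = x_{i+1}`. -/
def xBar (i : ℕ) : PS₂ :=
  -xVar i * MvPowerSeries.invOfUnit
    (1 + MvPowerSeries.C (MvPowerSeries.C β) * xVar i) 1

/-- The factor `(1 - x̄ y) / (1 - x y)` for `x = x_{i+1}` and `y = y_{j+1}`. -/
def cauchyFactor (i j : ℕ) : PS₂ :=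
  (1 - xBar i * yVar j) * MvPowerSeries.invOfUnit (1 - xVar i * yVar j) 1

/-- The infinite product of the factors `cauchyFactor i j` over all `i` and `j`. All terms of
such a factor except for the constant term `1` are divisible by `x_{i+1} y_{j+1}`, so only the
factors whose variables both occur in a monomial contribute to the coefficient of that monomial. -/
def cauchyKernel : PS₂ := fun α : ℕ →₀ ℕ => fun γ : ℕ →₀ ℕ =>
  MvPowerSeries.coeff γ (MvPowerSeries.coeff α
    (∏ i ∈ α.support, ∏ j ∈ γ.support, cauchyFactor i j))

/-- The dual function `gp_λ`: the family `gp` is determined by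
`∑_λ GQ_λ(x) gp_λ(y) = ∏_{i,j} (1 - x̄_i y_j) / (1 - x_i y_j)`. -/
def gp (lam : StrictPartition) : PS := coefficient GQ cauchyKernel lam

/-- The dual function `gq_λ`: the family `gq` is determined by
`∑_λ GP_λ(x) gq_λ(y) = ∏_{i,j} (1 - x̄_i y_j) / (1 - x_i y_j)`. -/
def gq (lam : StrictPartition) : PS := coefficient GP cauchyKernel lam

/-- The coefficient of `GP_λ` in `GP_μ GP_ν`, that is, `a_{μν}^λ β^{|λ|-|μ|-|ν|}`. -/
def aCoeff (mu nu lam : StrictPartition) : Polynomial ℤ := coefficient GP (GP mu * GP nu) lam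

/-- The coefficient of `GQ_λ` in `GQ_μ GQ_ν`, that is, `b_{μν}^λ β^{|λ|-|μ|-|ν|}`. -/
def bCoeff (mu nu lam : StrictPartition) : Polynomial ℤ := coefficient GQ (GQ mu * GQ nu) lam

/-- The skew dual function `gp_{λ/μ} = ∑_ν b_{μν}^λ β^{|λ|-|μ|-|ν|} gp_ν`. -/
def gpSkew (lam mu : StrictPartition) : PS := ∑ᶠ nu, bCoeff mu nu lam • gp nu

/-- The skew dual function `gq_{λ/μ} = ∑_ν a_{μν}^λ β^{|λ|-|μ|-|ν|} gq_ν`. -/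
def gqSkew (lam mu : StrictPartition) : PS := ∑ᶠ nu, aCoeff mu nu lam • gq nu

/-! ### Schur functions and the involution `ω` -/

/-- The Schur function of a partition, as a sum over semistandard tableaux. -/
def schur (D : YoungDiagram) : PS :=
  genFun (fun (T : SemistandardYoungTableau D) i => (D.cells.filter fun b => T b.1 b.2 = i).card)
    fun _ => 1

open Classical in
/-- The operator `ω`, which sends `∑_λ c_λ s_λ` to `∑_λ c_λ s_{λᵀ}` (infinite combinations are
allowed), extended by zero to series that are not of this form. -/
def omega (f : PS) : PS :=
  if h : ∃ c : YoungDiagram → Polynomial ℤ, IsExpansion schur f c then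
    fun α : ℕ →₀ ℕ => ∑ᶠ D : YoungDiagram, h.choose D * MvPowerSeries.coeff α (schur D.transpose)
  else 0

/-- The function `jp_{λ/μ} = ω(gp_{λ/μ})`. -/
def jpSkew (lam mu : StrictPartition) : PS := omega (gpSkew lam mu)

/-- The function `jq_{λ/μ} = ω(gq_{λ/μ})`. -/
def jqSkew (lam mu : StrictPartition) : PS := omega (gqSkew lam mu)

/-! ### Shifted reverse plane partitions -/

/-- Fillings of a diagram with weakly increasing rows and columns. -/
structure IsRPP (D : Finset (ℕ × ℕ)) (T : D → Letter) : Prop where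
  row_weak : ∀ b b' : D, b.1.1 = b'.1.1 → b.1.2 < b'.1.2 → T b ≤ T b'
  col_weak : ∀ b b' : D, b.1.2 = b'.1.2 → b.1.1 < b'.1.1 → T b ≤ T b'

/-- The shifted reverse plane partitions of shape `λ/μ`. -/
def ShRPPQ (lam mu : StrictPartition) : Type :=
  {T : lam.skewSD mu → Letter // IsRPP (lam.skewSD mu) T}

/-- The shifted reverse plane partitions of shape `λ/μ` with all diagonal entries primed. -/
def ShRPPP (lam mu : StrictPartition) : Type :=
  {T : lam.skewSD mu → Letter // IsRPP (lam.skewSD mu) T ∧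
    ∀ b : lam.skewSD mu, b.1.1 = b.1.2 → Letter.IsPrimed (T b)}

/-- The number of distinct columns containing `i` plus the number of distinct rows
containing `i'`. -/
def rppWeight {D : Finset (ℕ × ℕ)} (T : D → Letter) (i : ℕ) : ℕ :=
  {j : ℕ | ∃ b : D, b.1.2 = j ∧ T b = unprimed i}.ncard +
    {k : ℕ | ∃ b : D, b.1.1 = k ∧ T b = primed i}.ncard

/-- The generating function of `ShRPPP λ μ`, each `T` with the
coefficient `(-β)^{|λ/μ| - |wt(T)|}`. -/
def rppGenP (lam mu : StrictPartition) : PS :=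
  genFun (fun T : ShRPPP lam mu => rppWeight T.1)
    fun T => (-β) ^ ((lam.skewSD mu).card - ∑ᶠ i, rppWeight T.1 i)

/-- The generating function of `ShRPPQ λ μ`, each `T` with the
coefficient `(-β)^{|λ/μ| - |wt(T)|}`. -/
def rppGenQ (lam mu : StrictPartition) : PS :=
  genFun (fun T : ShRPPQ lam mu => rppWeight T.1)
    fun T => (-β) ^ ((lam.skewSD mu).card - ∑ᶠ i, rppWeight T.1 i)

/-! ### Shifted bar tableaux -/

/-- Semistandard (single-valued) fillings of a diagram. -/
structure IsSemistandard (D : Finset (ℕ × ℕ)) (V : D → Letter) : Prop extends IsRPP D V where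
  col_unprimed : ∀ b b' : D, b.1.2 = b'.1.2 → ∀ i, V b = unprimed i → V b' = unprimed i → b = b'
  row_primed : ∀ b b' : D, b.1.1 = b'.1.1 → ∀ i, V b = primed i → V b' = primed i → b = b'

/-- A set of contiguous boxes within a single row or a single column. -/
def IsBar (B : Finset (ℕ × ℕ)) : Prop :=
  (∃ i a c, B = {i} ×ˢ Finset.Icc a c) ∨ (∃ j a c, B = Finset.Icc a c ×ˢ {j})

/-- The pair of `V` and `P` is a shifted bar tableau: `V` is semistandard and `P` is a partition
of the diagram into contiguous bars on each of which `V` is constant. (By semistandardness every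
connected set of boxes with the same entry is such a bar.) -/
structure IsBarTableau {D : Finset (ℕ × ℕ)} (V : D → Letter) (P : Finpartition D) : Prop where
  semistandard : IsSemistandard D V
  bar : ∀ B ∈ P.parts, IsBar B
  constant : ∀ B ∈ P.parts, ∀ b b' : D, b.1 ∈ B → b'.1 ∈ B → V b = V b'

/-- The shifted bar tableaux of shape `λ/μ`. -/
def ShBTQ (lam mu : StrictPartition) : Type :=
  {T : (lam.skewSD mu → Letter) × Finpartition (lam.skewSD mu) // IsBarTableau T.1 T.2}

/-- The shifted bar tableaux of shape `λ/μ` with no primed diagonal entries. -/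
def ShBTP (lam mu : StrictPartition) : Type :=
  {T : (lam.skewSD mu → Letter) × Finpartition (lam.skewSD mu) // IsBarTableau T.1 T.2 ∧
    ∀ b : lam.skewSD mu, b.1.1 = b.1.2 → ¬ Letter.IsPrimed (T.1 b)}

/-- The number of blocks containing `i` or `i'`. -/
def barWeight {D : Finset (ℕ × ℕ)} (V : D → Letter) (P : Finpartition D) (i : ℕ) : ℕ :=
  {B : Finset (ℕ × ℕ) | B ∈ P.parts ∧ ∃ b : D, b.1 ∈ B ∧ Letter.index (V b) = i}.ncard

/-- The generating function of `ShBTP λ μ`, each `T` with the coefficient `(-β)^{|λ/μ| - |T|}`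
where `|T|` is the number of blocks. -/
def barGenP (lam mu : StrictPartition) : PS :=
  genFun (fun T : ShBTP lam mu => barWeight T.1.1 T.1.2)
    fun T => (-β) ^ ((lam.skewSD mu).card - T.1.2.parts.card)

/-- The generating function of `ShBTQ λ μ`, each `T` with the coefficient `(-β)^{|λ/μ| - |T|}`
where `|T|` is the number of blocks. -/
def barGenQ (lam mu : StrictPartition) : PS :=
  genFun (fun T : ShBTQ lam mu => barWeight T.1.1 T.1.2)
    fun T => (-β) ^ ((lam.skewSD mu).card - T.1.2.parts.card)

end

end KSchur

/-!
The diagrams `SD_{λ/μ}` with `ℓ(λ) ≤ 1` have a single row, and only one variable `x` matters.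
Indeed `GP_λ` and `GQ_λ` vanish at `(x, 0, 0, …)` if `λ` has two parts or more, while there
`GP_{(n)} = x^n` and, for `n ≥ 1`, `GQ_{(n)} = (2 + βx) x^n` (`coeff_GP`, `coeff_GQ_oneRow_succ`).
Hence the coefficient of `GP_{(n)}` or `GQ_{(n)}` in any series can be read off after setting the
other variables to zero (`coefficient_GP`, `coefficient_GQ`). No expansions in all variables are
needed: whichever clause of the definition of `coefficient` applies, it gives an expansion in one
variable, and such an expansion is unique.

With `v = 1 / (1 + βx)`, the Cauchy kernel becomes `∏_j (1 + xv y_j) / (1 - x y_j)`, in which the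
coefficient of `y^γ` is `x^k (1 + v)^r`, where `k` is the degree of `γ` and `r` the number of
variables in `y^γ` (`coeff_cauchyKernel`). So `gq_{(n)/(m)}` has the coefficient
`[x^{n-m}] x^k (1 + v)^r` at `y^γ`; the same holds for `gp_{(n)/(m)}` if `m ≥ 1`, and
`gp_{(n)}` has the coefficient `[x^n] x^k v (1 + v)^{r-1}` for `γ ≠ 0` and `n ≥ 1`, because
`1 + v = (2 + βx) v`.

Reverse plane partitions with a single row are multisets of letters. One of weight `γ` is given by
the set `S` of the numbers that occur primed and by the repetitions of the primed letters, which
form a multiset with elements in `S`. This yields the same coefficients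
(`coeff_rpp_rowDiagram`). Bar tableaux with a single row are weakly increasing labelings of the
boxes by blocks, and are counted in the same way: now the unprimed blocks are the ones that may
have more than one box, and `(1 + v)^r` is replaced by `(1 + v)^r v^{k-r}`
(`coeff_bar_rowDiagram`).

It remains to see that `ω` turns the first kind of series into the second. The coefficient of
`y^γ` in the Schur function of the hook with `k` cells, `b` of them below the corner, is
`binom(r - 1, b)` (`coeff_schur_hook`). By Pascal's rule
`(1 + v)^r = ∑_b binom(r - 1, b) (v^b + v^{b+1})`, so the first series is a combination of hooks,
and replacing `b` by `k - 1 - b` gives the second one (`omega_eq_of_closed_form`). The condition on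
the diagonal replaces `v^b + v^{b+1}` by `v^{b+1}`. The operator `ω` is computed by this expansion
since expansions into Schur functions are unique, by triangularity with respect to the dominance
order (`eq_zero_of_finsum_schur`).
-/

namespace KSchur

/-! ### Generating functions and weakly increasing words -/

/-- This holds for infinitely many fillings of weight `γ` too: then `finsum` and `Nat.card` are both
zero. -/
lemma coeff_genFun_of_const {τ : Type} (wt : τ → ℕ → ℕ) (c : τ → Polynomial ℤ) (γ : ℕ →₀ ℕ)
    (c₀ : Polynomial ℤ) (h : ∀ T, wt T = γ → c T = c₀) :
    MvPowerSeries.coeff γ (genFun wt c) = (Nat.card {T : τ // wt T = γ} : Polynomial ℤ) * c₀ := by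
  change ∑ᶠ T : {T : τ // wt T = γ}, c T.1 = _
  rw [finsum_congr fun T : {T : τ // wt T = γ} => h T.1 T.2]
  rcases finite_or_infinite {T : τ // wt T = γ} with hf | hf
  · have := Fintype.ofFinite {T : τ // wt T = γ}
    rw [finsum_eq_sum_of_fintype, Finset.sum_const, Finset.card_univ, nsmul_eq_mul,
      Nat.card_eq_fintype_card]
  · rw [Nat.card_eq_zero_of_infinite, Nat.cast_zero, zero_mul]
    by_cases h0 : c₀ = 0
    · simp [h0]
    · refine finsum_of_infinite_support ?_
      rw [Function.support_const h0]
      exact Set.infinite_univ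

section Words

variable {ι α : Type} [Fintype ι] [PartialOrder ι] {N : ℕ}

lemma map_univ_eq_ofFn (e : Fin N ≃o ι) (T : ι → α) :
    Finset.univ.val.map T = (List.ofFn (T ∘ e) : Multiset α) := by
  have h : (Finset.univ : Finset ι) = Finset.univ.map e.toEquiv.toEmbedding := by simp
  rw [h, Finset.map_val, Multiset.map_map]
  exact (Fin.univ_val_map (T ∘ e))

variable [LinearOrder α]

/-- A weakly increasing word is determined by the multiset of its letters. -/
lemma monotone_eq_of_map_eq (e : Fin N ≃o ι) {T T' : ι → α} (hT : Monotone T) (hT' : Monotone T')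
    (h : Finset.univ.val.map T = Finset.univ.val.map T') : T = T' := by
  rw [map_univ_eq_ofFn e, map_univ_eq_ofFn e, Multiset.coe_eq_coe] at h
  have h2 := List.Perm.eq_of_sortedLE (List.sortedLE_ofFn_iff.2 (hT.comp e.monotone))
    (List.sortedLE_ofFn_iff.2 (hT'.comp e.monotone)) h
  have h3 := List.ofFn_injective h2
  funext b
  simpa using congrFun h3 (e.symm b)

/-- Every multiset of the right size is the multiset of letters of a weakly increasing word. -/
lemma exists_monotone_map_eq (e : Fin N ≃o ι) (s : Multiset α) (hs : Multiset.card s = N) :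
    ∃ T : ι → α, Monotone T ∧ Finset.univ.val.map T = s := by
  have hl : (s.sort (· ≤ ·)).length = N := by rw [Multiset.length_sort, hs]
  subst hl
  refine ⟨(s.sort (· ≤ ·)).get ∘ e.symm, ?_, ?_⟩
  · exact Monotone.comp ((Multiset.pairwise_sort s (· ≤ ·)).sortedLE.monotone_get) e.symm.monotone
  · rw [map_univ_eq_ofFn e]
    have : ((s.sort (· ≤ ·)).get ∘ e.symm) ∘ e = (s.sort (· ≤ ·)).get := by
      funext i; simp
    rw [this, List.ofFn_get, Multiset.sort_eq]

end Words

/-- Weakly increasing words are counted by the multisets of their letters. -/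
lemma ncard_monotone {ι α : Type} [Fintype ι] [PartialOrder ι] [LinearOrder α] {N : ℕ}
    (e : Fin N ≃o ι) (P : Multiset α → Prop) :
    {T : ι → α | Monotone T ∧ P (Finset.univ.val.map T)}.ncard =
      {s : Multiset α | Multiset.card s = N ∧ P s}.ncard := by
  rw [← Set.InjOn.ncard_image (f := fun T : ι → α => Finset.univ.val.map T)]
  · congr 1
    ext s
    constructor
    · rintro ⟨T, ⟨hT, hP⟩, rfl⟩
      refine ⟨?_, hP⟩
      have := Fintype.card_congr e.toEquiv
      rw [Fintype.card_fin] at this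
      simp [this]
    · rintro ⟨hs, hP⟩
      obtain ⟨T, hT, rfl⟩ := exists_monotone_map_eq e s hs
      exact ⟨T, ⟨hT, hP⟩, rfl⟩
  · intro T hT T' hT' h
    exact monotone_eq_of_map_eq e hT.1 hT'.1 h

/-! ### Diagrams with a single row -/

/-- The boxes of the first row in the columns `m, …, n - 1`. -/
abbrev rowDiagram (m n : ℕ) : Finset (ℕ × ℕ) := {0} ×ˢ Finset.Ico m n

lemma rowDiagram_fst {m n : ℕ} (b : rowDiagram m n) : b.1.1 = 0 := by
  have := b.2
  rw [Finset.mem_product, Finset.mem_singleton] at this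
  exact this.1

lemma rowDiagram_snd {m n : ℕ} (b : rowDiagram m n) : m ≤ b.1.2 ∧ b.1.2 < n := by
  have := b.2
  rw [Finset.mem_product, Finset.mem_Ico] at this
  exact this.2

lemma rowDiagram_ext {m n : ℕ} {b b' : rowDiagram m n} (h : b.1.2 = b'.1.2) : b = b' :=
  Subtype.ext (Prod.ext ((rowDiagram_fst b).trans (rowDiagram_fst b').symm) h)

lemma rowDiagram_le_iff {m n : ℕ} {b b' : rowDiagram m n} : b ≤ b' ↔ b.1.2 ≤ b'.1.2 := by
  rw [← Subtype.coe_le_coe, Prod.le_def]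
  simp [rowDiagram_fst]

lemma card_rowDiagram (m n : ℕ) : (rowDiagram m n).card = n - m := by simp

/-- The boxes of a row, numbered from left to right. -/
def rowIso (m n : ℕ) : Fin (n - m) ≃o rowDiagram m n where
  toFun i := ⟨(0, m + i), by simp; omega⟩
  invFun b := ⟨b.1.2 - m, by have := rowDiagram_snd b; omega⟩
  left_inv i := by simp
  right_inv b := rowDiagram_ext (by have := rowDiagram_snd b; simp; omega)
  map_rel_iff' := by
    intro a b
    rw [rowDiagram_le_iff]
    simp

lemma isRPP_rowDiagram_iff {m n : ℕ} (T : rowDiagram m n → Letter) :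
    IsRPP (rowDiagram m n) T ↔ Monotone T := by
  constructor
  · intro h b b' hb
    rw [rowDiagram_le_iff] at hb
    rcases hb.lt_or_eq with h1 | h1
    · exact h.row_weak b b' ((rowDiagram_fst b).trans (rowDiagram_fst b').symm) h1
    · rw [rowDiagram_ext h1]
  · intro h
    constructor
    · intro b b' _ h2
      exact h (rowDiagram_le_iff.2 h2.le)
    · intro b b' _ h2
      rw [rowDiagram_fst, rowDiagram_fst] at h2
      exact absurd h2 (lt_irrefl _)

/-! ### Sums over subsets -/

/-- Subsets of `U` that contain `i` are counted through the remaining elements of `U`. -/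
lemma sum_powerset_filter_mem {U : Finset ℕ} {i : ℕ} (hi : i ∈ U) (f : ℕ → ℕ) :
    ∑ S ∈ U.powerset with i ∈ S, f S.card =
      ∑ j ∈ Finset.range U.card, (U.card - 1).choose j * f (j + 1) := by
  have h1 : (U.powerset.filter fun S => i ∈ S) = (U.erase i).powerset.image (insert i) := by
    ext S
    simp only [Finset.mem_filter, Finset.mem_powerset, Finset.mem_image]
    constructor
    · rintro ⟨h, h'⟩
      exact ⟨S.erase i, Finset.erase_subset_erase i h, Finset.insert_erase h'⟩
    · rintro ⟨R, hR, rfl⟩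
      refine ⟨Finset.insert_subset hi (hR.trans (Finset.erase_subset _ _)),
        Finset.mem_insert_self _ _⟩
  have hni : ∀ R ∈ (U.erase i).powerset, i ∉ R := fun R hR h =>
    Finset.notMem_erase i U (Finset.mem_powerset.1 hR h)
  rw [h1, Finset.sum_image]
  · rw [Finset.sum_congr rfl fun R hR => by rw [Finset.card_insert_of_notMem (hni R hR)],
      Finset.sum_powerset_apply_card (fun j => f (j + 1)), Finset.card_erase_of_mem hi,
      Nat.sub_add_cancel (Finset.card_pos.2 ⟨i, hi⟩)]
    simp
  · intro R hR R' hR' h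
    rw [← Finset.erase_insert (hni R hR), h, Finset.erase_insert (hni R' hR')]

lemma sum_powerset_filter_notMem {U : Finset ℕ} {i : ℕ} (hi : i ∈ U) (f : ℕ → ℕ) :
    ∑ S ∈ U.powerset with i ∉ S, f S.card =
      ∑ j ∈ Finset.range U.card, (U.card - 1).choose j * f j := by
  have h1 : (U.powerset.filter fun S => i ∉ S) = (U.erase i).powerset := by
    ext S
    simp [Finset.subset_erase]
  rw [h1, Finset.sum_powerset_apply_card f, Finset.card_erase_of_mem hi,
      Nat.sub_add_cancel (Finset.card_pos.2 ⟨i, hi⟩)]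
  simp

lemma card_finset_sym {α : Type} [DecidableEq α] (S : Finset α) (n : ℕ) :
    (S.sym n).card = S.card.multichoose n := by
  have h : S.sym n = Finset.univ.image (Sym.map ((↑) : S → α) (n := n)) := by
    ext s
    simp only [Finset.mem_sym_iff, Finset.mem_image, Finset.mem_univ, true_and]
    constructor
    · intro hs
      refine ⟨s.attach.map fun x => ⟨x.1, hs x.1 x.2⟩, ?_⟩
      rw [Sym.map_map]
      exact Sym.attach_map_coe s
    · rintro ⟨u, rfl⟩ a ha
      obtain ⟨b, -, rfl⟩ := Sym.mem_map.1 ha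
      exact b.2
  rw [h, Finset.card_image_of_injective _ (Sym.map_injective Subtype.val_injective n),
    Finset.card_univ, Sym.card_sym_eq_multichoose, Fintype.card_coe]

/-! ### Reverse plane partitions with a single row -/

/-- The letters of a filling of a row which has weight `γ` and in which the primed numbers in use
are those of the set `S`. In a single row, all occurrences of `i'` together contribute one to the
weight and each occurrence of `i` contributes one. So for `i ∈ S` the letter `i'` occurs once, or
more often as listed in `t`, and the letter `i` occurs `γ i - 1` times; for `i ∉ S` the letter `i`
occurs `γ i` times. -/
noncomputable def rppContent (γ : ℕ →₀ ℕ) (S : Finset ℕ) (t : Multiset ℕ) : Multiset Letter :=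
  (S.val + t).map primed + (Finsupp.toMultiset γ - S.val).map unprimed

lemma primed_injective : Function.Injective primed := fun i j h => by
  simpa [primed] using h

lemma unprimed_injective : Function.Injective unprimed := fun i j h => by
  simpa [unprimed] using h

lemma primed_ne_unprimed (i j : ℕ) : primed i ≠ unprimed j := by
  simp [primed, unprimed]

lemma eq_primed_or_unprimed (a : Letter) : a = primed a.index ∨ a = unprimed a.index := by
  rcases h : (ofLex a).2 with _ | _
  · left
    exact ofLex.injective (Prod.ext rfl h)
  · right
    exact ofLex.injective (Prod.ext rfl h)

lemma count_primed_rppContent (γ : ℕ →₀ ℕ) (S : Finset ℕ) (t : Multiset ℕ) (i : ℕ) :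
    (rppContent γ S t).count (primed i) = S.val.count i + t.count i := by
  rw [rppContent, Multiset.count_add, Multiset.count_map_eq_count' _ _ primed_injective,
    Multiset.count_add]
  rw [Multiset.count_eq_zero_of_notMem (a := primed i) (s := Multiset.map unprimed _), add_zero]
  simp [(primed_ne_unprimed _ _).symm]

lemma count_unprimed_rppContent (γ : ℕ →₀ ℕ) (S : Finset ℕ) (t : Multiset ℕ) (i : ℕ) :
    (rppContent γ S t).count (unprimed i) = γ i - S.val.count i := by
  rw [rppContent, Multiset.count_add, Multiset.count_map_eq_count' _ _ unprimed_injective,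
    Multiset.count_sub, Finsupp.count_toMultiset]
  rw [Multiset.count_eq_zero_of_notMem (a := unprimed i) (s := Multiset.map primed _), zero_add]
  simp only [Multiset.mem_map, not_exists, not_and]
  exact fun j _ => primed_ne_unprimed j i

lemma count_val_finset (S : Finset ℕ) (i : ℕ) : S.val.count i = if i ∈ S then 1 else 0 := by
  rw [Multiset.count_eq_of_nodup S.nodup]; simp

lemma val_le_toMultiset {γ : ℕ →₀ ℕ} {S : Finset ℕ} (hS : S ⊆ γ.support) :
    S.val ≤ Finsupp.toMultiset γ := by
  rw [Multiset.le_iff_count]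
  intro i
  rw [count_val_finset, Finsupp.count_toMultiset]
  split_ifs with h
  · exact Nat.one_le_iff_ne_zero.2 (Finsupp.mem_support_iff.1 (hS h))
  · exact Nat.zero_le _

lemma mem_rppContent_primed {γ : ℕ →₀ ℕ} {S : Finset ℕ} {t : Multiset ℕ} (ht : ∀ i ∈ t, i ∈ S)
    (i : ℕ) : primed i ∈ rppContent γ S t ↔ i ∈ S := by
  rw [← Multiset.count_pos, count_primed_rppContent, count_val_finset]
  split_ifs with h
  · simp [h]
  · simp only [h, iff_false, zero_add, Multiset.count_pos]
    exact fun h' => h (ht i h')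

lemma letter_multiset_ext {s s' : Multiset Letter}
    (h : ∀ i, s.count (primed i) = s'.count (primed i))
    (h' : ∀ i, s.count (unprimed i) = s'.count (unprimed i)) : s = s' := by
  ext a
  rcases eq_primed_or_unprimed a with ha | ha <;> rw [ha]
  · exact h _
  · exact h' _

/-- The condition on the letters of a filling of a row that the filling has weight `γ`. -/
def HasRppWeight (γ : ℕ →₀ ℕ) (s : Multiset Letter) : Prop :=
  ∀ i, s.count (unprimed i) + (if primed i ∈ s then 1 else 0) = γ i

lemma card_rppContent {γ : ℕ →₀ ℕ} {S : Finset ℕ} (hS : S ⊆ γ.support) (t : Multiset ℕ) :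
    Multiset.card (rppContent γ S t) = γ.degree + Multiset.card t := by
  have h1 := Multiset.card_le_card (val_le_toMultiset hS)
  rw [rppContent, Multiset.card_add, Multiset.card_map, Multiset.card_map, Multiset.card_add,
    Multiset.card_sub (val_le_toMultiset hS)]
  have h2 : Multiset.card (Finsupp.toMultiset γ) = γ.degree := by
    rw [Finsupp.card_toMultiset]; rfl
  omega

lemma hasRppWeight_rppContent {γ : ℕ →₀ ℕ} {S : Finset ℕ} (hS : S ⊆ γ.support) {t : Multiset ℕ}
    (ht : ∀ i ∈ t, i ∈ S) : HasRppWeight γ (rppContent γ S t) := by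
  intro i
  have h := Multiset.le_iff_count.1 (val_le_toMultiset hS) i
  rw [Finsupp.count_toMultiset] at h
  rw [count_unprimed_rppContent, count_val_finset] at *
  simp only [mem_rppContent_primed ht]
  omega

/-- The set `S` consists of the numbers that occur primed, and `t` of their repetitions. -/
lemma exists_rppContent {γ : ℕ →₀ ℕ} {s : Multiset Letter} (hs : HasRppWeight γ s) :
    ∃ S ⊆ γ.support, ∃ t : Multiset ℕ, (∀ i ∈ t, i ∈ S) ∧ rppContent γ S t = s := by
  classical
  set S := γ.support.filter fun i => primed i ∈ s with hSdef
  have hmem : ∀ i, i ∈ S ↔ primed i ∈ s := by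
    intro i
    rw [hSdef, Finset.mem_filter, Finsupp.mem_support_iff, and_iff_right_iff_imp]
    intro h
    have := hs i
    rw [if_pos h] at this
    omega
  set u : Multiset ℕ := (s.filter Letter.IsPrimed).map Letter.index with hu
  have hcu : ∀ i, u.count i = s.count (primed i) := by
    intro i
    rw [hu, Multiset.count_map, Multiset.filter_filter, ← Multiset.countP_eq_card_filter,
      Multiset.count]
    refine Multiset.countP_congr rfl fun a _ => ?_
    apply propext
    constructor
    · rintro ⟨rfl, h⟩
      exact (ofLex.injective (Prod.ext rfl h.symm))
    · rintro rfl
      exact ⟨rfl, rfl⟩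
  have hle : S.val ≤ u := by
    rw [Multiset.le_iff_count]
    intro i
    rw [hcu, count_val_finset]
    split_ifs with h
    · exact Multiset.count_pos.2 ((hmem i).1 h)
    · exact Nat.zero_le _
  refine ⟨S, Finset.filter_subset _ _, u - S.val, ?_, letter_multiset_ext ?_ ?_⟩
  · intro i hi
    rw [hmem, ← Multiset.count_pos, ← hcu]
    exact Multiset.count_pos.2 (Multiset.mem_of_le (Multiset.sub_le_self _ _) hi)
  · intro i
    have := Multiset.le_iff_count.1 hle i
    rw [count_primed_rppContent, Multiset.count_sub, ← hcu]
    omega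
  · intro i
    have := hs i
    rw [count_unprimed_rppContent, count_val_finset]
    simp only [hmem]
    omega

open Classical in
/-- A multiset of letters of weight `γ` with `M` letters more than the degree of `γ` is a set `S` of
numbers that occur primed together with a multiset of `M` elements of `S`. -/
lemma ncard_hasRppWeight (γ : ℕ →₀ ℕ) (M : ℕ) (p : Finset ℕ → Prop) :
    {s : Multiset Letter | Multiset.card s = γ.degree + M ∧ HasRppWeight γ s ∧
      p (γ.support.filter fun i => primed i ∈ s)}.ncard =
      ∑ S ∈ γ.support.powerset with p S, Nat.multichoose S.card M := by
  have key : {s : Multiset Letter | Multiset.card s = γ.degree + M ∧ HasRppWeight γ s ∧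
      p (γ.support.filter fun i => primed i ∈ s)} =
      (((γ.support.powerset.filter p).sigma fun S => S.sym M).image
        fun x => rppContent γ x.1 x.2.1 : Finset _) := by
    ext s
    simp only [Set.mem_ofPred_eq, Finset.coe_image, Set.mem_image, Finset.mem_coe, Finset.mem_sigma,
      Finset.mem_filter, Finset.mem_powerset, Finset.mem_sym_iff]
    constructor
    · rintro ⟨hc, hw, hp⟩
      obtain ⟨S, hS, t, ht, rfl⟩ := exists_rppContent hw
      have hSf : (γ.support.filter fun i => primed i ∈ rppContent γ S t) = S := by
        simp only [mem_rppContent_primed ht, Finset.filter_mem_eq_inter]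
        exact Finset.inter_eq_right.2 hS
      rw [hSf] at hp
      rw [card_rppContent hS] at hc
      exact ⟨⟨S, ⟨t, by omega⟩⟩, ⟨⟨hS, hp⟩, ht⟩, rfl⟩
    · rintro ⟨⟨S, t⟩, ⟨⟨hS, hp⟩, ht⟩, rfl⟩
      have ht' : ∀ i ∈ t.1, i ∈ S := ht
      refine ⟨?_, hasRppWeight_rppContent hS ht', ?_⟩
      · rw [card_rppContent hS, t.2]
      · simp only [mem_rppContent_primed ht', Finset.filter_mem_eq_inter]
        rwa [Finset.inter_eq_right.2 hS]
  rw [key, Set.ncard_coe_finset, Finset.card_image_of_injOn, Finset.card_sigma]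
  · exact Finset.sum_congr rfl fun S _ => card_finset_sym _ _
  · rintro ⟨S, t⟩ hx ⟨S', t'⟩ hx' h
    simp only [Finset.coe_sigma, Set.mem_sigma_iff, Finset.mem_coe, Finset.mem_sym_iff] at hx hx'
    have hS : S = S' := by
      ext i
      rw [← mem_rppContent_primed (γ := γ) (t := t.1) hx.2,
        ← mem_rppContent_primed (γ := γ) (t := t'.1) hx'.2]
      exact iff_of_eq (congrArg _ h)
    subst hS
    congr 1
    apply Subtype.ext
    ext i
    have := congrArg (Multiset.count (primed i)) h
    simp only [count_primed_rppContent] at this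
    exact Nat.add_left_cancel this

lemma card_subtype_fiber {X Y : Type} (A : X → Prop) (f : X → Y) (y : Y) :
    Nat.card {T : {T // A T} // f T.1 = y} = {T | A T ∧ f T = y}.ncard := by
  rw [← Nat.card_coe_set_eq]
  exact Nat.card_congr (Equiv.subtypeSubtypeEquivSubtypeInter A fun T => f T = y)

/-- On a single row, the weight of a filling depends only on the multiset of its letters. -/
lemma rppWeight_rowDiagram {m n : ℕ} (T : rowDiagram m n → Letter) (i : ℕ) :
    rppWeight T i = (Finset.univ.val.map T).count (unprimed i) +
      if primed i ∈ Finset.univ.val.map T then 1 else 0 := by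
  classical
  rw [rppWeight]
  congr 1
  · have h : {j : ℕ | ∃ b : rowDiagram m n, b.1.2 = j ∧ T b = unprimed i} =
        ((Finset.univ.filter fun b => unprimed i = T b).image fun b => b.1.2 : Finset ℕ) := by
      ext j
      simp only [Set.mem_ofPred_eq, Finset.coe_image, Set.mem_image, Finset.mem_coe,
        Finset.mem_filter, Finset.mem_univ, true_and]
      exact exists_congr fun b => ⟨fun h => ⟨h.2.symm, h.1⟩, fun h => ⟨h.2, h.1.symm⟩⟩
    rw [h, Set.ncard_coe_finset, Finset.card_image_of_injective _ fun b b' h => rowDiagram_ext h,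
      Multiset.count_map]
    rfl
  · have hmem : primed i ∈ Finset.univ.val.map T ↔ ∃ b, T b = primed i := by
      simp only [Multiset.mem_map, Finset.mem_val, Finset.mem_univ, true_and]
    split_ifs with h
    · obtain ⟨b, hb⟩ := hmem.1 h
      rw [Set.ncard_eq_one]
      refine ⟨0, Set.eq_singleton_iff_unique_mem.2 ⟨⟨b, rowDiagram_fst b, hb⟩, ?_⟩⟩
      rintro k ⟨b', hb', -⟩
      rw [← hb', rowDiagram_fst]
    · rw [Set.ncard_eq_zero (Set.Finite.subset (Set.finite_singleton 0) _)]
      · rw [Set.eq_empty_iff_forall_notMem]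
        rintro k ⟨b, -, hb⟩
        exact h (hmem.2 ⟨b, hb⟩)
      · rintro k ⟨b, hb, -⟩
        rw [← hb, rowDiagram_fst]
        rfl

lemma rppWeight_eq_iff {m n : ℕ} (T : rowDiagram m n → Letter) (γ : ℕ →₀ ℕ) :
    rppWeight T = γ ↔ HasRppWeight γ (Finset.univ.val.map T) := by
  rw [funext_iff]
  exact forall_congr' fun i => by rw [rppWeight_rowDiagram]

lemma degree_le_of_hasRppWeight {γ : ℕ →₀ ℕ} {s : Multiset Letter} (h : HasRppWeight γ s) :
    γ.degree ≤ Multiset.card s := by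
  obtain ⟨S, hS, t, -, rfl⟩ := exists_rppContent h
  rw [card_rppContent hS]
  exact Nat.le_add_right _ _

lemma finsum_finsupp (γ : ℕ →₀ ℕ) : ∑ᶠ i, γ i = γ.degree :=
  finsum_eq_sum_of_support_subset _ (by simp)

open Classical in
/-- The coefficients of the generating function of those fillings of a row whose set of primed
numbers satisfies the condition `p`. -/
lemma coeff_rpp_rowDiagram {m n : ℕ} (γ : ℕ →₀ ℕ) (A : (rowDiagram m n → Letter) → Prop)
    (p : Finset ℕ → Prop)
    (hA : ∀ T, rppWeight T = γ → (A T ↔ Monotone T ∧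
      (Monotone T → p (γ.support.filter fun i => primed i ∈ Finset.univ.val.map T)))) :
    MvPowerSeries.coeff γ (genFun (fun T : {T // A T} => rppWeight T.1)
      fun T => (-β) ^ ((rowDiagram m n).card - ∑ᶠ i, rppWeight T.1 i)) =
    if γ.degree ≤ n - m then (-β) ^ (n - m - γ.degree) *
      ((∑ S ∈ γ.support.powerset with p S, Nat.multichoose S.card (n - m - γ.degree) : ℕ) :
        Polynomial ℤ) else 0 := by
  rw [coeff_genFun_of_const _ _ γ ((-β) ^ (n - m - γ.degree))]
  · rw [card_subtype_fiber A rppWeight]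
    have h1 : {T | A T ∧ rppWeight T = γ} = {T : rowDiagram m n → Letter | Monotone T ∧
        (fun s : Multiset Letter => HasRppWeight γ s ∧ p (γ.support.filter fun i => primed i ∈ s))
          (Finset.univ.val.map T)} := by
      ext T
      simp only [Set.mem_ofPred_eq]
      rw [← rppWeight_eq_iff]
      constructor
      · rintro ⟨h, h'⟩
        have := (hA T h').1 h
        exact ⟨this.1, h', this.2 this.1⟩
      · rintro ⟨h, h', h''⟩
        exact ⟨(hA T h').2 ⟨h, fun _ => h''⟩, h'⟩
    rw [h1, ncard_monotone (rowIso m n)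
      (fun s => HasRppWeight γ s ∧ p (γ.support.filter fun i => primed i ∈ s))]
    split_ifs with hk
    · have h2 := ncard_hasRppWeight γ (n - m - γ.degree) p
      rw [Nat.add_sub_cancel' hk] at h2
      rw [h2, mul_comm]
    · rw [(Set.ncard_eq_zero (Set.Finite.subset Set.finite_empty _)).2]
      · simp
      · rw [Set.eq_empty_iff_forall_notMem]
        rintro s ⟨hs, hw, -⟩
        exact hk (hs ▸ degree_le_of_hasRppWeight hw)
      · rintro s ⟨hs, hw, -⟩
        exact hk (hs ▸ degree_le_of_hasRppWeight hw)
  · intro T hT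
    rw [card_rowDiagram, hT, finsum_finsupp]

/-- In a weakly increasing filling of a row, the number in the first box is the least one of the
support of the weight. -/
lemma index_first_box {m n : ℕ} {W : rowDiagram m n → ℕ} {γ : ℕ →₀ ℕ} (hW : Monotone W)
    (hγ : ∀ i, i ∈ γ.support ↔ ∃ b, W b = i) (h0 : γ.support.Nonempty) {b₀ : rowDiagram m n}
    (hb₀ : b₀.1.2 = m) : W b₀ = γ.support.min' h0 := by
  apply le_antisymm
  · obtain ⟨b, hb⟩ := (hγ _).1 (γ.support.min'_mem h0)
    rw [← hb]
    exact hW (rowDiagram_le_iff.2 (by rw [hb₀]; exact (rowDiagram_snd b).1))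
  · exact Finset.min'_le _ _ ((hγ _).2 ⟨b₀, rfl⟩)

lemma letter_index_mono : Monotone Letter.index := fun a b h => by
  rcases (Prod.Lex.le_iff).1 h with h | h
  · exact h.le
  · exact h.1.le

lemma mem_support_iff_of_rppWeight {m n : ℕ} {T : rowDiagram m n → Letter} {γ : ℕ →₀ ℕ}
    (h : rppWeight T = γ) (i : ℕ) : i ∈ γ.support ↔ ∃ b, (T b).index = i := by
  rw [Finsupp.mem_support_iff, ← (rppWeight_eq_iff T γ).1 h i]
  constructor
  · intro h1
    have h2 : unprimed i ∈ Finset.univ.val.map T ∨ primed i ∈ Finset.univ.val.map T := by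
      by_contra! h3
      rw [Multiset.count_eq_zero_of_notMem h3.1, if_neg h3.2] at h1
      exact h1 rfl
    rcases h2 with h2 | h2 <;> obtain ⟨b, -, hb⟩ := Multiset.mem_map.1 h2
    · exact ⟨b, by rw [hb]; rfl⟩
    · exact ⟨b, by rw [hb]; rfl⟩
  · rintro ⟨b, rfl⟩
    have hb : T b ∈ Finset.univ.val.map T := Multiset.mem_map_of_mem _ (Finset.mem_univ_val _)
    rcases eq_primed_or_unprimed (T b) with h1 | h1
    · rw [if_pos (h1 ▸ hb)]; omega
    · have := Multiset.count_pos.2 (h1 ▸ hb : unprimed _ ∈ _); omega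

lemma first_box_isPrimed_iff {m n : ℕ} {T : rowDiagram m n → Letter} {γ : ℕ →₀ ℕ}
    (hT : Monotone T) (h : rppWeight T = γ) (h0 : γ.support.Nonempty) {b₀ : rowDiagram m n}
    (hb₀ : b₀.1.2 = m) :
    (T b₀).IsPrimed ↔ primed (γ.support.min' h0) ∈ Finset.univ.val.map T := by
  have h1 := index_first_box (letter_index_mono.comp hT) (mem_support_iff_of_rppWeight h) h0 hb₀
  rw [Function.comp_apply] at h1
  rw [← h1]
  constructor
  · intro h2
    have h3 : T b₀ = primed (T b₀).index := ofLex.injective (Prod.ext rfl h2)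
    rw [← h3]
    exact Multiset.mem_map_of_mem _ (Finset.mem_univ_val _)
  · intro h2
    obtain ⟨b, -, hb⟩ := Multiset.mem_map.1 h2
    have h3 : T b₀ ≤ T b := hT (rowDiagram_le_iff.2 (by rw [hb₀]; exact (rowDiagram_snd b).1))
    rcases eq_primed_or_unprimed (T b₀) with h4 | h4
    · rw [h4]; rfl
    · rw [hb, h4] at h3
      rcases (Prod.Lex.le_iff).1 h3 with h5 | h5
      · exact absurd h5 (lt_irrefl _)
      · exact absurd h5.2 (by simp [unprimed, primed])

/-- The number `[u^M] (1 + v)^r` for `v = 1 / (1 - u)`. -/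
def onePlusPowCoeff (r M : ℕ) : ℕ := ∑ j ∈ Finset.range (r + 1), r.choose j * j.multichoose M

/-- The number `[u^M] v (1 + v)^{r-1}` for `v = 1 / (1 - u)`. -/
def onePlusPowCoeff' (r M : ℕ) : ℕ :=
  ∑ j ∈ Finset.range r, (r - 1).choose j * (j + 1).multichoose M

lemma coeff_rpp_rowDiagram_true {m n : ℕ} (γ : ℕ →₀ ℕ) (A : (rowDiagram m n → Letter) → Prop)
    (hA : ∀ T, A T ↔ IsRPP (rowDiagram m n) T) :
    MvPowerSeries.coeff γ (genFun (fun T : {T // A T} => rppWeight T.1)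
      fun T => (-β) ^ ((rowDiagram m n).card - ∑ᶠ i, rppWeight T.1 i)) =
    if γ.degree ≤ n - m then (-β) ^ (n - m - γ.degree) *
      (onePlusPowCoeff γ.support.card (n - m - γ.degree) : Polynomial ℤ) else 0 := by
  classical
  rw [coeff_rpp_rowDiagram γ A fun _ => True]
  · simp only [Finset.filter_true]
    rw [Finset.sum_powerset_apply_card fun j => Nat.multichoose j (n - m - γ.degree)]
    rfl
  · intro T _
    simp [hA, isRPP_rowDiagram_iff]

/-- The only diagonal box is the first one of the row. Its entry is primed if and only if the least
number in use occurs primed, which prescribes one element of the set of primed numbers. -/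
lemma coeff_rppP_rowDiagram_zero {n : ℕ} (hn : 0 < n) (γ : ℕ →₀ ℕ) :
    MvPowerSeries.coeff γ
      (genFun (fun T : {T : rowDiagram 0 n → Letter // IsRPP (rowDiagram 0 n) T ∧
        ∀ b : rowDiagram 0 n, b.1.1 = b.1.2 → (T b).IsPrimed} => rppWeight T.1)
      fun T => (-β) ^ ((rowDiagram 0 n).card - ∑ᶠ i, rppWeight T.1 i)) =
    if γ.degree ≤ n then (-β) ^ (n - γ.degree) *
      (onePlusPowCoeff' γ.support.card (n - γ.degree) : Polynomial ℤ) else 0 := by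
  classical
  set b₀ : rowDiagram 0 n := ⟨(0, 0), by simp [hn]⟩ with hb₀
  have hdiag : ∀ T : rowDiagram 0 n → Letter,
      (∀ b : rowDiagram 0 n, b.1.1 = b.1.2 → (T b).IsPrimed) ↔ (T b₀).IsPrimed := by
    intro T
    constructor
    · exact fun h => h b₀ rfl
    · intro h b hb
      rwa [show b = b₀ from rowDiagram_ext (by rw [← hb, rowDiagram_fst])]
  rw [coeff_rpp_rowDiagram γ _ fun S => ∃ h : γ.support.Nonempty, γ.support.min' h ∈ S]
  · rw [Nat.sub_zero]
    congr 3
    rcases Finset.eq_empty_or_nonempty γ.support with h0 | h0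
    · simp [h0, onePlusPowCoeff']
    · simp only [exists_prop_of_true h0]
      rw [sum_powerset_filter_mem (γ.support.min'_mem h0)
        fun j => Nat.multichoose j (n - γ.degree)]
      rfl
  · intro T hT
    rw [isRPP_rowDiagram_iff, hdiag]
    refine and_congr_right fun hmono => ?_
    rw [← imp_iff_right hmono (b := (T b₀).IsPrimed)]
    refine imp_congr_right fun hmono => ?_
    have h0 : γ.support.Nonempty := ⟨_, (mem_support_iff_of_rppWeight hT _).2 ⟨b₀, rfl⟩⟩
    rw [first_box_isPrimed_iff hmono hT h0 rfl, exists_prop_of_true h0, Finset.mem_filter,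
      and_iff_right (γ.support.min'_mem h0)]

/-! ### The Cauchy kernel in one variable `x` -/

/-- The power series `(1 + βx)^{-j}`. -/
noncomputable def invOneAddPow (j : ℕ) : PowerSeries (Polynomial ℤ) :=
  PowerSeries.mk fun M => (-β) ^ M * (j.multichoose M : Polynomial ℤ)

lemma invOneAddPow_zero : invOneAddPow 0 = 1 := by
  ext M
  rcases M with _ | M <;> simp [invOneAddPow, PowerSeries.coeff_one]

lemma mul_invOneAddPow_succ (j : ℕ) :
    (1 + PowerSeries.C β * PowerSeries.X) * invOneAddPow (j + 1) = invOneAddPow j := by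
  ext M : 1
  rcases M with _ | M
  · simp [invOneAddPow, add_mul, mul_assoc]
  · rw [add_mul, one_mul, mul_assoc, map_add, PowerSeries.coeff_C_mul,
      PowerSeries.coeff_succ_X_mul]
    simp only [invOneAddPow, PowerSeries.coeff_mk]
    rw [Nat.multichoose_succ_succ]
    push_cast
    ring

lemma one_add_mul_invOneAddPow_one :
    (1 + PowerSeries.C β * PowerSeries.X) * invOneAddPow 1 = 1 := by
  rw [mul_invOneAddPow_succ, invOneAddPow_zero]

lemma invOneAddPow_eq_pow (j : ℕ) : invOneAddPow j = invOneAddPow 1 ^ j := by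
  induction j with
  | zero => rw [invOneAddPow_zero, pow_zero]
  | succ j ih =>
    rw [pow_succ, ← ih, ← mul_invOneAddPow_succ j, mul_right_comm, mul_comm,
      one_add_mul_invOneAddPow_one, mul_one]

lemma coeff_one_add_pow (r M : ℕ) :
    PowerSeries.coeff M ((1 + invOneAddPow 1) ^ r) =
      (-β) ^ M * (onePlusPowCoeff r M : Polynomial ℤ) := by
  rw [add_comm, add_pow, map_sum, onePlusPowCoeff, Nat.cast_sum, Finset.mul_sum]
  refine Finset.sum_congr rfl fun j _ => ?_
  rw [one_pow, mul_one, ← invOneAddPow_eq_pow, ← map_natCast PowerSeries.C,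
    PowerSeries.coeff_mul_C, invOneAddPow, PowerSeries.coeff_mk]
  push_cast
  ring

lemma coeff_mul_one_add_pow {r : ℕ} (hr : 0 < r) (M : ℕ) :
    PowerSeries.coeff M (invOneAddPow 1 * (1 + invOneAddPow 1) ^ (r - 1)) =
      (-β) ^ M * (onePlusPowCoeff' r M : Polynomial ℤ) := by
  rw [add_comm, add_pow, Finset.mul_sum, map_sum, onePlusPowCoeff', Nat.cast_sum, Finset.mul_sum,
    Nat.sub_add_cancel hr]
  refine Finset.sum_congr rfl fun j _ => ?_
  rw [one_pow, mul_one, ← mul_assoc, ← pow_succ', ← invOneAddPow_eq_pow,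
    ← map_natCast PowerSeries.C, PowerSeries.coeff_mul_C, invOneAddPow, PowerSeries.coeff_mk]
  push_cast
  ring

/-- Setting `x₂ = x₃ = ⋯ = 0`, and regarding the outcome as a power series in `y₁, y₂, …` with
coefficients in `ℤ[β][[x₁]]`. -/
noncomputable def restrictSwapFun (f : PS₂) : MvPowerSeries ℕ (PowerSeries (Polynomial ℤ)) :=
  fun γ : ℕ →₀ ℕ => PowerSeries.mk fun n =>
    MvPowerSeries.coeff γ (MvPowerSeries.coeff (Finsupp.single 0 n) f)

lemma coeff_restrictSwapFun (f : PS₂) (γ : ℕ →₀ ℕ) (n : ℕ) :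
    PowerSeries.coeff n (MvPowerSeries.coeff γ (restrictSwapFun f)) =
      MvPowerSeries.coeff γ (MvPowerSeries.coeff (Finsupp.single 0 n) f) :=
  PowerSeries.coeff_mk n fun n =>
    MvPowerSeries.coeff γ (MvPowerSeries.coeff (Finsupp.single 0 n) f)

/-- The ring homomorphism given by `restrictSwapFun`. -/
noncomputable def restrictSwap : PS₂ →+* MvPowerSeries ℕ (PowerSeries (Polynomial ℤ)) where
  toFun := restrictSwapFun
  map_one' := by
    classical
    ext γ : 1
    ext n : 1
    rw [coeff_restrictSwapFun, MvPowerSeries.coeff_one, MvPowerSeries.coeff_one]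
    by_cases hn : n = 0 <;> by_cases hγ : γ = 0 <;>
      simp [hn, hγ, MvPowerSeries.coeff_one, PowerSeries.coeff_one]
  map_zero' := by
    ext γ : 1
    ext n : 1
    rw [coeff_restrictSwapFun]
    simp
  map_add' f g := by
    ext γ : 1
    ext n : 1
    rw [map_add, map_add]
    simp only [coeff_restrictSwapFun, map_add]
  map_mul' f g := by
    classical
    ext γ : 1
    ext n : 1
    rw [MvPowerSeries.coeff_mul, map_sum]
    simp only [PowerSeries.coeff_mul, coeff_restrictSwapFun]
    rw [MvPowerSeries.coeff_mul, map_sum, Finsupp.antidiagonal_single, Finset.sum_map,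
      Finset.sum_comm]
    refine Finset.sum_congr rfl fun p _ => ?_
    rw [MvPowerSeries.coeff_mul]
    rfl

lemma coeff_restrictSwap (f : PS₂) (γ : ℕ →₀ ℕ) (n : ℕ) :
    PowerSeries.coeff n (MvPowerSeries.coeff γ (restrictSwap f)) =
      MvPowerSeries.coeff γ (MvPowerSeries.coeff (Finsupp.single 0 n) f) :=
  coeff_restrictSwapFun f γ n

lemma restrictSwap_xVar : restrictSwap (xVar 0) = MvPowerSeries.C PowerSeries.X := by
  classical
  ext γ : 1
  ext n : 1
  rw [coeff_restrictSwap, xVar, MvPowerSeries.coeff_X, MvPowerSeries.coeff_C]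
  by_cases hn : n = 1
  · subst hn
    by_cases hγ : γ = 0 <;> simp [hγ, MvPowerSeries.coeff_one]
  · rw [if_neg (fun h => hn (Finsupp.single_injective 0 h))]
    by_cases hγ : γ = 0 <;> simp [hγ, PowerSeries.coeff_X, hn]

lemma restrictSwap_C (f : PS) : restrictSwap (MvPowerSeries.C f) =
    MvPowerSeries.map PowerSeries.C f := by
  classical
  ext γ : 1
  ext n : 1
  rw [coeff_restrictSwap, MvPowerSeries.coeff_C, MvPowerSeries.coeff_map, PowerSeries.coeff_C]
  by_cases hn : n = 0 <;> simp [hn]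

lemma restrictSwap_yVar (j : ℕ) : restrictSwap (yVar j) = MvPowerSeries.X j := by
  rw [yVar, restrictSwap_C, MvPowerSeries.map_X]

/-- The coefficient of `y^k` in `(1 - x̄ y) / (1 - x y)`, a series that is equal to
`1 + ∑_{k ≥ 1} (1 + 1 / (1 + β x)) x^k y^k`. -/
noncomputable def factorCoeff (k : ℕ) : PowerSeries (Polynomial ℤ) :=
  if k = 0 then 1 else (1 + invOneAddPow 1) * PowerSeries.X ^ k

lemma mul_invOfUnit_eq_one {σ R : Type} [CommRing R] (φ : MvPowerSeries σ R)
    (h : MvPowerSeries.constantCoeff φ = 1) : φ * MvPowerSeries.invOfUnit φ 1 = 1 :=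
  MvPowerSeries.mul_invOfUnit φ 1 (by simpa using h)

lemma cauchyFactor_mul (j : ℕ) :
    (1 + MvPowerSeries.C (MvPowerSeries.C β) * xVar 0) * (1 - xVar 0 * yVar j) * cauchyFactor 0 j =
      1 + MvPowerSeries.C (MvPowerSeries.C β) * xVar 0 + xVar 0 * yVar j := by
  have h1 := mul_invOfUnit_eq_one (1 + MvPowerSeries.C (MvPowerSeries.C β) * xVar 0 : PS₂)
    (by simp [xVar])
  have h2 := mul_invOfUnit_eq_one (1 - xVar 0 * yVar j : PS₂) (by simp [xVar])
  rw [cauchyFactor, xBar]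
  linear_combination (1 + MvPowerSeries.C (MvPowerSeries.C β) * xVar 0 + xVar 0 * yVar j) * h2 +
    (xVar 0 * yVar j) * (h1) * ((1 - xVar 0 * yVar j) *
      MvPowerSeries.invOfUnit (1 - xVar 0 * yVar j) 1)

lemma restrictSwap_cauchyFactor (j : ℕ) :
    (1 - MvPowerSeries.C PowerSeries.X * MvPowerSeries.X j) * restrictSwap (cauchyFactor 0 j) =
      1 + MvPowerSeries.C (invOneAddPow 1 * PowerSeries.X) * MvPowerSeries.X j := by
  have h := congrArg restrictSwap (cauchyFactor_mul j)
  have hw := congrArg (MvPowerSeries.C (σ := ℕ)) one_add_mul_invOneAddPow_one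
  simp only [map_mul, map_add, map_sub, map_one, restrictSwap_C, MvPowerSeries.map_C,
    restrictSwap_xVar, restrictSwap_yVar] at h hw ⊢
  linear_combination (MvPowerSeries.C (invOneAddPow 1)) * h +
    (1 - (1 - MvPowerSeries.C PowerSeries.X * MvPowerSeries.X j) *
      restrictSwap (cauchyFactor 0 j)) * hw

open Classical in
lemma coeff_restrictSwap_cauchyFactor (j : ℕ) (γ : ℕ →₀ ℕ) :
    MvPowerSeries.coeff γ (restrictSwap (cauchyFactor 0 j)) =
      if γ = Finsupp.single j (γ j) then factorCoeff (γ j) else 0 := by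
  have h := congrArg (MvPowerSeries.coeff γ) (restrictSwap_cauchyFactor j)
  rw [sub_mul, one_mul, mul_assoc, map_sub, sub_eq_iff_eq_add, map_add, MvPowerSeries.coeff_C_mul,
    MvPowerSeries.coeff_C_mul, MvPowerSeries.coeff_one, MvPowerSeries.coeff_X] at h
  rw [h, MvPowerSeries.X, MvPowerSeries.coeff_monomial_mul, one_mul]
  clear h
  simp only [Finsupp.single_le_iff]
  -- Multiplied by `1 - x y`, the factor becomes `1 + x y / (1 + β x)`; so its coefficients satisfy
  -- a recurrence that lowers the exponent of `y`.
  induction hk : γ j generalizing γ with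
  | zero =>
    have h1 : γ ≠ Finsupp.single j 1 := by
      rintro rfl
      simp at hk
    simp [h1, factorCoeff]
  | succ k ih =>
    have h1 : γ ≠ 0 := by
      rintro rfl
      simp at hk
    set δ := γ - Finsupp.single j 1 with hδ
    have hγδ : γ = δ + Finsupp.single j 1 := by
      rw [hδ, tsub_add_cancel_of_le (Finsupp.single_le_iff.2 (by omega))]
    have hδj : δ j = k := by simp [hδ, hk]
    have h2 := congrArg (MvPowerSeries.coeff δ) (restrictSwap_cauchyFactor j)
    rw [sub_mul, one_mul, mul_assoc, map_sub, sub_eq_iff_eq_add, map_add,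
      MvPowerSeries.coeff_C_mul, MvPowerSeries.coeff_C_mul, MvPowerSeries.coeff_one,
      MvPowerSeries.coeff_X, MvPowerSeries.X, MvPowerSeries.coeff_monomial_mul, one_mul] at h2
    simp only [Finsupp.single_le_iff] at h2
    have h4 : γ = Finsupp.single j (k + 1) ↔ δ = Finsupp.single j k := by
      rw [hγδ, Finsupp.single_add, add_left_inj]
    have h5 : γ = Finsupp.single j 1 ↔ δ = 0 := by
      rw [hγδ, add_eq_right]
    rw [hδj] at h2
    rw [if_neg h1, if_pos (Nat.le_add_left 1 k), h2, ih δ hδj]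
    simp only [h4, h5]
    rcases k with _ | k
    · by_cases hδ0 : δ = 0
      · simp [hδ0, factorCoeff]
        ring
      · simp [hδ0]
    · have hδ0 : δ ≠ 0 := by
        rintro h
        simp [h] at hδj
      by_cases hδ1 : δ = Finsupp.single j (k + 1)
      · simp [hδ1, factorCoeff]
        ring
      · rw [if_neg hδ0, if_neg hδ1, if_neg hδ1]
        simp

lemma coeff_restrictSwap_prod (γ : ℕ →₀ ℕ) :
    MvPowerSeries.coeff γ (restrictSwap (∏ j ∈ γ.support, cauchyFactor 0 j)) =
      PowerSeries.X ^ γ.degree * (1 + invOneAddPow 1) ^ γ.support.card := by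
  classical
  rw [map_prod, MvPowerSeries.coeff_prod]
  -- Each factor involves its own variable only, so there is a single way to distribute `γ`.
  set l₀ : ℕ →₀ (ℕ →₀ ℕ) := Finsupp.onFinset γ.support (fun j => Finsupp.single j (γ j))
    (fun j h => by
      rw [Finsupp.mem_support_iff]
      rintro h'
      simp [h'] at h) with hl₀
  have hl₀j : ∀ j, l₀ j = Finsupp.single j (γ j) := fun j => rfl
  rw [Finset.sum_eq_single l₀]
  · have h1 : ∀ j ∈ γ.support, MvPowerSeries.coeff (l₀ j) (restrictSwap (cauchyFactor 0 j)) =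
        PowerSeries.X ^ γ j * (1 + invOneAddPow 1) := by
      intro j hj
      rw [coeff_restrictSwap_cauchyFactor, hl₀j, Finsupp.single_eq_same, if_pos rfl, factorCoeff,
        if_neg (Finsupp.mem_support_iff.1 hj), mul_comm]
    rw [Finset.prod_congr rfl h1, Finset.prod_mul_distrib, Finset.prod_const,
      Finset.prod_pow_eq_pow_sum]
    rfl
  · intro l hl hne
    rw [Finset.mem_finsuppAntidiag] at hl
    by_contra h
    rw [Finset.prod_eq_zero_iff] at h
    push Not at h
    refine hne (Finsupp.ext fun j => ?_)
    have h1 : ∀ j ∈ γ.support, l j = Finsupp.single j (l j j) := by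
      intro j hj
      by_contra h2
      have := h j hj
      rw [coeff_restrictSwap_cauchyFactor, if_neg h2] at this
      exact this rfl
    by_cases hj : j ∈ γ.support
    · have h3 : γ j = l j j := by
        rw [← hl.1, Finsupp.finsetSum_apply, Finset.sum_eq_single j]
        · intro i hi hij
          rw [h1 i hi, Finsupp.single_eq_of_ne hij.symm]
        · exact fun h => absurd hj h
      rw [hl₀j, h3, ← h1 j hj]
    · rw [hl₀j, Finsupp.notMem_support_iff.1 hj, Finsupp.single_zero]
      exact Finsupp.notMem_support_iff.1 fun h => hj (hl.2 h)
  · intro h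
    refine absurd ?_ h
    rw [Finset.mem_finsuppAntidiag]
    refine ⟨?_, Finsupp.support_onFinset_subset⟩
    simp only [hl₀j]
    exact γ.sum_single

/-- For a single variable `x`, the coefficient of `y^γ` in the Cauchy kernel is
`x^{|γ|} (1 + 1 / (1 + βx))^r`, where `r` is the number of variables that occur in `y^γ`. -/
lemma coeff_cauchyKernel (γ : ℕ →₀ ℕ) (n : ℕ) :
    MvPowerSeries.coeff γ (MvPowerSeries.coeff (Finsupp.single 0 n) cauchyKernel) =
      PowerSeries.coeff n (PowerSeries.X ^ γ.degree * (1 + invOneAddPow 1) ^ γ.support.card) := by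
  classical
  change MvPowerSeries.coeff γ (MvPowerSeries.coeff (Finsupp.single 0 n)
    (∏ i ∈ (Finsupp.single 0 n).support, ∏ j ∈ γ.support, cauchyFactor i j)) = _
  rcases n with _ | n
  · by_cases hγ : γ = 0
    · simp [hγ]
    · have h1 : γ.degree ≠ 0 := fun h => hγ ((Finsupp.degree_eq_zero_iff γ).1 h)
      simp [h1, hγ, MvPowerSeries.coeff_one]
  · rw [Finsupp.support_single _ (Nat.succ_ne_zero n), Finset.prod_singleton,
      ← coeff_restrictSwap, coeff_restrictSwap_prod]

/-! ### `GP` and `GQ` in one variable -/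

/-- The strict partition `(n)`, which is empty for `n = 0`. -/
def oneRow (n : ℕ) : StrictPartition where
  parts := if n = 0 then [] else [n]
  decreasing := by split_ifs <;> simp
  pos := by
    split_ifs with h
    · simp
    · simp only [List.mem_singleton, forall_eq]
      exact Nat.pos_of_ne_zero h

lemma oneRow_part_zero (n : ℕ) : (oneRow n).part 0 = n := by
  by_cases h : n = 0 <;> simp [StrictPartition.part, oneRow, h]

lemma oneRow_injective : Function.Injective oneRow := fun n n' h => by
  rw [← oneRow_part_zero n, h, oneRow_part_zero]

lemma oneRow_length_zero : (oneRow 0).length = 0 := by simp [StrictPartition.length, oneRow]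

lemma oneRow_length_of_pos {n : ℕ} (hn : 0 < n) : (oneRow n).length = 1 := by
  simp [StrictPartition.length, oneRow, hn.ne']

lemma eq_oneRow_of_length_le {lam : StrictPartition} (h : lam.length ≤ 1) :
    lam = oneRow (lam.part 0) := by
  obtain ⟨parts, hd, hp⟩ := lam
  ext1
  rcases parts with _ | ⟨a, _ | ⟨b, l⟩⟩
  · simp [oneRow, StrictPartition.part]
  · have : 0 < a := hp a (by simp)
    simp [oneRow, StrictPartition.part, this.ne']
  · simp [StrictPartition.length] at h

lemma oneRow_SD (n : ℕ) : (oneRow n).SD = rowDiagram 0 n := by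
  rcases Nat.eq_zero_or_pos n with rfl | hn
  · simp [StrictPartition.SD, oneRow_length_zero]
  · rw [StrictPartition.SD, oneRow_length_of_pos hn, Finset.range_one, Finset.singleton_biUnion,
      oneRow_part_zero, zero_add]

lemma oneRow_skewSD (n m : ℕ) : (oneRow n).skewSD (oneRow m) = rowDiagram m n := by
  rw [StrictPartition.skewSD, oneRow_SD, oneRow_SD]
  ext b
  simp only [Finset.mem_sdiff, Finset.mem_product, Finset.mem_singleton, Finset.mem_Ico]
  omega

section OneVariable

variable {D : Finset (ℕ × ℕ)} {T : D → Finset Letter} {d : ℕ}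

lemma index_eq_zero_of_setWeight (hw : setWeight T = Finsupp.single 0 d) (b : D) {a : Letter}
    (ha : a ∈ T b) : a.index = 0 := by
  by_contra h
  have h1 := congrFun hw a.index
  rw [Finsupp.single_eq_of_ne h, setWeight, Finset.sum_eq_zero_iff] at h1
  have h2 := Finset.card_eq_zero.1 (h1 b (Finset.mem_univ _))
  exact Finset.notMem_empty a (h2 ▸ Finset.mem_filter.2 ⟨ha, rfl⟩)

lemma eq_of_index_eq_zero {a : Letter} (h : a.index = 0) : a = primed 0 ∨ a = unprimed 0 := by
  rcases eq_primed_or_unprimed a with h1 | h1 <;> rw [h] at h1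
  · exact Or.inl h1
  · exact Or.inr h1

lemma primed_lt_unprimed (i : ℕ) : primed i < unprimed i :=
  Prod.Lex.lt_iff.2 (Or.inr ⟨rfl, by simp [primed, unprimed]⟩)

lemma setWeight_eq_single (h : ∀ b, ∀ a ∈ T b, Letter.index a = 0) :
    setWeight T = Finsupp.single 0 (setSize T) := by
  funext i
  rw [setWeight, setSize]
  by_cases hi : i = 0
  · subst hi
    rw [Finsupp.single_eq_same]
    exact Finset.sum_congr rfl fun b _ => by rw [Finset.filter_true_of_mem (h b)]
  · rw [Finsupp.single_eq_of_ne hi]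
    refine Finset.sum_eq_zero fun b _ => ?_
    rw [Finset.filter_false_of_mem, Finset.card_empty]
    exact fun a ha h' => hi (h' ▸ h b a ha)

/-- With the two letters `1'` and `1` only, every box except for the leftmost one of its row
contains nothing but `1`. -/
lemma eq_singleton_of_left (hT : IsSetSemistandard D T) (h : ∀ b, ∀ a ∈ T b, Letter.index a = 0)
    {b b' : D} (hrow : b.1.1 = b'.1.1) (hlt : b.1.2 < b'.1.2) : T b' = {unprimed 0} := by
  rw [Finset.eq_singleton_iff_nonempty_unique_mem]
  refine ⟨hT.nonempty b', fun a ha => ?_⟩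
  rcases eq_of_index_eq_zero (h b' a ha) with rfl | h1
  · exfalso
    obtain ⟨a, ha'⟩ := hT.nonempty b
    rcases eq_of_index_eq_zero (h b a ha') with rfl | rfl
    · have := hT.row_primed b b' hrow 0 ha' ha
      rw [this] at hlt
      exact lt_irrefl _ hlt
    · exact absurd (hT.row_weak b b' hrow hlt _ ha' _ ha) (not_le.2 (primed_lt_unprimed 0))
  · exact h1

/-- A shifted diagram with at least two rows has no set-valued tableaux in the letters `1'` and `1`:
the box `(0, 1)` contains `1`, so the box `(1, 1)` below it can contain neither of the two. -/
lemma not_isSetSemistandard_of_corner (h00 : (0, 0) ∈ D) (h01 : (0, 1) ∈ D) (h11 : (1, 1) ∈ D)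
    (hT : IsSetSemistandard D T) (h : ∀ b, ∀ a ∈ T b, Letter.index a = 0) : False := by
  have h1 : T ⟨(0, 1), h01⟩ = {unprimed 0} :=
    eq_singleton_of_left (b := ⟨(0, 0), h00⟩) hT h rfl Nat.zero_lt_one
  have h1' : unprimed 0 ∈ T ⟨(0, 1), h01⟩ := by rw [h1]; exact Finset.mem_singleton_self _
  obtain ⟨a, ha⟩ := hT.nonempty ⟨(1, 1), h11⟩
  rcases eq_of_index_eq_zero (h _ a ha) with rfl | rfl
  · exact absurd (hT.col_weak ⟨(0, 1), h01⟩ ⟨(1, 1), h11⟩ rfl Nat.zero_lt_one _ h1' _ ha)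
      (not_le.2 (primed_lt_unprimed 0))
  · have := hT.col_unprimed ⟨(0, 1), h01⟩ ⟨(1, 1), h11⟩ rfl 0 h1' ha
    simp at this

end OneVariable

lemma mem_SD_of_two_le_length {lam : StrictPartition} (h : 2 ≤ lam.length) :
    (0, 0) ∈ lam.SD ∧ (0, 1) ∈ lam.SD ∧ (1, 1) ∈ lam.SD := by
  obtain ⟨parts, hd, hp⟩ := lam
  rcases parts with _ | ⟨a, _ | ⟨b, l⟩⟩
  · simp [StrictPartition.length] at h
  · simp [StrictPartition.length] at h
  · have hb : 0 < b := hp b (by simp)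
    have hab : b < a := by
      rw [List.pairwise_cons] at hd
      exact hd.1 b (by simp)
    simp only [StrictPartition.SD, StrictPartition.length, StrictPartition.part,
      Finset.mem_biUnion, Finset.mem_range, Finset.mem_product, Finset.mem_singleton,
      Finset.mem_Ico, List.length_cons]
    refine ⟨⟨0, by omega, rfl, ?_⟩, ⟨0, by omega, rfl, ?_⟩, ⟨1, by omega, rfl, ?_⟩⟩ <;>
      simp <;> omega

/-- The filling of a row with the set `A` in its first box and with `1` in all others. -/
def rowFilling (n : ℕ) (A : Finset Letter) (b : rowDiagram 0 n) : Finset Letter :=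
  if b.1.2 = 0 then A else {unprimed 0}

lemma index_rowFilling {n : ℕ} {A : Finset Letter} (hA : A ⊆ {primed 0, unprimed 0})
    (b : rowDiagram 0 n) (a : Letter) (ha : a ∈ rowFilling n A b) : a.index = 0 := by
  rw [rowFilling] at ha
  split_ifs at ha
  · have := hA ha
    rw [Finset.mem_insert, Finset.mem_singleton] at this
    rcases this with rfl | rfl <;> rfl
  · rw [Finset.mem_singleton.1 ha]; rfl

lemma isSetSemistandard_rowFilling {n : ℕ} {A : Finset Letter} (hA : A ⊆ {primed 0, unprimed 0})
    (hA0 : A.Nonempty) : IsSetSemistandard (rowDiagram 0 n) (rowFilling n A) where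
  nonempty b := by
    rw [rowFilling]
    split_ifs
    · exact hA0
    · exact Finset.singleton_nonempty _
  row_weak b b' _ hlt a ha a' ha' := by
    have h1 : a' = unprimed 0 := by
      rw [rowFilling, if_neg (by omega)] at ha'
      exact Finset.mem_singleton.1 ha'
    rcases eq_of_index_eq_zero (index_rowFilling hA b a ha) with h2 | h2 <;> rw [h1, h2]
    exact (primed_lt_unprimed 0).le
  col_weak b b' _ hlt := by
    rw [rowDiagram_fst, rowDiagram_fst] at hlt
    exact absurd hlt (lt_irrefl _)
  col_unprimed b b' h _ _ _ := rowDiagram_ext h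
  row_primed b b' _ i h h' := by
    have h0 : ∀ b : rowDiagram 0 n, primed i ∈ rowFilling n A b → b.1.2 = 0 := by
      intro b hb
      by_contra h0
      rw [rowFilling, if_neg h0] at hb
      exact primed_ne_unprimed _ _ (Finset.mem_singleton.1 hb)
    exact rowDiagram_ext ((h0 b h).trans (h0 b' h').symm)

lemma setSize_rowFilling {n : ℕ} (A : Finset Letter) :
    setSize (rowFilling (n + 1) A) = A.card + n := by
  have h0 : ((0, 0) : ℕ × ℕ) ∈ rowDiagram 0 (n + 1) := by simp
  rw [setSize, ← Finset.add_sum_erase _ _ (Finset.mem_univ ⟨(0, 0), h0⟩)]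
  congr 1
  rw [Finset.sum_congr rfl (g := fun _ => 1), Finset.sum_const, smul_eq_mul, mul_one,
    Finset.card_erase_of_mem (Finset.mem_univ _), Finset.card_univ, Fintype.card_coe,
    card_rowDiagram]
  · rfl
  · intro b hb
    have : b.1.2 ≠ 0 := fun h => (Finset.mem_erase.1 hb).1 (rowDiagram_ext h)
    rw [rowFilling, if_neg this, Finset.card_singleton]

lemma eq_rowFilling {n : ℕ} {T : rowDiagram 0 (n + 1) → Finset Letter}
    (hT : IsSetSemistandard _ T) (h : ∀ b, ∀ a ∈ T b, Letter.index a = 0) :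
    T = rowFilling (n + 1) (T ⟨(0, 0), by simp⟩) := by
  funext b
  rw [rowFilling]
  split_ifs with hb
  · exact congrArg T (rowDiagram_ext hb)
  · exact eq_singleton_of_left (b := ⟨(0, 0), by simp⟩) hT h (rowDiagram_fst b).symm
      (Nat.pos_of_ne_zero hb)

lemma subset_of_index {A : Finset Letter} (h : ∀ a ∈ A, Letter.index a = 0) :
    A ⊆ {primed 0, unprimed 0} := fun a ha => by
  rw [Finset.mem_insert, Finset.mem_singleton]
  exact eq_of_index_eq_zero (h a ha)

lemma rowFilling_zero_box {n : ℕ} (A : Finset Letter) :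
    rowFilling (n + 1) A ⟨(0, 0), by simp⟩ = A := if_pos rfl

/-- In the letters `1'` and `1`, a set-valued filling of a row amounts to the set in its first
box. -/
lemma ncard_setFillings (n d : ℕ) (p : Finset Letter → Prop) [DecidablePred p] :
    {T : rowDiagram 0 (n + 1) → Finset Letter | (IsSetSemistandard _ T ∧ p (T ⟨(0, 0), by simp⟩)) ∧
      setWeight T = Finsupp.single 0 d}.ncard =
    ((({primed 0, unprimed 0} : Finset Letter).powerset.filter fun A => A.Nonempty ∧
      A.card + n = d ∧ p A).card) := by
  rw [← Set.ncard_coe_finset, ← Set.InjOn.ncard_image (f := rowFilling (n + 1))]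
  · congr 1
    ext T
    simp only [Set.mem_ofPred_eq, Set.mem_image, Finset.mem_coe, Finset.mem_filter,
      Finset.mem_powerset]
    constructor
    · rintro ⟨⟨hT, hp⟩, hw⟩
      have hi : ∀ b, ∀ a ∈ T b, Letter.index a = 0 := fun b a => index_eq_zero_of_setWeight hw b
      refine ⟨_, ⟨subset_of_index (hi ⟨(0, 0), by simp⟩), hT.nonempty _, ?_, hp⟩,
        (eq_rowFilling hT hi).symm⟩
      rw [setWeight_eq_single hi] at hw
      rw [← setSize_rowFilling, ← eq_rowFilling hT hi]
      exact Finsupp.single_injective 0 (DFunLike.coe_injective hw)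
    · rintro ⟨A, ⟨hA, hA0, hc, hp⟩, rfl⟩
      refine ⟨⟨isSetSemistandard_rowFilling hA hA0, ?_⟩, ?_⟩
      · rwa [rowFilling_zero_box]
      · rw [setWeight_eq_single (index_rowFilling hA), setSize_rowFilling, hc]
  · intro A _ A' _ h
    rw [← rowFilling_zero_box (n := n) A, h, rowFilling_zero_box]

lemma setSize_eq_of_setWeight {D : Finset (ℕ × ℕ)} {T : D → Finset Letter} {d : ℕ}
    (hw : setWeight T = Finsupp.single 0 d) : setSize T = d := by
  have := setWeight_eq_single fun b a => index_eq_zero_of_setWeight hw b (a := a)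
  rw [hw] at this
  exact (Finsupp.single_injective 0 (DFunLike.coe_injective this)).symm

lemma coeff_setFillings {D : Finset (ℕ × ℕ)} (d : ℕ) (A : (D → Finset Letter) → Prop) :
    MvPowerSeries.coeff (Finsupp.single 0 d) (genFun (fun T : {T // A T} => setWeight T.1)
      fun T => β ^ (setSize T.1 - D.card)) =
    ({T | A T ∧ setWeight T = Finsupp.single 0 d}.ncard : Polynomial ℤ) * β ^ (d - D.card) := by
  rw [coeff_genFun_of_const _ _ _ (β ^ (d - D.card)), card_subtype_fiber A setWeight]
  intro T hT
  rw [setSize_eq_of_setWeight hT]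

lemma coeff_setFillings_empty (d : ℕ) (A : (rowDiagram 0 0 → Finset Letter) → Prop)
    (hA : ∀ T, A T) :
    MvPowerSeries.coeff (Finsupp.single 0 d) (genFun (fun T : {T // A T} => setWeight T.1)
      fun T => β ^ (setSize T.1 - (rowDiagram 0 0).card)) = if d = 0 then 1 else 0 := by
  have hE : IsEmpty (rowDiagram 0 0) := ⟨fun b => absurd (rowDiagram_snd b).2 (Nat.not_lt_zero _)⟩
  have hw : ∀ T : rowDiagram 0 0 → Finset Letter, setWeight T = Finsupp.single 0 0 := by
    intro T
    funext i
    simp [setWeight]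
  rw [coeff_setFillings]
  split_ifs with hd
  · subst hd
    have : {T | A T ∧ setWeight T = Finsupp.single 0 0} = {fun b => hE.elim b} := by
      ext T
      simp only [Set.mem_ofPred_eq, hA, hw, Set.mem_singleton_iff, and_self, true_iff]
      exact Subsingleton.elim _ _
    rw [this]
    simp
  · have : {T | A T ∧ setWeight T = Finsupp.single 0 d} = ∅ := by
      rw [Set.eq_empty_iff_forall_notMem]
      rintro T ⟨-, h⟩
      rw [hw] at h
      exact hd (Finsupp.single_injective 0 (DFunLike.coe_injective h)).symm
    rw [this]
    simp

lemma coeff_GQ_oneRow_zero (d : ℕ) :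
    MvPowerSeries.coeff (Finsupp.single 0 d) (GQ (oneRow 0)) = if d = 0 then 1 else 0 := by
  unfold GQ SetShYTQ
  -- The type of the fillings depends on the diagram, which is generalized before it is replaced.
  generalize hD : (oneRow 0).SD = D
  rw [oneRow_SD] at hD
  subst hD
  refine coeff_setFillings_empty d _ fun T => ?_
  have h : ∀ b : rowDiagram 0 0, False := fun b => absurd (rowDiagram_snd b).2 (Nat.not_lt_zero _)
  exact ⟨fun b => (h b).elim, fun b => (h b).elim, fun b => (h b).elim, fun b => (h b).elim,
    fun b => (h b).elim⟩

/-- In one variable, `GQ_{(n)}(x) = 2 x^n + β x^{n+1}` for `n ≥ 1`. -/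
lemma coeff_GQ_oneRow_succ (n d : ℕ) :
    MvPowerSeries.coeff (Finsupp.single 0 d) (GQ (oneRow (n + 1))) =
      if d = n + 1 then 2 else if d = n + 2 then β else 0 := by
  unfold GQ SetShYTQ
  generalize hD : (oneRow (n + 1)).SD = D
  rw [oneRow_SD] at hD
  subst hD
  rw [coeff_setFillings d, card_rowDiagram]
  have h := ncard_setFillings n d fun _ => True
  simp only [and_true] at h
  have hc : ({primed 0, unprimed 0} : Finset Letter).card = 2 :=
    Finset.card_pair (primed_ne_unprimed 0 0)
  rw [h]
  rcases le_or_gt d n with hd | hd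
  · have h1 : d ≠ n + 1 := by omega
    have h2 : d ≠ n + 2 := by omega
    rw [if_neg h1, if_neg h2, Finset.filter_false_of_mem]
    · simp
    · rintro A - ⟨hA, hA'⟩
      have := hA.card_pos
      omega
  · have hf : (({primed 0, unprimed 0} : Finset Letter).powerset.filter fun A =>
        A.Nonempty ∧ A.card + n = d) =
        ({primed 0, unprimed 0} : Finset Letter).powersetCard (d - n) := by
      ext A
      rw [Finset.mem_filter, Finset.mem_powerset, Finset.mem_powersetCard, ← Finset.card_pos]
      refine and_congr_right fun _ => ?_
      omega
    rw [hf, Finset.card_powersetCard, hc]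
    obtain ⟨j, rfl⟩ : ∃ j, d = n + 1 + j := ⟨d - (n + 1), by omega⟩
    rw [show n + 1 + j - n = j + 1 by omega, show n + 1 + j - (n + 1 - 0) = j by omega]
    rcases j with _ | _ | j
    · simp
    · simp
    · rw [if_neg (by omega), if_neg (by omega), Nat.choose_eq_zero_of_lt (by omega)]
      simp

lemma coeff_GP_oneRow (n d : ℕ) :
    MvPowerSeries.coeff (Finsupp.single 0 d) (GP (oneRow n)) = if d = n then 1 else 0 := by
  have hdec : DecidablePred Letter.IsPrimed := fun a =>
    inferInstanceAs (Decidable ((ofLex a).2 = false))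
  unfold GP SetShYTP
  generalize hD : (oneRow n).SD = D
  rw [oneRow_SD] at hD
  subst hD
  rcases n with _ | n
  · refine coeff_setFillings_empty d _ fun T => ?_
    have h : ∀ b : rowDiagram 0 0, False := fun b =>
      absurd (rowDiagram_snd b).2 (Nat.not_lt_zero _)
    exact ⟨⟨fun b => (h b).elim, fun b => (h b).elim, fun b => (h b).elim, fun b => (h b).elim,
      fun b => (h b).elim⟩, fun b => (h b).elim⟩
  · rw [coeff_setFillings d, card_rowDiagram]
    have hdiag : ∀ T : rowDiagram 0 (n + 1) → Finset Letter,
        (∀ b : rowDiagram 0 (n + 1), b.1.1 = b.1.2 → ∀ a ∈ T b, ¬ a.IsPrimed) ↔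
          ∀ a ∈ T ⟨(0, 0), by simp⟩, ¬ a.IsPrimed := by
      intro T
      constructor
      · exact fun h => h _ rfl
      · intro h b hb
        rwa [show b = ⟨(0, 0), by simp⟩ from rowDiagram_ext (by rw [← hb, rowDiagram_fst])]
    simp only [hdiag]
    rw [ncard_setFillings n d fun A => ∀ a ∈ A, ¬ a.IsPrimed]
    have hA : ∀ A ⊆ ({primed 0, unprimed 0} : Finset Letter), (A.Nonempty ∧ A.card + n = d ∧
        ∀ a ∈ A, ¬ a.IsPrimed) ↔ A = {unprimed 0} ∧ d = n + 1 := by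
      intro A hA
      constructor
      · rintro ⟨h1, h2, h3⟩
        have h4 : A = {unprimed 0} := by
          rw [Finset.eq_singleton_iff_nonempty_unique_mem]
          refine ⟨h1, fun a ha => ?_⟩
          have := hA ha
          rw [Finset.mem_insert, Finset.mem_singleton] at this
          rcases this with rfl | h5
          · exact absurd rfl (h3 _ ha)
          · exact h5
        rw [h4, Finset.card_singleton] at h2
        exact ⟨h4, by omega⟩
      · rintro ⟨rfl, rfl⟩
        refine ⟨Finset.singleton_nonempty _, by rw [Finset.card_singleton, add_comm], ?_⟩
        intro a ha
        rw [Finset.mem_singleton.1 ha]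
        simp [Letter.IsPrimed, unprimed]
    split_ifs with hd
    · rw [show (Finset.filter _ _) = ({{unprimed 0}} : Finset (Finset Letter)) from ?_]
      · simp [hd]
      · ext A
        rw [Finset.mem_filter, Finset.mem_powerset, Finset.mem_singleton]
        constructor
        · rintro ⟨h1, h2⟩
          exact ((hA A h1).1 h2).1
        · rintro rfl
          have h1 : ({unprimed 0} : Finset Letter) ⊆ {primed 0, unprimed 0} :=
            Finset.subset_insert _ _
          exact ⟨h1, (hA _ h1).2 ⟨rfl, hd⟩⟩
    · rw [Finset.filter_false_of_mem]
      · simp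
      · intro A h1 h2
        exact hd ((hA A (Finset.mem_powerset.1 h1)).1 h2).2

lemma coeff_setFillings_of_two_le_length {lam : StrictPartition} (h : 2 ≤ lam.length) (d : ℕ)
    (A : (lam.SD → Finset Letter) → Prop) (hA : ∀ T, A T → IsSetSemistandard lam.SD T) :
    MvPowerSeries.coeff (Finsupp.single 0 d) (genFun (fun T : {T // A T} => setWeight T.1)
      fun T => β ^ (setSize T.1 - lam.SD.card)) = 0 := by
  rw [coeff_setFillings]
  have : {T | A T ∧ setWeight T = Finsupp.single 0 d} = ∅ := by
    rw [Set.eq_empty_iff_forall_notMem]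
    rintro T ⟨hT, hw⟩
    obtain ⟨h1, h2, h3⟩ := mem_SD_of_two_le_length h
    exact not_isSetSemistandard_of_corner h1 h2 h3 (hA T hT)
      fun b a => index_eq_zero_of_setWeight hw b
  rw [this]
  simp

open Classical in
/-- In one variable, `GP_{(n)}(x) = x^n`, and `GP_λ(x) = 0` if `λ` has more than one part. -/
lemma coeff_GP (lam : StrictPartition) (d : ℕ) :
    MvPowerSeries.coeff (Finsupp.single 0 d) (GP lam) = if lam = oneRow d then 1 else 0 := by
  by_cases h : lam.length ≤ 1
  · rw [eq_oneRow_of_length_le h, coeff_GP_oneRow]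
    simp only [oneRow_injective.eq_iff, eq_comm]
  · rw [if_neg]
    · exact coeff_setFillings_of_two_le_length (by omega) d _ fun T hT => hT.1
    · rintro rfl
      rcases Nat.eq_zero_or_pos d with rfl | hd
      · simp [oneRow_length_zero] at h
      · simp [oneRow_length_of_pos hd] at h

lemma coeff_GQ_of_two_le_length {lam : StrictPartition} (h : 2 ≤ lam.length) (d : ℕ) :
    MvPowerSeries.coeff (Finsupp.single 0 d) (GQ lam) = 0 :=
  coeff_setFillings_of_two_le_length h d _ fun _ hT => hT

/-! ### The coefficient of `GP_λ` and `GQ_λ` for `λ` with at most one part -/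

section Coefficient

variable {M : Type} [CommRing M] [Algebra (Polynomial ℤ) M]

lemma eq_single_of_support {n : ℕ} {α : ℕ →₀ ℕ} (h : ∀ i ∈ α.support, i < (oneRow n).length) :
    ∃ d, α = Finsupp.single 0 d ∧ (n = 0 → d = 0) := by
  rcases Nat.eq_zero_or_pos n with rfl | hn
  · rw [oneRow_length_zero] at h
    refine ⟨0, ?_, fun _ => rfl⟩
    rw [Finsupp.single_zero, ← Finsupp.support_eq_empty, Finset.eq_empty_iff_forall_notMem]
    exact fun i hi => absurd (h i hi) (Nat.not_lt_zero i)
  · rw [oneRow_length_of_pos hn] at h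
    refine ⟨α 0, ?_, fun h => absurd h hn.ne'⟩
    ext i
    by_cases hi : i = 0
    · rw [hi, Finsupp.single_eq_same]
    · rw [Finsupp.single_eq_of_ne hi]
      by_contra h'
      exact hi (Nat.lt_one_iff.1 (h i (Finsupp.mem_support_iff.2 h')))

lemma single_support_lt {n d : ℕ} (h : n = 0 → d = 0) :
    ∀ i ∈ (Finsupp.single 0 d).support, i < (oneRow n).length := by
  intro i hi
  rcases Nat.eq_zero_or_pos n with rfl | hn
  · rw [h rfl] at hi
    simp at hi
  · rw [oneRow_length_of_pos hn]
    have := Finsupp.support_single_subset hi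
    rw [Finset.mem_singleton] at this
    omega

/-- Whether or not there is an expansion in all variables, the coefficient of `G_{(n)}` only
depends on the expansion in a single variable. -/
lemma coefficient_oneRow (G : StrictPartition → PS) (f : MvPowerSeries ℕ M) (n : ℕ)
    (c : StrictPartition → M)
    (hc : ∀ d, MvPowerSeries.coeff (Finsupp.single 0 d) f =
      ∑ᶠ l, MvPowerSeries.coeff (Finsupp.single 0 d) (G l) • c l)
    (huniq : ∀ c' : StrictPartition → M, (∀ d, (n = 0 → d = 0) →
      MvPowerSeries.coeff (Finsupp.single 0 d) f =
        ∑ᶠ l, MvPowerSeries.coeff (Finsupp.single 0 d) (G l) • c' l) →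
      c' (oneRow n) = c (oneRow n)) :
    coefficient G f (oneRow n) = c (oneRow n) := by
  unfold coefficient
  split_ifs with h h'
  · exact huniq _ fun d _ => h.choose_spec _
  · exact huniq _ fun d hd => h'.choose_spec _ (single_support_lt hd)
  · refine absurd ⟨c, fun α hα => ?_⟩ h'
    obtain ⟨d, rfl, -⟩ := eq_single_of_support hα
    exact hc d

lemma finsum_GP (c : StrictPartition → M) (d : ℕ) :
    ∑ᶠ l, MvPowerSeries.coeff (Finsupp.single 0 d) (GP l) • c l = c (oneRow d) := by
  rw [finsum_eq_single _ (oneRow d)]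
  · rw [coeff_GP, if_pos rfl, one_smul]
  · intro l hl
    rw [coeff_GP, if_neg hl, zero_smul]

lemma coefficient_GP (f : MvPowerSeries ℕ M) (n : ℕ) :
    coefficient GP f (oneRow n) = MvPowerSeries.coeff (Finsupp.single 0 n) f := by
  rw [coefficient_oneRow GP f n fun l => MvPowerSeries.coeff (Finsupp.single 0 (l.part 0)) f]
  · simp only [oneRow_part_zero]
  · intro d
    rw [finsum_GP, oneRow_part_zero]
  · intro c' hc'
    simp only [oneRow_part_zero]
    rw [hc' n id, finsum_GP]

lemma finsum_GQ_zero (c : StrictPartition → M) :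
    ∑ᶠ l, MvPowerSeries.coeff (Finsupp.single 0 0) (GQ l) • c l = c (oneRow 0) := by
  rw [finsum_eq_single _ (oneRow 0)]
  · rw [coeff_GQ_oneRow_zero, if_pos rfl, one_smul]
  · intro l hl
    by_cases h : l.length ≤ 1
    · rw [eq_oneRow_of_length_le h] at hl ⊢
      rcases hk : l.part 0 with _ | k
      · exact absurd (by rw [hk]) hl
      · rw [coeff_GQ_oneRow_succ, if_neg (by omega), if_neg (by omega), zero_smul]
    · rw [coeff_GQ_of_two_le_length (by omega), zero_smul]

lemma finsum_GQ_succ (c : StrictPartition → M) (d : ℕ) :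
    ∑ᶠ l, MvPowerSeries.coeff (Finsupp.single 0 (d + 1)) (GQ l) • c l =
      2 * c (oneRow (d + 1)) + if d = 0 then 0 else β • c (oneRow d) := by
  classical
  rw [finsum_eq_sum_of_support_subset (s := {oneRow (d + 1), oneRow d}),
    Finset.sum_pair fun h => absurd (oneRow_injective h) (Nat.succ_ne_self d)]
  · congr 1
    · rw [coeff_GQ_oneRow_succ, if_pos rfl, ofNat_smul_eq_nsmul, nsmul_eq_mul]
      norm_num
    · rcases d with _ | d
      · simp [coeff_GQ_oneRow_zero]
      · rw [coeff_GQ_oneRow_succ, if_neg (by omega), if_pos rfl, if_neg (by omega)]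
  · intro l hl
    rw [Function.mem_support] at hl
    simp only [Finset.coe_insert, Finset.coe_singleton, Set.mem_insert_iff, Set.mem_singleton_iff]
    by_contra! hne
    apply hl
    by_cases h : l.length ≤ 1
    · rw [eq_oneRow_of_length_le h] at hne ⊢
      rcases hk : l.part 0 with _ | k
      · rw [coeff_GQ_oneRow_zero, if_neg (Nat.succ_ne_zero d), zero_smul]
      · rw [hk, Ne, Ne, oneRow_injective.eq_iff, oneRow_injective.eq_iff] at hne
        rw [coeff_GQ_oneRow_succ, if_neg (by omega), if_neg (by omega), zero_smul]
    · rw [coeff_GQ_of_two_le_length (by omega), zero_smul]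

/-- The numbers `g n` are the coefficients of `GQ_{(n)}` if
`f(x) = g 0 + ∑_{n ≥ 1} g n (2 + βx) x^n`. -/
lemma coefficient_GQ (h2 : ∀ a : M, 2 * a = 0 → a = 0) (f : MvPowerSeries ℕ M) (g : ℕ → M)
    (h0 : MvPowerSeries.coeff (Finsupp.single 0 0) f = g 0)
    (hsucc : ∀ d, MvPowerSeries.coeff (Finsupp.single 0 (d + 1)) f =
      2 * g (d + 1) + if d = 0 then 0 else β • g d) (n : ℕ) :
    coefficient GQ f (oneRow n) = g n := by
  rw [coefficient_oneRow GQ f n fun l => g (l.part 0)]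
  · simp only [oneRow_part_zero]
  · rintro (_ | d)
    · rw [finsum_GQ_zero, oneRow_part_zero, h0]
    · rw [finsum_GQ_succ, oneRow_part_zero, oneRow_part_zero, hsucc]
  · intro c hc
    rw [oneRow_part_zero]
    have hc0 : c (oneRow 0) = g 0 := by
      rw [← h0, hc 0 fun _ => rfl, finsum_GQ_zero]
    rcases Nat.eq_zero_or_pos n with rfl | hn
    · exact hc0
    · have key : ∀ k, c (oneRow k) = g k := by
        intro k
        induction k with
        | zero => exact hc0
        | succ k ih =>
          have := hc (k + 1) fun h => absurd h hn.ne'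
          rw [hsucc, finsum_GQ_succ, ih, add_left_inj] at this
          exact (sub_eq_zero.1 (h2 _ (by rw [mul_sub, this, sub_self]))).symm
      exact key n

end Coefficient

/-! ### The skew dual functions -/

lemma two_mul_eq_zero_polynomial (a : Polynomial ℤ) (h : 2 * a = 0) : a = 0 := by
  rcases mul_eq_zero.1 h with h | h
  · exact absurd h two_ne_zero
  · exact h

lemma two_mul_eq_zero_PS (a : PS) (h : 2 * a = 0) : a = 0 := by
  ext1 γ
  have := congrArg (MvPowerSeries.coeff γ) h
  rw [two_mul, map_add, ← two_mul, map_zero] at this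
  rw [two_mul_eq_zero_polynomial _ this, map_zero]

lemma gq_oneRow (n : ℕ) :
    gq (oneRow n) = MvPowerSeries.coeff (Finsupp.single 0 n) cauchyKernel :=
  coefficient_GP _ _

/-- The function `gp_{(n)}`. Since `1 + v = (2 + βx) v` for `v = 1 / (1 + βx)`, the coefficient
`x^{|γ|} (1 + v)^r` of `y^γ ≠ 1` in the Cauchy kernel is `2 + βx` times `x^{|γ|} v (1 + v)^{r-1}`,
and `GQ_{(n)}(x) = (2 + βx) x^n` for `n ≥ 1`. -/
noncomputable def gpOneRow (n : ℕ) : PS := fun γ : ℕ →₀ ℕ =>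
  if n = 0 then if γ = 0 then 1 else 0
  else if γ = 0 then 0
  else PowerSeries.coeff n (PowerSeries.X ^ γ.degree *
    (invOneAddPow 1 * (1 + invOneAddPow 1) ^ (γ.support.card - 1)))

lemma coeff_gpOneRow (n : ℕ) (γ : ℕ →₀ ℕ) : MvPowerSeries.coeff γ (gpOneRow n) =
    if n = 0 then if γ = 0 then 1 else 0
    else if γ = 0 then 0
    else PowerSeries.coeff n (PowerSeries.X ^ γ.degree *
      (invOneAddPow 1 * (1 + invOneAddPow 1) ^ (γ.support.card - 1))) := rfl

lemma coeff_cauchyKernel_zero :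
    MvPowerSeries.coeff (Finsupp.single 0 0) cauchyKernel = gpOneRow 0 := by
  ext1 γ
  rw [coeff_cauchyKernel, coeff_gpOneRow, if_pos rfl]
  split_ifs with hγ
  · simp [hγ]
  · have h1 : γ.degree ≠ 0 := fun h => hγ ((Finsupp.degree_eq_zero_iff γ).1 h)
    simp [h1]

lemma coeff_cauchyKernel_succ (d : ℕ) :
    MvPowerSeries.coeff (Finsupp.single 0 (d + 1)) cauchyKernel =
    2 * gpOneRow (d + 1) + if d = 0 then 0 else β • gpOneRow d := by
  ext1 γ
  rw [coeff_cauchyKernel, two_mul, map_add, map_add, ← two_mul, coeff_gpOneRow,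
    if_neg (Nat.succ_ne_zero d)]
  by_cases hγ : γ = 0
  · subst hγ
    by_cases hd : d = 0
    · simp [hd, PowerSeries.coeff_one]
    · simp [hd, coeff_gpOneRow, PowerSeries.coeff_one]
  · have h1 : 0 < γ.degree := Nat.pos_of_ne_zero fun h => hγ ((Finsupp.degree_eq_zero_iff γ).1 h)
    have h2 : 0 < γ.support.card := Finset.card_pos.2 (Finsupp.support_nonempty_iff.2 hγ)
    rw [if_neg hγ]
    set P := PowerSeries.X ^ γ.degree *
      (invOneAddPow 1 * (1 + invOneAddPow 1) ^ (γ.support.card - 1)) with hP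
    have h3 : PowerSeries.X ^ γ.degree * (1 + invOneAddPow 1) ^ γ.support.card =
        2 * P + PowerSeries.C β * (PowerSeries.X * P) := by
      have h4 := one_add_mul_invOneAddPow_one
      rw [hP]
      obtain ⟨r, hr⟩ : ∃ r, γ.support.card = r + 1 := ⟨_, (Nat.sub_add_cancel h2).symm⟩
      rw [hr, Nat.add_sub_cancel, pow_succ]
      linear_combination (-PowerSeries.X ^ γ.degree * (1 + invOneAddPow 1) ^ r) * h4
    rw [h3, map_add, PowerSeries.coeff_C_mul, PowerSeries.coeff_succ_X_mul, two_mul, map_add,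
      ← two_mul]
    congr 1
    split_ifs with hd
    · subst hd
      rw [hP, PowerSeries.coeff_zero_eq_constantCoeff]
      simp [h1.ne']
    · rw [MvPowerSeries.coeff_smul, coeff_gpOneRow, if_neg hd, if_neg hγ]

lemma gp_oneRow (n : ℕ) : gp (oneRow n) = gpOneRow n :=
  coefficient_GQ two_mul_eq_zero_PS _ _ coeff_cauchyKernel_zero coeff_cauchyKernel_succ n

lemma coeff_mul_single {f g : PS} (d : ℕ) :
    MvPowerSeries.coeff (Finsupp.single 0 d) (f * g) =
      ∑ p ∈ Finset.HasAntidiagonal.antidiagonal d, MvPowerSeries.coeff (Finsupp.single 0 p.1) f *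
        MvPowerSeries.coeff (Finsupp.single 0 p.2) g := by
  classical
  rw [MvPowerSeries.coeff_mul, Finsupp.antidiagonal_single, Finset.sum_map]
  rfl

open Classical in
lemma aCoeff_oneRow (m n : ℕ) (nu : StrictPartition) (h : m ≤ n) :
    aCoeff (oneRow m) nu (oneRow n) = if nu = oneRow (n - m) then 1 else 0 := by
  rw [aCoeff, coefficient_GP, coeff_mul_single, Finset.sum_eq_single (m, n - m)]
  · rw [coeff_GP, coeff_GP, if_pos rfl, one_mul]
  · intro p hp hne
    rw [Finset.HasAntidiagonal.mem_antidiagonal] at hp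
    rw [coeff_GP, if_neg, zero_mul]
    intro h'
    have := oneRow_injective h'
    exact hne (Prod.ext this.symm (by simp; omega))
  · intro h'
    rw [Finset.HasAntidiagonal.mem_antidiagonal] at h'
    exact absurd (Nat.add_sub_cancel' h) h'

lemma gqSkew_oneRow {m n : ℕ} (h : m ≤ n) :
    gqSkew (oneRow n) (oneRow m) =
      MvPowerSeries.coeff (Finsupp.single 0 (n - m)) cauchyKernel := by
  rw [gqSkew, finsum_eq_single _ (oneRow (n - m)), aCoeff_oneRow m n _ h, if_pos rfl, one_smul,
    gq_oneRow]
  intro nu hnu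
  rw [aCoeff_oneRow m n _ h, if_neg hnu, zero_smul]

lemma bCoeff_eq_zero {m n : ℕ} {nu : StrictPartition} (h : 2 ≤ nu.length) :
    bCoeff (oneRow m) nu (oneRow n) = 0 := by
  have h1 : ∀ d, MvPowerSeries.coeff (Finsupp.single 0 d) (GQ (oneRow m) * GQ nu) = 0 := by
    intro d
    rw [coeff_mul_single]
    exact Finset.sum_eq_zero fun p _ => by rw [coeff_GQ_of_two_le_length h, mul_zero]
  rw [bCoeff, coefficient_GQ two_mul_eq_zero_polynomial _ (fun _ => 0)]
  · exact h1 0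
  · intro d
    rw [h1]
    split_ifs <;> simp

lemma bCoeff_one (n : ℕ) (k : ℕ) :
    bCoeff (oneRow 0) (oneRow k) (oneRow n) = if k = n then 1 else 0 := by
  have h1 : ∀ d, MvPowerSeries.coeff (Finsupp.single 0 d) (GQ (oneRow 0) * GQ (oneRow k)) =
      MvPowerSeries.coeff (Finsupp.single 0 d) (GQ (oneRow k)) := by
    intro d
    rw [coeff_mul_single, Finset.sum_eq_single (0, d)]
    · rw [coeff_GQ_oneRow_zero, if_pos rfl, one_mul]
    · rintro ⟨a, b⟩ hp hne
      rw [Finset.HasAntidiagonal.mem_antidiagonal] at hp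
      rw [coeff_GQ_oneRow_zero, if_neg, zero_mul]
      rintro h
      simp only at hp h
      exact hne (Prod.ext h (by simp; omega))
    · simp
  rw [bCoeff, coefficient_GQ two_mul_eq_zero_polynomial _ (fun n => if k = n then 1 else 0)]
  · rw [h1]
    rcases k with _ | k
    · rw [coeff_GQ_oneRow_zero]
    · rw [coeff_GQ_oneRow_succ, if_neg (by omega), if_neg (by omega), if_neg (by omega)]
  · intro d
    rw [h1]
    rcases k with _ | k
    · simp only [coeff_GQ_oneRow_zero]
      by_cases hd : d = 0
      · simp [hd]
      · simp [hd, Ne.symm hd]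
    · rw [coeff_GQ_oneRow_succ]
      by_cases h2 : d = k
      · simp [h2]
      · by_cases h3 : d = k + 1
        · simp [h3]
        · simp [h2, h3, Ne.symm h2, Ne.symm h3]

/-- For `m, k ≥ 1`, the product `(2 + βx) x^m (2 + βx) x^k` of `GQ_{(m)}` and `GQ_{(k)}` in one
variable is `2 GQ_{(m+k)} + β GQ_{(m+k+1)}`. -/
lemma bCoeff_oneRow_succ (m k n : ℕ) :
    bCoeff (oneRow (m + 1)) (oneRow k) (oneRow n) =
      if k = 0 then if n = m + 1 then 1 else 0
      else if n = m + 1 + k then 2 else if n = m + 1 + k + 1 then β else 0 := by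
  have h1 : ∀ d, MvPowerSeries.coeff (Finsupp.single 0 d) (GQ (oneRow (m + 1)) * GQ (oneRow k)) =
      (if m + 1 ≤ d then 2 * MvPowerSeries.coeff (Finsupp.single 0 (d - (m + 1))) (GQ (oneRow k))
        else 0) +
      (if m + 2 ≤ d then β * MvPowerSeries.coeff (Finsupp.single 0 (d - (m + 2))) (GQ (oneRow k))
        else 0) := by
    intro d
    rw [coeff_mul_single]
    have h2 : ∀ p ∈ Finset.HasAntidiagonal.antidiagonal d,
        MvPowerSeries.coeff (Finsupp.single 0 p.1) (GQ (oneRow (m + 1))) *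
          MvPowerSeries.coeff (Finsupp.single 0 p.2) (GQ (oneRow k)) =
        (if p.1 = m + 1 then
          2 * MvPowerSeries.coeff (Finsupp.single 0 p.2) (GQ (oneRow k)) else 0) +
        (if p.1 = m + 2 then
          β * MvPowerSeries.coeff (Finsupp.single 0 p.2) (GQ (oneRow k)) else 0) := by
      intro p _
      rw [coeff_GQ_oneRow_succ]
      by_cases h3 : p.1 = m + 1
      · simp [h3]
      · by_cases h4 : p.1 = m + 2
        · simp [h4]
        · simp [h3, h4]
    rw [Finset.sum_congr rfl h2, Finset.sum_add_distrib,
      Finset.Nat.sum_antidiagonal_eq_sum_range_succ_mk,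
      Finset.Nat.sum_antidiagonal_eq_sum_range_succ_mk]
    simp only [Finset.sum_ite_eq', Finset.mem_range]
    simp only [Nat.lt_succ_iff]
  rw [bCoeff, coefficient_GQ two_mul_eq_zero_polynomial _ (fun n =>
      if k = 0 then if n = m + 1 then 1 else 0
      else if n = m + 1 + k then 2 else if n = m + 1 + k + 1 then β else 0)]
  · rw [h1]
    split_ifs <;> first | (exfalso; omega) | simp
  · intro d
    rw [h1, smul_eq_mul]
    rcases k with _ | k
    · simp only [coeff_GQ_oneRow_zero]
      split_ifs <;> first | (exfalso; omega) | simp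
    · simp only [coeff_GQ_oneRow_succ]
      split_ifs <;> first | (exfalso; omega) | simp

lemma gpSkew_oneRow_zero (n : ℕ) : gpSkew (oneRow n) (oneRow 0) = gpOneRow n := by
  rw [gpSkew, finsum_eq_single _ (oneRow n), bCoeff_one, if_pos rfl, one_smul, gp_oneRow]
  intro nu hnu
  by_cases h : nu.length ≤ 1
  · rw [eq_oneRow_of_length_le h] at hnu ⊢
    rw [bCoeff_one, if_neg fun h' => hnu (congrArg oneRow h'), zero_smul]
  · rw [bCoeff_eq_zero (by omega), zero_smul]

/-- For `μ ≠ ∅`, the functions `gp_{(n)/μ}` and `gq_{(n)/μ}` agree. -/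
lemma gpSkew_oneRow_succ {m n : ℕ} (h : m + 1 ≤ n) :
    gpSkew (oneRow n) (oneRow (m + 1)) =
      MvPowerSeries.coeff (Finsupp.single 0 (n - (m + 1))) cauchyKernel := by
  classical
  obtain ⟨j, rfl⟩ := Nat.exists_eq_add_of_le h
  rw [Nat.add_sub_cancel_left, gpSkew]
  rcases j with _ | d
  · rw [coeff_cauchyKernel_zero, finsum_eq_single _ (oneRow 0), bCoeff_oneRow_succ, if_pos rfl,
      if_pos rfl, one_smul, gp_oneRow]
    intro nu hnu
    by_cases h : nu.length ≤ 1
    · rw [eq_oneRow_of_length_le h] at hnu ⊢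
      have hk : nu.part 0 ≠ 0 := fun h' => hnu (congrArg oneRow h')
      rw [bCoeff_oneRow_succ, if_neg hk, if_neg (by omega), if_neg (by omega), zero_smul]
    · rw [bCoeff_eq_zero (by omega), zero_smul]
  · rw [coeff_cauchyKernel_succ, finsum_eq_sum_of_support_subset (s := {oneRow (d + 1), oneRow d}),
      Finset.sum_pair fun h => absurd (oneRow_injective h) (Nat.succ_ne_self d)]
    · congr 1
      · rw [bCoeff_oneRow_succ, if_neg (Nat.succ_ne_zero d), if_pos rfl, gp_oneRow,
          ofNat_smul_eq_nsmul, nsmul_eq_mul]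
        norm_num
      · rcases d with _ | d
        · rw [bCoeff_oneRow_succ, if_pos rfl, if_neg (by omega), if_pos rfl, zero_smul]
        · rw [bCoeff_oneRow_succ, if_neg (by omega), if_neg (by omega), if_pos (by omega),
            if_neg (by omega), gp_oneRow]
    · intro nu hl
      rw [Function.mem_support] at hl
      simp only [Finset.coe_insert, Finset.coe_singleton, Set.mem_insert_iff,
        Set.mem_singleton_iff]
      by_contra! hne
      apply hl
      by_cases h : nu.length ≤ 1
      · rw [eq_oneRow_of_length_le h] at hne ⊢
        rw [Ne, Ne, oneRow_injective.eq_iff, oneRow_injective.eq_iff] at hne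
        rw [bCoeff_oneRow_succ]
        by_cases hk : nu.part 0 = 0
        · rw [if_pos hk, if_neg (by omega), zero_smul]
        · rw [if_neg hk, if_neg (by omega), if_neg (by omega), zero_smul]
      · rw [bCoeff_eq_zero (by omega), zero_smul]

/-- The coefficient of `y^γ` in the coefficient of `x^N` in the Cauchy kernel. -/
lemma coeff_cauchyKernel_eq (N : ℕ) (γ : ℕ →₀ ℕ) :
    MvPowerSeries.coeff γ (MvPowerSeries.coeff (Finsupp.single 0 N) cauchyKernel) =
    if γ.degree ≤ N then (-β) ^ (N - γ.degree) *
      (onePlusPowCoeff γ.support.card (N - γ.degree) : Polynomial ℤ) else 0 := by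
  rw [coeff_cauchyKernel, PowerSeries.coeff_X_pow_mul', coeff_one_add_pow]

lemma coeff_gpOneRow_eq {N : ℕ} (hN : 0 < N) (γ : ℕ →₀ ℕ) :
    MvPowerSeries.coeff γ (gpOneRow N) =
    if γ.degree ≤ N then (-β) ^ (N - γ.degree) *
      (onePlusPowCoeff' γ.support.card (N - γ.degree) : Polynomial ℤ) else 0 := by
  rw [coeff_gpOneRow, if_neg hN.ne']
  split_ifs with hγ h h
  · subst hγ
    simp [onePlusPowCoeff']
  · rfl
  · rw [PowerSeries.coeff_X_pow_mul', if_pos h, coeff_mul_one_add_pow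
      (Finset.card_pos.2 (Finsupp.support_nonempty_iff.2 hγ))]
  · rw [PowerSeries.coeff_X_pow_mul', if_neg h]

/-! ### Bar tableaux with a single row: counting contents -/

/-- The refined letters that label the blocks of a bar tableau: the pair `(i, 0)` labels a block
with the entry `i'`, and `(i, q)` for `q ≥ 1` labels the `q`-th block with the entry `i`. -/
abbrev BlockLabel : Type := ℕ ×ₗ ℕ

/-- The label of the block `(i, q)`. -/
def blockLabel (i q : ℕ) : BlockLabel := toLex (i, q)

lemma blockLabel_inj {i q i' q' : ℕ} : blockLabel i q = blockLabel i' q' ↔ i = i' ∧ q = q' := by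
  simp [blockLabel]

lemma exists_blockLabel (z : BlockLabel) : ∃ i q, z = blockLabel i q :=
  ⟨(ofLex z).1, (ofLex z).2, rfl⟩

/-- The labels of the blocks with unprimed entries, if the weight is `γ` and the primed numbers in
use are those of the set `S`. -/
def unprimedLabels (γ : ℕ →₀ ℕ) (S : Finset ℕ) : Finset BlockLabel :=
  (γ.support.sigma fun i => Finset.Icc 1 (γ i - if i ∈ S then 1 else 0)).image
    fun x => blockLabel x.1 x.2

/-- The labels of the blocks with primed entries. -/
def primedLabels (S : Finset ℕ) : Finset BlockLabel := S.image fun i => blockLabel i 0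

lemma mem_unprimedLabels {γ : ℕ →₀ ℕ} {S : Finset ℕ} {i q : ℕ} :
    blockLabel i q ∈ unprimedLabels γ S ↔ 0 < q ∧ q + (if i ∈ S then 1 else 0) ≤ γ i := by
  simp only [unprimedLabels, Finset.mem_image, Finset.mem_sigma, Finsupp.mem_support_iff,
    Finset.mem_Icc, Sigma.exists, blockLabel_inj]
  constructor
  · rintro ⟨i, q, ⟨h1, h2⟩, rfl, rfl⟩
    omega
  · rintro h
    refine ⟨i, q, ⟨?_, ?_⟩, rfl, rfl⟩ <;> omega

lemma mem_primedLabels {S : Finset ℕ} {i q : ℕ} :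
    blockLabel i q ∈ primedLabels S ↔ q = 0 ∧ i ∈ S := by
  simp only [primedLabels, Finset.mem_image, blockLabel_inj]
  constructor
  · rintro ⟨i, h, rfl, rfl⟩
    exact ⟨rfl, h⟩
  · rintro ⟨rfl, h⟩
    exact ⟨i, h, rfl, rfl⟩

lemma card_primedLabels (S : Finset ℕ) : (primedLabels S).card = S.card :=
  Finset.card_image_of_injective _ fun _ _ h => (blockLabel_inj.1 h).1

lemma card_unprimedLabels {γ : ℕ →₀ ℕ} {S : Finset ℕ} (hS : S ⊆ γ.support) :
    (unprimedLabels γ S).card + S.card = γ.degree := by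
  rw [unprimedLabels, Finset.card_image_of_injective, Finset.card_sigma]
  · have h1 : S.card = ∑ i ∈ γ.support, if i ∈ S then 1 else 0 := by
      rw [Finset.sum_ite_mem, Finset.inter_eq_right.2 hS, Finset.card_eq_sum_ones]
    rw [h1, ← Finset.sum_add_distrib, Finsupp.degree_apply]
    refine Finset.sum_congr rfl fun i hi => ?_
    rw [Nat.card_Icc]
    have := Finsupp.mem_support_iff.1 hi
    split_ifs <;> omega
  · rintro ⟨i, q⟩ ⟨i', q'⟩ h
    obtain ⟨rfl, rfl⟩ := blockLabel_inj.1 h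
    rfl

/-- The multiset of labels of the boxes of a bar tableau with a single row of weight `γ`, whose
primed numbers are those of the set `S` and for which `t` lists the surplus boxes of the blocks. -/
def barContent (γ : ℕ →₀ ℕ) (S : Finset ℕ) (t : Multiset BlockLabel) : Multiset BlockLabel :=
  (primedLabels S).val + (unprimedLabels γ S).val + t

/-- The condition on the labels of the boxes of a row that they come from a bar tableau of
weight `γ`. -/
structure HasBarWeight (γ : ℕ →₀ ℕ) (s : Multiset BlockLabel) : Prop where
  count_le : ∀ i, s.count (blockLabel i 0) ≤ 1
  pos : ∀ i, blockLabel i 0 ∈ s → 0 < γ i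
  mem_iff : ∀ i q, 0 < q →
    (blockLabel i q ∈ s ↔ q + (if blockLabel i 0 ∈ s then 1 else 0) ≤ γ i)

lemma card_barContent {γ : ℕ →₀ ℕ} {S : Finset ℕ} (hS : S ⊆ γ.support) (t : Multiset BlockLabel) :
    Multiset.card (barContent γ S t) = γ.degree + Multiset.card t := by
  rw [barContent, Multiset.card_add, Multiset.card_add, Finset.card_val, Finset.card_val,
    card_primedLabels, ← card_unprimedLabels hS, add_comm S.card]

lemma mem_barContent_iff {γ : ℕ →₀ ℕ} {S : Finset ℕ} {t : Multiset BlockLabel}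
    (ht : ∀ z ∈ t, z ∈ unprimedLabels γ S) (i q : ℕ) : blockLabel i q ∈ barContent γ S t ↔
      (q = 0 ∧ i ∈ S) ∨ (0 < q ∧ q + (if i ∈ S then 1 else 0) ≤ γ i) := by
  rw [barContent, Multiset.mem_add, Multiset.mem_add, Finset.mem_val, Finset.mem_val,
    mem_primedLabels, mem_unprimedLabels, or_assoc]
  refine or_congr_right (or_iff_left_of_imp fun h => ?_)
  exact mem_unprimedLabels.1 (ht _ h)

lemma mem_barContent_zero {γ : ℕ →₀ ℕ} {S : Finset ℕ} {t : Multiset BlockLabel}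
    (ht : ∀ z ∈ t, z ∈ unprimedLabels γ S) (i : ℕ) :
    blockLabel i 0 ∈ barContent γ S t ↔ i ∈ S := by
  rw [mem_barContent_iff ht]
  simp

lemma hasBarWeight_barContent {γ : ℕ →₀ ℕ} {S : Finset ℕ} (hS : S ⊆ γ.support)
    {t : Multiset BlockLabel} (ht : ∀ z ∈ t, z ∈ unprimedLabels γ S) :
    HasBarWeight γ (barContent γ S t) where
  count_le i := by
    have h1 : blockLabel i 0 ∉ unprimedLabels γ S := fun h =>
      (lt_irrefl 0 (mem_unprimedLabels.1 h).1)
    rw [barContent, Multiset.count_add, Multiset.count_add,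
      Multiset.count_eq_zero_of_notMem (s := t) fun h => h1 (ht _ h),
      Multiset.count_eq_zero_of_notMem (s := (unprimedLabels γ S).val) h1]
    exact Multiset.nodup_iff_count_le_one.1 (primedLabels S).nodup _
  pos i h := by
    rw [mem_barContent_zero ht] at h
    exact Nat.pos_of_ne_zero (Finsupp.mem_support_iff.1 (hS h))
  mem_iff i q hq := by
    simp only [mem_barContent_zero ht]
    rw [mem_barContent_iff ht]
    simp [hq, hq.ne']

lemma exists_barContent {γ : ℕ →₀ ℕ} {s : Multiset BlockLabel} (hs : HasBarWeight γ s) :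
    ∃ S ⊆ γ.support, ∃ t : Multiset BlockLabel, (∀ z ∈ t, z ∈ unprimedLabels γ S) ∧
      barContent γ S t = s := by
  classical
  set S := γ.support.filter fun i => blockLabel i 0 ∈ s with hSdef
  have hmem : ∀ i, i ∈ S ↔ blockLabel i 0 ∈ s := by
    intro i
    rw [hSdef, Finset.mem_filter, Finsupp.mem_support_iff, and_iff_right_iff_imp]
    exact fun h => (hs.pos i h).ne'
  have hmem' : ∀ i q, 0 < q → (blockLabel i q ∈ s ↔ blockLabel i q ∈ unprimedLabels γ S) := by
    intro i q hq
    rw [hs.mem_iff i q hq, mem_unprimedLabels]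
    simp only [hmem, hq, true_and]
  have hle : (primedLabels S).val + (unprimedLabels γ S).val ≤ s := by
    rw [← Finset.disjUnion_val _ _ ?_, Finset.val_le_iff_val_subset]
    · intro z hz
      obtain ⟨i, q, rfl⟩ := exists_blockLabel z
      rw [Finset.mem_val, Finset.mem_disjUnion, mem_primedLabels] at hz
      rcases hz with ⟨rfl, h⟩ | h
      · exact (hmem i).1 h
      · exact (hmem' i q (mem_unprimedLabels.1 h).1).2 h
    · rw [Finset.disjoint_left]
      intro z hz hz'
      obtain ⟨i, q, rfl⟩ := exists_blockLabel z
      rw [mem_primedLabels] at hz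
      rw [mem_unprimedLabels] at hz'
      omega
  refine ⟨S, Finset.filter_subset _ _, s - ((primedLabels S).val + (unprimedLabels γ S).val), ?_,
    add_tsub_cancel_of_le hle⟩
  intro z hz
  obtain ⟨i, q, rfl⟩ := exists_blockLabel z
  have hzs : blockLabel i q ∈ s := Multiset.mem_of_le (Multiset.sub_le_self _ _) hz
  rcases Nat.eq_zero_or_pos q with rfl | hq
  · exfalso
    rw [← Multiset.count_pos, Multiset.count_sub, Multiset.count_add] at hz
    have h1 := hs.count_le i
    have h2 : 0 < (primedLabels S).val.count (blockLabel i 0) := by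
      rw [Multiset.count_pos, Finset.mem_val, mem_primedLabels, hmem]
      exact ⟨rfl, hzs⟩
    omega
  · exact (hmem' i q hq).1 hzs

/-- For each set `S` of primed numbers, `|γ| - |S|` labels with unprimed entries occur, and the `M`
surplus boxes are distributed among these. -/
lemma ncard_hasBarWeight (γ : ℕ →₀ ℕ) (M : ℕ) (p : Finset ℕ → Prop) [DecidablePred p] :
    {s : Multiset BlockLabel | Multiset.card s = γ.degree + M ∧ HasBarWeight γ s ∧
      p (γ.support.filter fun i => blockLabel i 0 ∈ s)}.ncard =
      ∑ S ∈ γ.support.powerset with p S, Nat.multichoose (γ.degree - S.card) M := by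
  have hfilter : ∀ {S t}, S ⊆ γ.support → (∀ z ∈ t, z ∈ unprimedLabels γ S) →
      (γ.support.filter fun i => blockLabel i 0 ∈ barContent γ S t) = S := by
    intro S t hS ht
    simp only [mem_barContent_zero ht, Finset.filter_mem_eq_inter]
    exact Finset.inter_eq_right.2 hS
  have key : {s : Multiset BlockLabel | Multiset.card s = γ.degree + M ∧ HasBarWeight γ s ∧
      p (γ.support.filter fun i => blockLabel i 0 ∈ s)} =
      (((γ.support.powerset.filter p).sigma fun S => (unprimedLabels γ S).sym M).image
        fun x => barContent γ x.1 x.2.1 : Finset _) := by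
    ext s
    simp only [Set.mem_ofPred_eq, Finset.coe_image, Set.mem_image, Finset.mem_coe, Finset.mem_sigma,
      Finset.mem_filter, Finset.mem_powerset, Finset.mem_sym_iff]
    constructor
    · rintro ⟨hc, hw, hp⟩
      obtain ⟨S, hS, t, ht, rfl⟩ := exists_barContent hw
      rw [hfilter hS ht] at hp
      rw [card_barContent hS] at hc
      exact ⟨⟨S, ⟨t, by omega⟩⟩, ⟨⟨hS, hp⟩, ht⟩, rfl⟩
    · rintro ⟨⟨S, t⟩, ⟨⟨hS, hp⟩, ht⟩, rfl⟩
      have ht' : ∀ i ∈ t.1, i ∈ unprimedLabels γ S := ht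
      refine ⟨?_, hasBarWeight_barContent hS ht', ?_⟩
      · rw [card_barContent hS, t.2]
      · rwa [hfilter hS ht']
  rw [key, Set.ncard_coe_finset, Finset.card_image_of_injOn, Finset.card_sigma]
  · refine Finset.sum_congr rfl fun S hS => ?_
    rw [card_finset_sym, ← card_unprimedLabels
      (Finset.mem_powerset.1 (Finset.mem_filter.1 hS).1), Nat.add_sub_cancel]
  · rintro ⟨S, t⟩ hx ⟨S', t'⟩ hx' h
    simp only [Finset.coe_sigma, Set.mem_sigma_iff, Finset.mem_coe, Finset.mem_sym_iff] at hx hx'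
    have hS : S = S' := by
      ext i
      rw [← mem_barContent_zero (γ := γ) (t := t.1) hx.2,
        ← mem_barContent_zero (γ := γ) (t := t'.1) hx'.2]
      exact iff_of_eq (congrArg _ h)
    subst hS
    congr 1
    exact Subtype.ext (add_left_cancel h)

/-! ### Bar tableaux with a single row: tableaux and labelings -/

section Fibers

variable {X Y : Type} [DecidableEq Y] {D : Finset X}

/-- The elements of `D` with the label `z`. -/
def fiberOf (W : D → Y) (z : Y) : Finset X :=
  (Finset.univ.filter fun b => W b = z).map (Function.Embedding.subtype _)

lemma mem_fiberOf {W : D → Y} {z : Y} {x : X} : x ∈ fiberOf W z ↔ ∃ h : x ∈ D, W ⟨x, h⟩ = z := by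
  simp [fiberOf]

lemma mem_fiberOf_coe {W : D → Y} {z : Y} (b : D) : b.1 ∈ fiberOf W z ↔ W b = z := by
  rw [mem_fiberOf]
  exact ⟨fun ⟨_, h⟩ => h, fun h => ⟨b.2, h⟩⟩

lemma fiberOf_injOn (W : D → Y) : Set.InjOn (fiberOf W) (Finset.univ.image W : Finset Y) := by
  intro z hz z' _ h
  obtain ⟨b, -, rfl⟩ := Finset.mem_image.1 (Finset.mem_coe.1 hz)
  exact (mem_fiberOf_coe b).1 (h ▸ (mem_fiberOf_coe b).2 rfl)

variable [DecidableEq X]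

/-- The partition of `D` into the sets of elements with the same label. -/
def fiberPartition (W : D → Y) : Finpartition D :=
  Finpartition.ofExistsUnique (Finset.univ.image fun b => fiberOf W (W b))
    (by
      intro p hp
      obtain ⟨b, -, rfl⟩ := Finset.mem_image.1 hp
      intro x hx
      exact (mem_fiberOf.1 hx).1)
    (by
      intro a ha
      refine ⟨fiberOf W (W ⟨a, ha⟩), ⟨Finset.mem_image_of_mem _ (Finset.mem_univ _),
        mem_fiberOf.2 ⟨ha, rfl⟩⟩, ?_⟩
      rintro t ⟨ht, hat⟩
      obtain ⟨b, -, rfl⟩ := Finset.mem_image.1 ht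
      rw [(mem_fiberOf.1 hat).2])
    (by
      intro h
      obtain ⟨b, -, hb⟩ := Finset.mem_image.1 h
      exact Finset.notMem_empty b.1 (hb ▸ (mem_fiberOf_coe b).2 rfl))

lemma fiberPartition_parts (W : D → Y) :
    (fiberPartition W).parts = (Finset.univ.image W).image (fiberOf W) := by
  rw [Finset.image_image]
  rfl

lemma card_fiberPartition_parts (W : D → Y) :
    (fiberPartition W).parts.card = (Finset.univ.image W).card := by
  rw [fiberPartition_parts, Finset.card_image_of_injOn (fiberOf_injOn W)]

lemma mem_part_fiberPartition {W : D → Y} (b b' : D) :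
    b'.1 ∈ (fiberPartition W).part b.1 ↔ W b' = W b := by
  have h : (fiberPartition W).part b.1 = fiberOf W (W b) := by
    apply Finpartition.part_eq_of_mem
    · rw [fiberPartition_parts]
      exact Finset.mem_image_of_mem _ (Finset.mem_image_of_mem _ (Finset.mem_univ _))
    · exact (mem_fiberOf_coe b).2 rfl
  rw [h, mem_fiberOf_coe]

lemma eq_fiberPartition {W : D → Y} (P : Finpartition D)
    (h : ∀ b b' : D, b'.1 ∈ P.part b.1 ↔ W b' = W b) : fiberPartition W = P := by
  have h1 : ∀ b : D, fiberOf W (W b) = P.part b.1 := by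
    intro b
    ext x
    constructor
    · intro hx
      obtain ⟨hxD, hx⟩ := mem_fiberOf.1 hx
      exact (h b ⟨x, hxD⟩).2 hx
    · intro hx
      have hxD := P.part_subset b.1 hx
      exact mem_fiberOf.2 ⟨hxD, (h b ⟨x, hxD⟩).1 hx⟩
  apply Finpartition.ext
  ext B
  rw [fiberPartition_parts, Finset.image_image, Finset.mem_image]
  constructor
  · rintro ⟨b, -, rfl⟩
    rw [Function.comp_apply, h1, P.part_mem]
    exact b.2
  · intro hB
    obtain ⟨x, hx⟩ := P.nonempty_of_mem_parts hB
    refine ⟨⟨x, P.subset hB hx⟩, Finset.mem_univ _, ?_⟩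
    rw [Function.comp_apply, h1, P.part_eq_of_mem hB hx]

end Fibers

/-- The letter in the boxes of the block with a given label. -/
def labelLetter (z : BlockLabel) : Letter := toLex ((ofLex z).1, decide ((ofLex z).2 ≠ 0))

lemma labelLetter_zero (i : ℕ) : labelLetter (blockLabel i 0) = primed i := by
  simp [labelLetter, blockLabel, primed]

lemma labelLetter_of_pos {i q : ℕ} (hq : 0 < q) : labelLetter (blockLabel i q) = unprimed i := by
  simp [labelLetter, blockLabel, unprimed, hq.ne']

lemma index_labelLetter (i q : ℕ) : (labelLetter (blockLabel i q)).index = i := rfl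

lemma labelLetter_eq_primed {z : BlockLabel} {i : ℕ} :
    labelLetter z = primed i ↔ z = blockLabel i 0 := by
  obtain ⟨j, q, rfl⟩ := exists_blockLabel z
  rw [blockLabel_inj]
  rcases Nat.eq_zero_or_pos q with rfl | hq
  · rw [labelLetter_zero, primed_injective.eq_iff]
    simp
  · rw [labelLetter_of_pos hq]
    constructor
    · exact fun h => absurd h.symm (primed_ne_unprimed _ _)
    · exact fun h => absurd h.2 hq.ne'

lemma labelLetter_mono : Monotone labelLetter := by
  intro z z' h
  obtain ⟨i, q, rfl⟩ := exists_blockLabel z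
  obtain ⟨i', q', rfl⟩ := exists_blockLabel z'
  rcases (Prod.Lex.le_iff).1 h with h | ⟨h, h'⟩
  · exact (Prod.Lex.le_iff).2 (Or.inl h)
  · change i = i' at h
    change q ≤ q' at h'
    subst h
    rcases Nat.eq_zero_or_pos q with rfl | hq
    · rcases Nat.eq_zero_or_pos q' with rfl | hq'
      · exact le_rfl
      · rw [labelLetter_zero, labelLetter_of_pos hq']
        exact (Prod.Lex.le_iff).2 (Or.inr ⟨rfl, by simp [primed]⟩)
    · rw [labelLetter_of_pos hq, labelLetter_of_pos (by omega)]

/-- The number of blocks with a given index is the number of labels with that index. -/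
lemma barWeight_fiberPartition {D : Finset (ℕ × ℕ)} (W : D → BlockLabel) (i : ℕ) :
    barWeight (labelLetter ∘ W) (fiberPartition W) i =
      ((Finset.univ.image W).filter fun z => (labelLetter z).index = i).card := by
  have h : {B : Finset (ℕ × ℕ) | B ∈ (fiberPartition W).parts ∧
      ∃ b : D, b.1 ∈ B ∧ ((labelLetter ∘ W) b).index = i} =
      (((Finset.univ.image W).filter fun z => (labelLetter z).index = i).image (fiberOf W) :
        Finset _) := by
    ext B
    rw [Set.mem_ofPred_eq, fiberPartition_parts, Finset.mem_coe, Finset.mem_image, Finset.mem_image]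
    constructor
    · rintro ⟨⟨z, hz, rfl⟩, b, hb, rfl⟩
      refine ⟨z, Finset.mem_filter.2 ⟨hz, ?_⟩, rfl⟩
      rw [← (mem_fiberOf_coe b).1 hb]
      rfl
    · rintro ⟨z, hz, rfl⟩
      obtain ⟨hz, hzi⟩ := Finset.mem_filter.1 hz
      refine ⟨⟨z, hz, rfl⟩, ?_⟩
      obtain ⟨b, -, rfl⟩ := Finset.mem_image.1 hz
      exact ⟨b, (mem_fiberOf_coe b).2 rfl, hzi⟩
  rw [barWeight, h, Set.ncard_coe_finset, Finset.card_image_of_injOn]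
  exact (fiberOf_injOn W).mono (Finset.coe_subset.2 (Finset.filter_subset _ _))

section Row

variable {m n : ℕ}

/-- A bar within a row contains all boxes between any two of its boxes. -/
lemma IsBar.mem_of_le_of_le {B : Finset (ℕ × ℕ)} (hB : IsBar B) {x y z : rowDiagram m n}
    (hx : x.1 ∈ B) (hz : z.1 ∈ B) (hxy : x ≤ y) (hyz : y ≤ z) : y.1 ∈ B := by
  rw [rowDiagram_le_iff] at hxy hyz
  have h1 := rowDiagram_fst x
  have h2 := rowDiagram_fst y
  rcases hB with ⟨i, a, c, rfl⟩ | ⟨j, a, c, rfl⟩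
  · simp only [Finset.mem_product, Finset.mem_singleton, Finset.mem_Icc] at hx hz ⊢
    omega
  · simp only [Finset.mem_product, Finset.mem_singleton, Finset.mem_Icc] at hx hz ⊢
    omega

lemma isBar_fiberOf {Y : Type} [LinearOrder Y] {W : rowDiagram m n → Y} (hW : Monotone W)
    (b : rowDiagram m n) : IsBar (fiberOf W (W b)) := by
  set F := Finset.univ.filter fun b' => W b' = W b with hF
  have hb : b ∈ F := Finset.mem_filter.2 ⟨Finset.mem_univ _, rfl⟩
  obtain ⟨x, hx, hxmin⟩ := Finset.exists_min_image F (fun b => b.1.2) ⟨b, hb⟩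
  obtain ⟨z, hz, hzmax⟩ := Finset.exists_max_image F (fun b => b.1.2) ⟨b, hb⟩
  refine Or.inl ⟨0, x.1.2, z.1.2, ?_⟩
  ext y
  rw [Finset.mem_product, Finset.mem_singleton, Finset.mem_Icc]
  constructor
  · intro hy
    obtain ⟨hyD, hyW⟩ := mem_fiberOf.1 hy
    have hyF : (⟨y, hyD⟩ : rowDiagram m n) ∈ F := Finset.mem_filter.2 ⟨Finset.mem_univ _, hyW⟩
    exact ⟨rowDiagram_fst ⟨y, hyD⟩, hxmin _ hyF, hzmax _ hyF⟩
  · rintro ⟨h0, h1, h2⟩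
    have hyD : y ∈ rowDiagram m n := by
      rw [Finset.mem_product, Finset.mem_singleton, Finset.mem_Ico]
      exact ⟨h0, (rowDiagram_snd x).1.trans h1, h2.trans_lt (rowDiagram_snd z).2⟩
    refine mem_fiberOf.2 ⟨hyD, le_antisymm ?_ ?_⟩
    · rw [← (Finset.mem_filter.1 hz).2]
      exact hW (rowDiagram_le_iff.2 h2)
    · rw [← (Finset.mem_filter.1 hx).2]
      exact hW (rowDiagram_le_iff.2 h1)

lemma eq_of_count_map_le_one {ι Y : Type} [Fintype ι] [DecidableEq Y] {W : ι → Y} {z : Y}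
    (h : (Finset.univ.val.map W).count z ≤ 1) {b b' : ι} (hb : W b = z) (hb' : W b' = z) :
    b = b' := by
  rw [Multiset.count_map] at h
  have h' : (Finset.univ.filter fun b => z = W b).card ≤ 1 := h
  exact Finset.card_le_one.1 h' b
    (Finset.mem_filter.2 ⟨Finset.mem_univ _, hb.symm⟩) b'
    (Finset.mem_filter.2 ⟨Finset.mem_univ _, hb'.symm⟩)

lemma mem_map_univ {ι Y : Type} [Fintype ι] {W : ι → Y} {z : Y} :
    z ∈ Finset.univ.val.map W ↔ ∃ b, W b = z := by
  simp only [Multiset.mem_map, Finset.mem_val, Finset.mem_univ, true_and]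

/-- The bar tableau of a labeling of the boxes. -/
def barOfLabels (W : rowDiagram m n → BlockLabel) :
    (rowDiagram m n → Letter) × Finpartition (rowDiagram m n) :=
  (labelLetter ∘ W, fiberPartition W)

variable {γ : ℕ →₀ ℕ}

lemma card_filter_index {ι : Type} [Fintype ι] {W : ι → BlockLabel}
    (hw : HasBarWeight γ (Finset.univ.val.map W)) (i : ℕ) :
    ((Finset.univ.image W).filter fun z => (labelLetter z).index = i).card = γ i := by
  have hmem : ∀ z, z ∈ Finset.univ.image W ↔ z ∈ Finset.univ.val.map W := by
    intro z
    rw [mem_map_univ]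
    simp
  set e := if blockLabel i 0 ∈ Finset.univ.val.map W then 1 else 0 with he
  have h1 : ((Finset.univ.image W).filter fun z => (labelLetter z).index = i) =
      (Finset.Icc (1 - e) (γ i - e)).image (blockLabel i) := by
    ext z
    obtain ⟨j, q, rfl⟩ := exists_blockLabel z
    rw [Finset.mem_filter, hmem, index_labelLetter, Finset.mem_image]
    constructor
    · rintro ⟨hz, rfl⟩
      refine ⟨q, ?_, rfl⟩
      rw [Finset.mem_Icc]
      rcases Nat.eq_zero_or_pos q with rfl | hq
      · have : e = 1 := if_pos hz
        omega
      · rw [hw.mem_iff _ _ hq, ← he] at hz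
        omega
    · rintro ⟨q', hq', h⟩
      obtain ⟨rfl, rfl⟩ := blockLabel_inj.1 h
      refine ⟨?_, rfl⟩
      rw [Finset.mem_Icc] at hq'
      rcases Nat.eq_zero_or_pos q' with rfl | hq
      · by_contra h0
        have : e = 0 := if_neg h0
        omega
      · rw [hw.mem_iff _ _ hq, ← he]
        omega
  rw [h1, Finset.card_image_of_injective _ fun q q' h => (blockLabel_inj.1 h).2, Nat.card_Icc]
  by_cases h0 : blockLabel i 0 ∈ Finset.univ.val.map W
  · have : e = 1 := if_pos h0
    have := hw.pos i h0
    omega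
  · have : e = 0 := if_neg h0
    omega

lemma isBarTableau_barOfLabels {W : rowDiagram m n → BlockLabel} (hW : Monotone W)
    (hw : HasBarWeight γ (Finset.univ.val.map W)) :
    IsBarTableau (barOfLabels W).1 (barOfLabels W).2 where
  semistandard :=
    { toIsRPP := (isRPP_rowDiagram_iff _).2 (labelLetter_mono.comp hW)
      col_unprimed := fun b b' h _ _ _ => rowDiagram_ext h
      row_primed := fun b b' _ i h h' => eq_of_count_map_le_one (hw.count_le i)
        (labelLetter_eq_primed.1 h) (labelLetter_eq_primed.1 h') }
  bar B hB := by
    rw [barOfLabels, fiberPartition_parts, Finset.image_image] at hB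
    obtain ⟨b, -, rfl⟩ := Finset.mem_image.1 hB
    exact isBar_fiberOf hW b
  constant B hB b b' hb hb' := by
    rw [barOfLabels, fiberPartition_parts] at hB
    obtain ⟨z, -, rfl⟩ := Finset.mem_image.1 hB
    rw [mem_fiberOf_coe] at hb hb'
    simp only [barOfLabels, Function.comp_apply, hb, hb']

lemma barWeight_barOfLabels {W : rowDiagram m n → BlockLabel}
    (hw : HasBarWeight γ (Finset.univ.val.map W)) :
    barWeight (barOfLabels W).1 (barOfLabels W).2 = γ := by
  funext i
  rw [barOfLabels, barWeight_fiberPartition, card_filter_index hw]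

lemma card_parts_barOfLabels {W : rowDiagram m n → BlockLabel}
    (hw : HasBarWeight γ (Finset.univ.val.map W)) :
    (barOfLabels W).2.parts.card = γ.degree := by
  rw [barOfLabels, card_fiberPartition_parts,
    Finset.card_eq_sum_card_fiberwise (f := fun z => (labelLetter z).index) (t := γ.support)]
  · exact Finset.sum_congr rfl fun i _ => card_filter_index hw i
  · intro z hz
    have h1 := card_filter_index hw (labelLetter z).index
    have h2 : 0 < ((Finset.univ.image W).filter
        fun z' => (labelLetter z').index = (labelLetter z).index).card :=
      Finset.card_pos.2 ⟨z, Finset.mem_filter.2 ⟨hz, rfl⟩⟩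
    rw [Finset.mem_coe, Finsupp.mem_support_iff]
    exact (h1 ▸ h2 : 0 < γ _).ne'

/-- A weakly increasing labeling is determined by its bar tableau. -/
lemma eq_of_barOfLabels_eq {W W' : rowDiagram m n → BlockLabel} (hW : Monotone W)
    (hW' : Monotone W') (hw : HasBarWeight γ (Finset.univ.val.map W))
    (hw' : HasBarWeight γ (Finset.univ.val.map W')) (h : barOfLabels W = barOfLabels W') :
    W = W' := by
  have hfib : ∀ b b', W b' = W b ↔ W' b' = W' b := by
    intro b b'
    rw [← mem_part_fiberPartition, ← mem_part_fiberPartition]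
    exact iff_of_eq (by rw [show fiberPartition W = fiberPartition W' from congrArg Prod.snd h])
  have hlet : ∀ b, labelLetter (W b) = labelLetter (W' b) := fun b =>
    congrFun (congrArg Prod.fst h) b
  have h0 : ∀ i, blockLabel i 0 ∈ Finset.univ.val.map W ↔
      blockLabel i 0 ∈ Finset.univ.val.map W' := by
    intro i
    rw [mem_map_univ, mem_map_univ]
    exact exists_congr fun b => by rw [← labelLetter_eq_primed, hlet, labelLetter_eq_primed]
  have hrange : ∀ z, (∃ b, W b = z) ↔ ∃ b, W' b = z := by
    intro z
    rw [← mem_map_univ, ← mem_map_univ]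
    obtain ⟨i, q, rfl⟩ := exists_blockLabel z
    rcases Nat.eq_zero_or_pos q with rfl | hq
    · exact h0 i
    · rw [hw.mem_iff i q hq, hw'.mem_iff i q hq]
      simp only [h0]
  -- At the first box where the labelings differ, the smaller of the two labels must occur in the
  -- other labeling too, hence further to the left; but the partitions into blocks are the same.
  have step : ∀ {W W' : rowDiagram m n → BlockLabel}, Monotone W' →
      (∀ b b', W b' = W b ↔ W' b' = W' b) → (∀ z, (∃ b, W b = z) ↔ ∃ b, W' b = z) →
      ∀ b, (∀ b' < b, W b' = W' b') → ¬ W b < W' b := by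
    intro W W' hW' hfib hrange b ih hlt
    obtain ⟨b', hb'⟩ := (hrange (W b)).1 ⟨b, rfl⟩
    have hlt' : W' b' < W' b := hb' ▸ hlt
    have hle : ¬ b ≤ b' := fun hle => absurd (hW' hle) (not_le.2 hlt')
    have hbb : b' < b := by
      rw [rowDiagram_le_iff, not_le] at hle
      exact lt_of_le_not_ge (rowDiagram_le_iff.2 hle.le)
        fun h => absurd (rowDiagram_le_iff.1 h) (not_le.2 hle)
    have h1 : W b' = W b := (ih b' hbb).trans hb'
    exact hlt'.ne ((hfib b b').1 h1)
  have main : ∀ b, W b = W' b := by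
    intro b
    induction b using WellFoundedLT.induction with
    | ind b ih =>
      rcases lt_trichotomy (W b) (W' b) with hlt | heq | hlt
      · exact absurd hlt (step hW' hfib hrange b ih)
      · exact heq
      · exact absurd hlt (step hW (fun b b' => (hfib b b').symm) (fun z => (hrange z).symm) b
          fun b' hb' => (ih b' hb').symm)
  exact funext main

end Row

lemma card_image_le_card_image {ι X Y : Type} [DecidableEq X] [DecidableEq Y] (s : Finset ι)
    (f : ι → X) (g : ι → Y) (h : ∀ a ∈ s, ∀ b ∈ s, f a = f b → g a = g b) :
    (s.image g).card ≤ (s.image f).card := by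
  classical
  rcases isEmpty_or_nonempty ι with hι | hι
  · simp [Finset.eq_empty_of_isEmpty s]
  have hex : ∀ v ∈ s.image f, ∃ a ∈ s, f a = v := fun v hv => Finset.mem_image.1 hv
  choose! r hr hr' using hex
  refine (Finset.card_le_card ?_).trans (Finset.card_image_le (s := s.image f) (f := g ∘ r))
  intro y hy
  obtain ⟨a, ha, rfl⟩ := Finset.mem_image.1 hy
  have hfa := Finset.mem_image_of_mem f ha
  exact Finset.mem_image.2 ⟨f a, hfa, h _ (hr _ hfa) _ ha (hr' _ hfa)⟩

section Row

variable {m n : ℕ}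

open Classical in
/-- The number of blocks which begin weakly to the left of the box `b` and contain the same letter
as `b`. -/
noncomputable def blockNumber (V : rowDiagram m n → Letter) (P : Finpartition (rowDiagram m n))
    (b : rowDiagram m n) : ℕ :=
  ((Finset.univ.filter fun b' => b' ≤ b ∧ V b' = V b).image fun b' => P.part b'.1).card

open Classical in
/-- The labels of the boxes of a bar tableau. -/
noncomputable def labelsOfBar (V : rowDiagram m n → Letter) (P : Finpartition (rowDiagram m n))
    (b : rowDiagram m n) : BlockLabel :=
  blockLabel (V b).index (if (V b).IsPrimed then 0 else blockNumber V P b)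

variable {V : rowDiagram m n → Letter} {P : Finpartition (rowDiagram m n)}

lemma rowDiagram_le_total (b b' : rowDiagram m n) : b ≤ b' ∨ b' ≤ b := by
  rw [rowDiagram_le_iff, rowDiagram_le_iff]
  exact le_total _ _

lemma blockNumber_pos (b : rowDiagram m n) : 0 < blockNumber V P b := by
  classical
  exact Finset.card_pos.2 ⟨P.part b.1, Finset.mem_image.2
    ⟨b, Finset.mem_filter.2 ⟨Finset.mem_univ _, le_rfl, rfl⟩, rfl⟩⟩

lemma blockNumber_mono {b b' : rowDiagram m n} (h : b ≤ b') (hV : V b = V b') :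
    blockNumber V P b ≤ blockNumber V P b' := by
  classical
  refine Finset.card_le_card (Finset.image_subset_image fun c hc => ?_)
  rw [Finset.mem_filter] at hc ⊢
  exact ⟨hc.1, hc.2.1.trans h, hc.2.2.trans hV⟩

lemma labelLetter_labelsOfBar (b : rowDiagram m n) : labelLetter (labelsOfBar V P b) = V b := by
  rw [labelsOfBar]
  split_ifs with h
  · rw [labelLetter_zero]
    exact ofLex.injective (Prod.ext rfl h.symm)
  · rw [labelLetter_of_pos (blockNumber_pos b)]
    rcases eq_primed_or_unprimed (V b) with h1 | h1
    · exact absurd (by rw [h1]; rfl) h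
    · exact h1.symm

lemma IsBarTableau.mem_part (hT : IsBarTableau V P) {b c d : rowDiagram m n}
    (h : d.1 ∈ P.part b.1) (hbc : b ≤ c) (hcd : c ≤ d) : c.1 ∈ P.part b.1 :=
  (hT.bar _ (P.part_mem.2 b.2)).mem_of_le_of_le (P.mem_part_self.2 b.2) h hbc hcd

lemma IsBarTableau.eq_of_mem_part (hT : IsBarTableau V P) {b c : rowDiagram m n}
    (h : c.1 ∈ P.part b.1) : V c = V b :=
  hT.constant _ (P.part_mem.2 b.2) c b h (P.mem_part_self.2 b.2)

lemma mem_part_comm {b c : rowDiagram m n} :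
    c.1 ∈ P.part b.1 ↔ b.1 ∈ P.part c.1 := by
  rw [P.mem_part_iff_part_eq_part c.2 b.2, P.mem_part_iff_part_eq_part b.2 c.2, eq_comm]

lemma monotone_labelsOfBar (hT : IsBarTableau V P) : Monotone (labelsOfBar V P) := by
  classical
  intro b b' h
  have hV : V b ≤ V b' := (isRPP_rowDiagram_iff V).1 hT.semistandard.toIsRPP h
  rw [labelsOfBar, labelsOfBar]
  rcases (Prod.Lex.le_iff).1 hV with h1 | ⟨h1, h2⟩
  · exact (Prod.Lex.le_iff).2 (Or.inl h1)
  · refine (Prod.Lex.le_iff).2 (Or.inr ⟨h1, ?_⟩)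
    change (if (V b).IsPrimed then 0 else blockNumber V P b) ≤
      (if (V b').IsPrimed then 0 else blockNumber V P b')
    split_ifs with h3 h4 h4
    · exact le_rfl
    · exact Nat.zero_le _
    · exfalso
      apply h3
      have h5 : (ofLex (V b')).2 = false := h4
      rw [h5] at h2
      exact le_bot_iff.1 h2
    · refine blockNumber_mono h (ofLex.injective (Prod.ext h1 ?_))
      rw [Bool.eq_true_of_not_eq_false h3, Bool.eq_true_of_not_eq_false h4]

/-- Two boxes lie in the same block if and only if they have the same label. -/
lemma mem_part_iff_labelsOfBar_eq_of_le (hT : IsBarTableau V P) {b b' : rowDiagram m n}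
    (h : b ≤ b') : b'.1 ∈ P.part b.1 ↔ labelsOfBar V P b' = labelsOfBar V P b := by
  classical
  constructor
  · intro hm
    have hV := hT.eq_of_mem_part hm
    rw [labelsOfBar, labelsOfBar, hV]
    congr 1
    refine if_congr Iff.rfl rfl ?_
    refine le_antisymm (Finset.card_le_card fun B hB => ?_) (blockNumber_mono h hV.symm)
    obtain ⟨c, hc, rfl⟩ := Finset.mem_image.1 hB
    obtain ⟨-, hc, hcV⟩ := Finset.mem_filter.1 hc
    rcases rowDiagram_le_total c b with hcb | hbc
    · exact Finset.mem_image.2 ⟨c, Finset.mem_filter.2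
        ⟨Finset.mem_univ _, hcb, hcV.trans hV⟩, rfl⟩
    · refine Finset.mem_image.2 ⟨b, Finset.mem_filter.2 ⟨Finset.mem_univ _, le_rfl, rfl⟩, ?_⟩
      exact (((P.mem_part_iff_part_eq_part c.2 b.2).1 (hT.mem_part hm hbc hc))).symm
  · intro hl
    have hV : V b' = V b := by
      rw [← labelLetter_labelsOfBar (V := V) (P := P) b', hl, labelLetter_labelsOfBar]
    by_cases hp : (V b).IsPrimed
    · have h1 : V b = primed (V b).index := ofLex.injective (Prod.ext rfl hp)
      have : b' = b := hT.semistandard.row_primed b' b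
        ((rowDiagram_fst b').trans (rowDiagram_fst b).symm) (V b).index (hV.trans h1) h1
      rw [this]
      exact P.mem_part_self.2 b.2
    · have hN : blockNumber V P b' = blockNumber V P b := by
        have := (blockLabel_inj.1 hl).2
        rwa [hV, if_neg hp, if_neg hp] at this
      have hsub : ((Finset.univ.filter fun c => c ≤ b ∧ V c = V b).image fun c => P.part c.1) ⊆
          ((Finset.univ.filter fun c => c ≤ b' ∧ V c = V b').image fun c => P.part c.1) := by
        refine Finset.image_subset_image fun c hc => ?_
        rw [Finset.mem_filter] at hc ⊢
        exact ⟨hc.1, hc.2.1.trans h, hc.2.2.trans hV.symm⟩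
      -- The block of `b'` is counted by the block number of `b`, so it begins weakly to the left
      -- of `b`; being contiguous, it contains `b`.
      have heq := Finset.eq_of_subset_of_card_le hsub hN.le
      have hmem : P.part b'.1 ∈
          ((Finset.univ.filter fun c => c ≤ b ∧ V c = V b).image fun c => P.part c.1) := by
        rw [heq]
        exact Finset.mem_image.2 ⟨b', Finset.mem_filter.2 ⟨Finset.mem_univ _, le_rfl, rfl⟩, rfl⟩
      obtain ⟨c, hc, hcP⟩ := Finset.mem_image.1 hmem
      obtain ⟨-, hcb, -⟩ := Finset.mem_filter.1 hc
      have h1 : b'.1 ∈ P.part c.1 := by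
        rw [hcP]
        exact P.mem_part_self.2 b'.2
      have h2 : b.1 ∈ P.part c.1 := hT.mem_part h1 hcb h
      rw [P.mem_part_iff_part_eq_part b'.2 b.2, (P.mem_part_iff_part_eq_part b.2 c.2).1 h2]
      exact (P.mem_part_iff_part_eq_part b'.2 c.2).1 h1

lemma barOfLabels_labelsOfBar (hT : IsBarTableau V P) :
    barOfLabels (labelsOfBar V P) = (V, P) := by
  refine Prod.ext (funext fun b => labelLetter_labelsOfBar b) (eq_fiberPartition P fun b b' => ?_)
  rcases rowDiagram_le_total b b' with h | h
  · exact mem_part_iff_labelsOfBar_eq_of_le hT h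
  · rw [mem_part_comm, mem_part_iff_labelsOfBar_eq_of_le hT h, eq_comm]

/-- The blocks with the entry `i` are numbered without gaps, so the labels that occur are determined
by the weight and by the set of primed numbers. -/
lemma hasBarWeight_labelsOfBar {γ : ℕ →₀ ℕ} (hT : IsBarTableau V P) (hw : barWeight V P = γ) :
    HasBarWeight γ (Finset.univ.val.map (labelsOfBar V P)) := by
  classical
  set W := labelsOfBar V P with hW
  have hcard : ∀ i,
      ((Finset.univ.image W).filter fun z => (labelLetter z).index = i).card = γ i := by
    intro i
    have h1 : labelLetter ∘ W = V := congrArg Prod.fst (barOfLabels_labelsOfBar hT)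
    have h2 : fiberPartition W = P := congrArg Prod.snd (barOfLabels_labelsOfBar hT)
    rw [← barWeight_fiberPartition, ← hw, h1, h2]
  have hmem : ∀ z, z ∈ Finset.univ.image W ↔ z ∈ Finset.univ.val.map W := by
    intro z
    rw [mem_map_univ]
    simp
  -- The labels `(i, q)` with `q ≥ 1` that occur; their number is `γ i`, less one if `i'` occurs.
  have hQ : ∀ i, ∃ Q : Finset ℕ, (∀ q, q ∈ Q ↔ 0 < q ∧ blockLabel i q ∈ Finset.univ.val.map W) ∧
      Q.card + (if blockLabel i 0 ∈ Finset.univ.val.map W then 1 else 0) = γ i := by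
    intro i
    set R := ((Finset.univ.image W).filter fun z => (labelLetter z).index = i).image
      fun z => (ofLex z).2 with hR
    have hRmem : ∀ q, q ∈ R ↔ blockLabel i q ∈ Finset.univ.val.map W := by
      intro q
      rw [hR, Finset.mem_image]
      constructor
      · rintro ⟨z, hz, rfl⟩
        obtain ⟨hz', rfl⟩ := Finset.mem_filter.1 hz
        exact (hmem z).1 hz'
      · intro h
        exact ⟨blockLabel i q, Finset.mem_filter.2 ⟨(hmem _).2 h, rfl⟩, rfl⟩
    have hRcard : R.card = γ i := by
      rw [← hcard i, hR, Finset.card_image_of_injOn]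
      intro z hz z' hz' h
      have h1 := (Finset.mem_filter.1 (Finset.mem_coe.1 hz)).2
      have h2 := (Finset.mem_filter.1 (Finset.mem_coe.1 hz')).2
      exact ofLex.injective (Prod.ext (h1.trans h2.symm) h)
    refine ⟨R.erase 0, fun q => ?_, ?_⟩
    · rw [Finset.mem_erase, hRmem, Nat.pos_iff_ne_zero]
    · rw [← hRcard]
      split_ifs with h0
      · exact Finset.card_erase_add_one ((hRmem 0).2 h0)
      · rw [Finset.erase_eq_of_notMem fun h => h0 ((hRmem 0).1 h), add_zero]
  refine ⟨fun i => ?_, fun i hi => ?_, fun i q hq => ?_⟩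
  · rw [Multiset.count_map]
    have : (Finset.univ.filter fun b => blockLabel i 0 = W b).card ≤ 1 := by
      refine Finset.card_le_one.2 fun b hb b' hb' => ?_
      have h1 : ∀ b, b ∈ Finset.univ.filter (fun b => blockLabel i 0 = W b) → V b = primed i := by
        intro b hb
        rw [← labelLetter_labelsOfBar (V := V) (P := P) b, ← hW, ← (Finset.mem_filter.1 hb).2,
          labelLetter_zero]
      exact hT.semistandard.row_primed b b' ((rowDiagram_fst b).trans (rowDiagram_fst b').symm) i
        (h1 b hb) (h1 b' hb')
    exact this
  · obtain ⟨Q, -, hQ⟩ := hQ i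
    rw [if_pos hi] at hQ
    omega
  · obtain ⟨Q, hQmem, hQcard⟩ := hQ i
    -- The number of a block counts blocks with the same entry, which have distinct labels; so it
    -- is at most the number of these labels.
    have hsub : Q ⊆ Finset.Icc 1 Q.card := by
      intro q hq
      obtain ⟨hq0, hq⟩ := (hQmem q).1 hq
      rw [Finset.mem_Icc]
      refine ⟨hq0, ?_⟩
      obtain ⟨b, hb⟩ := mem_map_univ.1 hq
      have hVb : V b = unprimed i := by
        rw [← labelLetter_labelsOfBar (V := V) (P := P) b, ← hW, hb, labelLetter_of_pos hq0]
      have hqb : q = blockNumber V P b := by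
        rw [hW, labelsOfBar, hVb] at hb
        have := (blockLabel_inj.1 hb).2
        rw [if_neg (by simp [Letter.IsPrimed, unprimed])] at this
        exact this.symm
      rw [hqb]
      refine (card_image_le_card_image _ W _ fun c _ c' _ h => ?_).trans ?_
      · have h1 := congrArg Prod.snd (barOfLabels_labelsOfBar hT)
        have h2 : c'.1 ∈ P.part c.1 := by
          rw [← show fiberPartition W = P from h1]
          exact (mem_part_fiberPartition c c').2 h.symm
        exact ((P.mem_part_iff_part_eq_part c'.2 c.2).1 h2).symm
      · refine (Finset.card_le_card (t := Q.image (blockLabel i)) ?_).trans Finset.card_image_le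
        intro z hz
        obtain ⟨c, hc, rfl⟩ := Finset.mem_image.1 hz
        obtain ⟨-, -, hcV⟩ := Finset.mem_filter.1 hc
        have hWc : W c = blockLabel i (blockNumber V P c) := by
          rw [hW, labelsOfBar, hcV, hVb, if_neg (by simp [Letter.IsPrimed, unprimed])]
          rfl
        rw [hWc]
        refine Finset.mem_image_of_mem _ ((hQmem _).2 ⟨blockNumber_pos c, ?_⟩)
        exact mem_map_univ.2 ⟨c, hWc⟩
    have hQ2 : Q = Finset.Icc 1 Q.card :=
      Finset.eq_of_subset_of_card_le hsub (by rw [Nat.card_Icc, Nat.add_sub_cancel])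
    have h1 := hQmem q
    rw [hQ2, Finset.mem_Icc] at h1
    have h2 : blockLabel i q ∈ Finset.univ.val.map W ↔ q ≤ Q.card := by
      constructor
      · exact fun h => (h1.2 ⟨hq, h⟩).2
      · exact fun h => (h1.1 ⟨hq, h⟩).2
    rw [h2]
    omega

/-! ### Bar tableaux with a single row: generating functions -/

/-- The coefficients of the generating function of those bar tableaux of a row whose set of primed
numbers satisfies the condition `p`. -/
lemma coeff_bar_rowDiagram (γ : ℕ →₀ ℕ)
    (A : (rowDiagram m n → Letter) × Finpartition (rowDiagram m n) → Prop)
    (p : Finset ℕ → Prop) [DecidablePred p]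
    (hA : ∀ W : rowDiagram m n → BlockLabel, Monotone W → HasBarWeight γ (Finset.univ.val.map W) →
      (A (barOfLabels W) ↔ p (γ.support.filter fun i => blockLabel i 0 ∈ Finset.univ.val.map W))) :
    MvPowerSeries.coeff γ
      (genFun (fun T : {T : (rowDiagram m n → Letter) × Finpartition (rowDiagram m n) //
        IsBarTableau T.1 T.2 ∧ A T} => barWeight T.1.1 T.1.2)
      fun T => (-β) ^ ((rowDiagram m n).card - T.1.2.parts.card)) =
    if γ.degree ≤ n - m then (-β) ^ (n - m - γ.degree) *
      ((∑ S ∈ γ.support.powerset with p S,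
        Nat.multichoose (γ.degree - S.card) (n - m - γ.degree) : ℕ) : Polynomial ℤ) else 0 := by
  rw [coeff_genFun_of_const _ _ γ ((-β) ^ (n - m - γ.degree))]
  · rw [card_subtype_fiber (fun T => IsBarTableau T.1 T.2 ∧ A T) fun T => barWeight T.1 T.2]
    have h1 : {T : (rowDiagram m n → Letter) × Finpartition (rowDiagram m n) |
        (IsBarTableau T.1 T.2 ∧ A T) ∧ barWeight T.1 T.2 = γ} =
        barOfLabels '' {W | Monotone W ∧ (fun s : Multiset BlockLabel => HasBarWeight γ s ∧
          p (γ.support.filter fun i => blockLabel i 0 ∈ s)) (Finset.univ.val.map W)} := by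
      ext ⟨V, P⟩
      constructor
      · rintro ⟨⟨hT, hAT⟩, hw⟩
        have hw' := hasBarWeight_labelsOfBar hT hw
        refine ⟨labelsOfBar V P, ⟨monotone_labelsOfBar hT, hw', ?_⟩, barOfLabels_labelsOfBar hT⟩
        rw [← hA _ (monotone_labelsOfBar hT) hw', barOfLabels_labelsOfBar hT]
        exact hAT
      · rintro ⟨W, ⟨hW, hw, hp⟩, h⟩
        rw [← h]
        exact ⟨⟨isBarTableau_barOfLabels hW hw, (hA W hW hw).2 hp⟩, barWeight_barOfLabels hw⟩
    rw [h1, Set.InjOn.ncard_image, ncard_monotone (rowIso m n) fun s => HasBarWeight γ s ∧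
      p (γ.support.filter fun i => blockLabel i 0 ∈ s)]
    · split_ifs with hk
      · have h2 := ncard_hasBarWeight γ (n - m - γ.degree) p
        rw [Nat.add_sub_cancel' hk] at h2
        rw [h2, mul_comm]
      · have h2 : {s : Multiset BlockLabel | Multiset.card s = n - m ∧ HasBarWeight γ s ∧
            p (γ.support.filter fun i => blockLabel i 0 ∈ s)} = ∅ := by
          rw [Set.eq_empty_iff_forall_notMem]
          rintro s ⟨hs, hw, -⟩
          obtain ⟨S, hS, t, -, rfl⟩ := exists_barContent hw
          rw [card_barContent hS] at hs
          omega
        rw [h2]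
        simp
    · rintro W ⟨hW, hw, -⟩ W' ⟨hW', hw', -⟩ h
      exact eq_of_barOfLabels_eq hW hW' hw hw' h
  · rintro ⟨⟨V, P⟩, hT, hAT⟩ hw
    have h1 := card_parts_barOfLabels (hasBarWeight_labelsOfBar hT hw)
    rw [barOfLabels_labelsOfBar hT] at h1
    rw [card_rowDiagram, h1]

end Row

/-- The number `[u^M] (1 + v)^r v^{k-r}` for `v = 1 / (1 - u)`. -/
def barCoeff (r k M : ℕ) : ℕ := ∑ j ∈ Finset.range (r + 1), r.choose j * (k - j).multichoose M

/-- The number `[u^M] (1 + v)^{r-1} v^{k-r+1}` for `v = 1 / (1 - u)`. -/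
def barCoeff' (r k M : ℕ) : ℕ := ∑ j ∈ Finset.range r, (r - 1).choose j * (k - j).multichoose M

lemma coeff_bar_rowDiagram_true {m n : ℕ} (γ : ℕ →₀ ℕ)
    (A : (rowDiagram m n → Letter) × Finpartition (rowDiagram m n) → Prop)
    (hA : ∀ T, A T ↔ IsBarTableau T.1 T.2) :
    MvPowerSeries.coeff γ (genFun (fun T : {T // A T} => barWeight T.1.1 T.1.2)
      fun T => (-β) ^ ((rowDiagram m n).card - T.1.2.parts.card)) =
    if γ.degree ≤ n - m then (-β) ^ (n - m - γ.degree) *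
      (barCoeff γ.support.card γ.degree (n - m - γ.degree) : Polynomial ℤ) else 0 := by
  obtain rfl : A = fun T => IsBarTableau T.1 T.2 ∧ True :=
    funext fun T => propext (by rw [hA, and_true])
  rw [coeff_bar_rowDiagram γ _ fun _ => True]
  · simp only [Finset.filter_true]
    rw [Finset.sum_powerset_apply_card
      fun j => Nat.multichoose (γ.degree - j) (n - m - γ.degree)]
    rfl
  · exact fun W _ _ => Iff.rfl

/-- The entry of the only diagonal box is unprimed if and only if the least number in use does not
occur primed. -/
lemma coeff_barP_rowDiagram_zero {n : ℕ} (hn : 0 < n) (γ : ℕ →₀ ℕ) :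
    MvPowerSeries.coeff γ
      (genFun (fun T : {T : (rowDiagram 0 n → Letter) × Finpartition (rowDiagram 0 n) //
        IsBarTableau T.1 T.2 ∧ ∀ b : rowDiagram 0 n, b.1.1 = b.1.2 → ¬ (T.1 b).IsPrimed} =>
          barWeight T.1.1 T.1.2)
      fun T => (-β) ^ ((rowDiagram 0 n).card - T.1.2.parts.card)) =
    if γ.degree ≤ n then (-β) ^ (n - γ.degree) *
      (barCoeff' γ.support.card γ.degree (n - γ.degree) : Polynomial ℤ) else 0 := by
  classical
  set b₀ : rowDiagram 0 n := ⟨(0, 0), by simp [hn]⟩ with hb₀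
  have hdiag : ∀ V : rowDiagram 0 n → Letter,
      (∀ b : rowDiagram 0 n, b.1.1 = b.1.2 → ¬ (V b).IsPrimed) ↔ ¬ (V b₀).IsPrimed := by
    intro T
    constructor
    · exact fun h => h b₀ rfl
    · intro h b hb
      rwa [show b = b₀ from rowDiagram_ext (by rw [← hb, rowDiagram_fst])]
  rw [coeff_bar_rowDiagram γ _ fun S => ∃ h : γ.support.Nonempty, γ.support.min' h ∉ S]
  · rw [Nat.sub_zero]
    congr 3
    rcases Finset.eq_empty_or_nonempty γ.support with h0 | h0
    · simp [h0, barCoeff']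
    · simp only [exists_prop_of_true h0]
      rw [sum_powerset_filter_notMem (γ.support.min'_mem h0)
        fun j => Nat.multichoose (γ.degree - j) (n - γ.degree)]
      rfl
  · intro W hW hw
    rw [hdiag]
    have hsupp : ∀ i, i ∈ γ.support ↔ ∃ b, (labelLetter (W b)).index = i := by
      intro i
      rw [Finsupp.mem_support_iff, ← card_filter_index hw i, ← Nat.pos_iff_ne_zero,
        Finset.card_pos]
      constructor
      · rintro ⟨z, hz⟩
        obtain ⟨hz, hzi⟩ := Finset.mem_filter.1 hz
        obtain ⟨b, -, rfl⟩ := Finset.mem_image.1 hz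
        exact ⟨b, hzi⟩
      · rintro ⟨b, hb⟩
        exact ⟨W b, Finset.mem_filter.2 ⟨Finset.mem_image_of_mem _ (Finset.mem_univ _), hb⟩⟩
    have h0 : γ.support.Nonempty := ⟨_, (hsupp _).2 ⟨b₀, rfl⟩⟩
    have hi := index_first_box (letter_index_mono.comp (labelLetter_mono.comp hW)) hsupp h0
      (b₀ := b₀) rfl
    rw [exists_prop_of_true h0, Finset.mem_filter, and_iff_right (γ.support.min'_mem h0), ← hi]
    refine not_congr ?_
    change (labelLetter (W b₀)).IsPrimed ↔
      blockLabel (labelLetter (W b₀)).index 0 ∈ Finset.univ.val.map W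
    constructor
    · intro h
      refine mem_map_univ.2 ⟨b₀, labelLetter_eq_primed.1 (ofLex.injective (Prod.ext rfl h))⟩
    · intro h
      obtain ⟨b, hb⟩ := mem_map_univ.1 h
      have hle : W b₀ ≤ W b := hW (rowDiagram_le_iff.2 (Nat.zero_le _))
      obtain ⟨i, q, hiq⟩ := exists_blockLabel (W b₀)
      rw [hb, hiq, index_labelLetter] at hle
      rcases (Prod.Lex.le_iff).1 hle with h1 | h1
      · exact absurd h1 (lt_irrefl _)
      · have hq : q = 0 := Nat.le_zero.1 h1.2
        rw [hiq, hq, labelLetter_zero]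
        rfl

/-! ### Schur functions: uniqueness of expansions and the involution `ω` -/

section Schur

open YoungDiagram

/-- The number of entries `i` of a semistandard tableau. -/
def content {D : YoungDiagram} (T : SemistandardYoungTableau D) (i : ℕ) : ℕ :=
  (D.cells.filter fun b => T b.1 b.2 = i).card

lemma coeff_schur (D : YoungDiagram) (α : ℕ →₀ ℕ) : MvPowerSeries.coeff α (schur D) =
    (Nat.card {T : SemistandardYoungTableau D // content T = α} : Polynomial ℤ) := by
  rw [schur, coeff_genFun_of_const _ _ α 1 fun _ _ => rfl, mul_one]
  rfl

lemma mem_support_of_content {D : YoungDiagram} {T : SemistandardYoungTableau D} {α : ℕ →₀ ℕ}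
    (h : content T = α) {b : ℕ × ℕ} (hb : b ∈ D.cells) : T b.1 b.2 ∈ α.support := by
  rw [Finsupp.mem_support_iff, ← h, content]
  have hb' : b ∈ D.cells.filter fun b' => T b'.1 b'.2 = T b.1 b.2 :=
    Finset.mem_filter.2 ⟨hb, rfl⟩
  exact (Finset.card_pos.2 ⟨b, hb'⟩).ne'

lemma finite_content (D : YoungDiagram) (α : ℕ →₀ ℕ) :
    Finite {T : SemistandardYoungTableau D // content T = α} := by
  refine Finite.of_injective (β := D.cells → α.support)
    (fun T b => ⟨T.1 b.1.1 b.1.2, mem_support_of_content T.2 b.2⟩) ?_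
  intro T T' h
  refine Subtype.ext (SemistandardYoungTableau.ext fun i j => ?_)
  by_cases hij : (i, j) ∈ D
  · exact congrArg Subtype.val (congrFun h ⟨(i, j), hij⟩)
  · rw [T.1.zeros hij, T'.1.zeros hij]

lemma card_eq_degree_of_content {D : YoungDiagram} {T : SemistandardYoungTableau D} {α : ℕ →₀ ℕ}
    (h : content T = α) : D.card = α.degree := by
  rw [YoungDiagram.card, Finset.card_eq_sum_card_fiberwise (f := fun b => T b.1 b.2)
    (t := α.support) fun b hb => mem_support_of_content h hb]
  exact Finset.sum_congr rfl fun i _ => congrFun h i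

lemma exists_of_coeff_schur_ne_zero {D : YoungDiagram} {α : ℕ →₀ ℕ}
    (h : MvPowerSeries.coeff α (schur D) ≠ 0) :
    ∃ T : SemistandardYoungTableau D, content T = α := by
  rw [coeff_schur, Nat.cast_ne_zero] at h
  obtain ⟨⟨T, hT⟩⟩ := (Nat.card_ne_zero.1 h).1
  exact ⟨T, hT⟩

lemma coeff_schur_eq_zero {D : YoungDiagram} {α : ℕ →₀ ℕ} (h : D.card ≠ α.degree) :
    MvPowerSeries.coeff α (schur D) = 0 := by
  by_contra h'
  obtain ⟨T, hT⟩ := exists_of_coeff_schur_ne_zero h'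
  exact h (card_eq_degree_of_content hT)

lemma lt_card_of_mem {D : YoungDiagram} {i j : ℕ} (h : (i, j) ∈ D) : i < D.card ∧ j < D.card := by
  constructor
  · rw [← Nat.succ_le_iff, ← Finset.card_range i.succ]
    refine Finset.card_le_card_of_injOn (fun i' => (i', j)) (fun i' hi' => ?_)
      fun a _ b _ hab => (Prod.ext_iff.1 hab).1
    exact D.up_left_mem (Nat.lt_succ_iff.1 (Finset.mem_range.1 hi')) le_rfl h
  · rw [← Nat.succ_le_iff, ← Finset.card_range j.succ]
    refine Finset.card_le_card_of_injOn (fun j' => (i, j')) (fun j' hj' => ?_)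
      fun a _ b _ hab => (Prod.ext_iff.1 hab).2
    exact D.up_left_mem le_rfl (Nat.lt_succ_iff.1 (Finset.mem_range.1 hj')) h

lemma finite_card_eq (N : ℕ) : {D : YoungDiagram | D.card = N}.Finite := by
  refine Set.Finite.of_injOn (f := YoungDiagram.cells)
    (t := ((Finset.range N ×ˢ Finset.range N).powerset : Set (Finset (ℕ × ℕ)))) ?_ ?_
    (Finset.finite_toSet _)
  · rintro D rfl
    rw [Finset.mem_coe, Finset.mem_powerset]
    intro b hb
    rw [Finset.mem_product, Finset.mem_range, Finset.mem_range]
    exact lt_card_of_mem hb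
  · intro D _ D' _ h
    exact YoungDiagram.ext h

/-- The number of cells in the first `k` rows. -/
def rowSum (D : YoungDiagram) (k : ℕ) : ℕ := ∑ i ∈ Finset.range k, D.rowLen i

lemma rowSum_eq_card (D : YoungDiagram) (k : ℕ) :
    rowSum D k = (D.cells.filter fun b => b.1 < k).card := by
  rw [rowSum, Finset.card_eq_sum_card_fiberwise (f := Prod.fst) (t := Finset.range k)]
  · refine Finset.sum_congr rfl fun i hi => ?_
    rw [rowLen_eq_card, YoungDiagram.row]
    congr 1
    ext b
    rw [Finset.mem_range] at hi
    simp only [Finset.mem_filter]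
    constructor
    · rintro ⟨h, rfl⟩
      exact ⟨⟨h, hi⟩, rfl⟩
    · rintro ⟨⟨h, -⟩, rfl⟩
      exact ⟨h, rfl⟩
  · intro b hb
    exact Finset.mem_coe.2 (Finset.mem_range.2 (Finset.mem_filter.1 (Finset.mem_coe.1 hb)).2)

lemma rowSum_injective : Function.Injective rowSum := by
  intro D D' h
  have h1 : ∀ i, D.rowLen i = D'.rowLen i := by
    intro i
    have h2 := congrFun h (i + 1)
    have h3 := congrFun h i
    simp only [rowSum, Finset.sum_range_succ] at h2 h3
    omega
  ext ⟨i, j⟩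
  rw [YoungDiagram.mem_cells, YoungDiagram.mem_cells, mem_iff_lt_rowLen, mem_iff_lt_rowLen, h1]

lemma le_entry {D : YoungDiagram} (T : SemistandardYoungTableau D) {i j : ℕ} (h : (i, j) ∈ D) :
    i ≤ T i j := by
  induction i with
  | zero => exact Nat.zero_le _
  | succ i ih =>
    have h1 := ih (D.up_left_mem (Nat.le_succ i) le_rfl h)
    have h2 := T.col_strict (Nat.lt_add_one i) h
    omega

/-- The content of a semistandard tableau is dominated by its shape. -/
lemma rowSum_le_of_content {D D' : YoungDiagram} {T : SemistandardYoungTableau D}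
    (h : content T = D'.rowLen) : rowSum D' ≤ rowSum D := by
  intro k
  rw [rowSum_eq_card D, rowSum]
  have h1 : ∑ i ∈ Finset.range k, D'.rowLen i =
      (D.cells.filter fun b => T b.1 b.2 < k).card := by
    rw [Finset.card_eq_sum_card_fiberwise (f := fun b => T b.1 b.2) (t := Finset.range k)]
    · refine Finset.sum_congr rfl fun i hi => ?_
      rw [← h, content]
      congr 1
      ext b
      rw [Finset.mem_range] at hi
      simp only [Finset.mem_filter]
      constructor
      · rintro ⟨h, rfl⟩
        exact ⟨⟨h, hi⟩, rfl⟩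
      · rintro ⟨⟨h, -⟩, rfl⟩
        exact ⟨h, rfl⟩
    · intro b hb
      exact Finset.mem_coe.2 (Finset.mem_range.2 (Finset.mem_filter.1 (Finset.mem_coe.1 hb)).2)
  rw [h1]
  refine Finset.card_le_card fun b hb => ?_
  rw [Finset.mem_filter] at hb ⊢
  exact ⟨hb.1, (le_entry T hb.1).trans_lt hb.2⟩

/-- The row lengths of a diagram, as an exponent. -/
noncomputable def rowExponent (D : YoungDiagram) : ℕ →₀ ℕ :=
  Finsupp.onFinset (Finset.range D.card) D.rowLen fun _ hi =>
    Finset.mem_range.2 (lt_card_of_mem (mem_iff_lt_rowLen.2 (Nat.pos_of_ne_zero hi))).1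

lemma content_highestWeight (D : YoungDiagram) :
    content (SemistandardYoungTableau.highestWeight D) = rowExponent D := by
  funext i
  change _ = D.rowLen i
  rw [content, rowLen_eq_card, YoungDiagram.row]
  congr 1
  refine Finset.filter_congr fun b hb => ?_
  rw [SemistandardYoungTableau.highestWeight_apply]
  exact iff_of_eq (by rw [if_pos (show (b.1, b.2) ∈ D from hb)])

lemma coeff_schur_rowExponent_ne_zero (D : YoungDiagram) :
    MvPowerSeries.coeff (rowExponent D) (schur D) ≠ 0 := by
  rw [coeff_schur, Nat.cast_ne_zero, Nat.card_ne_zero]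
  exact ⟨⟨_, content_highestWeight D⟩, finite_content D _⟩

lemma finite_support_schur (α : ℕ →₀ ℕ) (c : YoungDiagram → Polynomial ℤ) :
    (Function.support fun D => MvPowerSeries.coeff α (schur D) • c D).Finite := by
  refine (finite_card_eq α.degree).subset fun D hD => ?_
  by_contra h
  exact hD (by simp only [coeff_schur_eq_zero h, zero_smul])

/-- The Schur functions are linearly independent, also for infinite linear combinations: the
coefficients of a vanishing combination are zero, as one sees from a shape with a nonzero
coefficient that is maximal in the dominance order. -/
lemma eq_zero_of_finsum_schur {c : YoungDiagram → Polynomial ℤ}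
    (h : ∀ α, ∑ᶠ D, MvPowerSeries.coeff α (schur D) • c D = 0) : c = 0 := by
  by_contra hc
  obtain ⟨D₀, hD₀⟩ := Function.ne_iff.1 hc
  have hfin : {D : YoungDiagram | D.card = D₀.card ∧ c D ≠ 0}.Finite :=
    (finite_card_eq D₀.card).subset fun D hD => hD.1
  obtain ⟨D, ⟨hDc, hD⟩, hmax⟩ := hfin.exists_maximalFor rowSum _ ⟨D₀, rfl, hD₀⟩
  have h1 := h (rowExponent D)
  rw [finsum_eq_single _ D] at h1
  · exact (mul_ne_zero (coeff_schur_rowExponent_ne_zero D) hD) h1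
  · intro D' hne
    by_contra h2
    have h3 : MvPowerSeries.coeff (rowExponent D) (schur D') ≠ 0 := fun h =>
      h2 (by rw [h, zero_smul])
    have h4 : c D' ≠ 0 := fun h => h2 (by rw [h, smul_zero])
    obtain ⟨T, hT⟩ := exists_of_coeff_schur_ne_zero h3
    have h5 : D'.card = D₀.card := by
      rw [card_eq_degree_of_content hT, ← card_eq_degree_of_content (content_highestWeight D), hDc]
    have h6 : rowSum D ≤ rowSum D' := rowSum_le_of_content hT
    exact hne (rowSum_injective (le_antisymm (hmax ⟨h5, h4⟩ h6) h6))

/-- Since Schur expansions are unique, `ω` may be computed from any of them. -/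
lemma omega_eq {f g : PS} (c : YoungDiagram → Polynomial ℤ) (hf : IsExpansion schur f c)
    (hg : ∀ α, MvPowerSeries.coeff α g =
      ∑ᶠ D : YoungDiagram, c D * MvPowerSeries.coeff α (schur D.transpose)) : omega f = g := by
  have hex : ∃ c : YoungDiagram → Polynomial ℤ, IsExpansion schur f c := ⟨c, hf⟩
  have hc : hex.choose = c := by
    rw [← sub_eq_zero]
    refine eq_zero_of_finsum_schur fun α => ?_
    simp only [Pi.sub_apply, smul_sub]
    rw [finsum_sub_distrib (finite_support_schur α _) (finite_support_schur α _),
      ← hex.choose_spec α, ← hf α, sub_self]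
  have hω : omega f = fun α : ℕ →₀ ℕ =>
      ∑ᶠ D : YoungDiagram, hex.choose D * MvPowerSeries.coeff α (schur D.transpose) :=
    dif_pos hex
  rw [hω]
  ext1 α
  rw [hg α, ← hc]
  rfl

end Schur

/-! ### Schur functions of hooks -/

section Hooks

/-- The hook with `a` cells to the right of the corner and `b` cells below it. -/
def hook (a b : ℕ) : YoungDiagram where
  cells := {0} ×ˢ Finset.range (a + 1) ∪ Finset.range (b + 1) ×ˢ {0}
  isLowerSet := by
    rintro ⟨i, j⟩ ⟨i', j'⟩ h hij
    obtain ⟨h1, h2⟩ := Prod.mk_le_mk.1 h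
    simp only [Finset.coe_union, Finset.coe_product, Finset.coe_singleton, Finset.coe_range,
      Set.mem_union, Set.mem_prod, Set.mem_singleton_iff, Set.mem_Iio] at hij ⊢
    omega

lemma mem_hook {a b i j : ℕ} : (i, j) ∈ hook a b ↔ (i = 0 ∧ j ≤ a) ∨ (j = 0 ∧ i ≤ b) := by
  rw [← YoungDiagram.mem_cells, hook]
  simp only [Finset.mem_union, Finset.mem_product, Finset.mem_singleton, Finset.mem_range]
  omega

lemma hook_transpose (a b : ℕ) : (hook a b).transpose = hook b a := by
  ext ⟨i, j⟩
  rw [YoungDiagram.mem_cells, YoungDiagram.mem_cells, YoungDiagram.mem_transpose, Prod.swap_prod_mk,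
    mem_hook, mem_hook]
  tauto

lemma hook_inj {a b a' b' : ℕ} (h : hook a b = hook a' b') : a = a' ∧ b = b' := by
  have h1 : ∀ i j, (i, j) ∈ hook a b ↔ (i, j) ∈ hook a' b' := fun i j => by rw [h]
  simp only [mem_hook] at h1
  have e1 := h1 0 a
  have e2 := h1 0 a'
  have e3 := h1 b 0
  have e4 := h1 b' 0
  omega

/-- The cells of a hook: the corner, the arm and the leg. -/
lemma hook_cells_val (a b : ℕ) : (hook a b).cells.val =
    (0, 0) ::ₘ ((Finset.univ : Finset (Fin a)).val.map (fun j => (0, j.1 + 1)) +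
      (Finset.univ : Finset (Fin b)).val.map (fun i => (i.1 + 1, 0))) := by
  rw [Multiset.Nodup.ext (hook a b).cells.nodup]
  · rintro ⟨i, j⟩
    rw [Finset.mem_val, YoungDiagram.mem_cells, mem_hook, Multiset.mem_cons, Multiset.mem_add,
      mem_map_univ, mem_map_univ]
    simp only [Prod.mk.injEq]
    constructor
    · intro h
      by_cases hi : i = 0
      · by_cases hj : j = 0
        · exact Or.inl ⟨hi, hj⟩
        · exact Or.inr (Or.inl ⟨⟨j - 1, by omega⟩, hi.symm, by simp; omega⟩)
      · exact Or.inr (Or.inr ⟨⟨i - 1, by omega⟩, by simp; omega, by omega⟩)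
    · rintro (h | ⟨j', h⟩ | ⟨i', h⟩)
      · omega
      · have := j'.2
        omega
      · have := i'.2
        omega
  · rw [Multiset.nodup_cons, Multiset.nodup_add]
    refine ⟨?_, ?_, ?_, ?_⟩
    · rw [Multiset.mem_add, mem_map_univ, mem_map_univ]
      simp
    · exact Finset.univ.nodup.map fun j j' h => Fin.ext (by simpa using h)
    · exact Finset.univ.nodup.map fun j j' h => Fin.ext (by simpa using h)
    · rw [Multiset.disjoint_left]
      intro x hx hx'
      rw [mem_map_univ] at hx hx'
      obtain ⟨j, rfl⟩ := hx
      obtain ⟨i, hi⟩ := hx'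
      simp at hi

lemma card_hook (a b : ℕ) : (hook a b).card = a + b + 1 := by
  rw [YoungDiagram.card, ← Finset.card_val, hook_cells_val]
  simp

variable {a b : ℕ}

/-- The entries of the arm of a filled hook. -/
def armEntries (T : SemistandardYoungTableau (hook a b)) (j : Fin a) : ℕ := T 0 (j + 1)

/-- The entries of the leg of a filled hook. -/
def legEntries (T : SemistandardYoungTableau (hook a b)) (i : Fin b) : ℕ := T (i + 1) 0

lemma content_hook_eq_iff (T : SemistandardYoungTableau (hook a b)) (α : ℕ →₀ ℕ) :
    content T = α ↔ Finsupp.toMultiset α =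
      T 0 0 ::ₘ (Finset.univ.val.map (armEntries T) + Finset.univ.val.map (legEntries T)) := by
  have h1 : (hook a b).cells.val.map (fun c => T c.1 c.2) =
      T 0 0 ::ₘ (Finset.univ.val.map (armEntries T) + Finset.univ.val.map (legEntries T)) := by
    rw [hook_cells_val, Multiset.map_cons, Multiset.map_add, Multiset.map_map, Multiset.map_map]
    rfl
  have h2 : ∀ i, content T i = ((hook a b).cells.val.map (fun c => T c.1 c.2)).count i := by
    intro i
    rw [Multiset.count_map, content, Finset.card_def, Finset.filter_val]
    congr 1
    exact Multiset.filter_congr fun c _ => eq_comm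
  rw [← h1]
  constructor
  · intro h
    ext i
    rw [Finsupp.count_toMultiset, ← h, h2]
  · intro h
    funext i
    rw [h2, ← h, Finsupp.count_toMultiset]

lemma monotone_armEntries (T : SemistandardYoungTableau (hook a b)) : Monotone (armEntries T) := by
  intro j j' h
  refine T.row_weak_of_le (Nat.succ_le_succ h) (mem_hook.2 (Or.inl ⟨rfl, ?_⟩))
  exact j'.2

lemma strictMono_legEntries (T : SemistandardYoungTableau (hook a b)) :
    StrictMono (legEntries T) := by
  intro i i' h
  refine T.col_strict (Nat.succ_lt_succ h) (mem_hook.2 (Or.inr ⟨rfl, ?_⟩))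
  exact i'.2

lemma corner_lt_legEntries (T : SemistandardYoungTableau (hook a b)) (i : Fin b) :
    T 0 0 < legEntries T i :=
  T.col_strict (Nat.succ_pos _) (mem_hook.2 (Or.inr ⟨rfl, i.2⟩))

lemma corner_le_armEntries (T : SemistandardYoungTableau (hook a b)) (j : Fin a) :
    T 0 0 ≤ armEntries T j :=
  T.row_weak (Nat.succ_pos _) (mem_hook.2 (Or.inl ⟨rfl, j.2⟩))

lemma mem_support_iff_of_content {T : SemistandardYoungTableau (hook a b)} {α : ℕ →₀ ℕ}
    (h : content T = α) (i : ℕ) : i ∈ α.support ↔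
      i = T 0 0 ∨ (∃ j, armEntries T j = i) ∨ ∃ j, legEntries T j = i := by
  have h1 : i ∈ α.support ↔ i ∈ Finsupp.toMultiset α := by
    rw [← Multiset.count_pos, Finsupp.count_toMultiset, Finsupp.mem_support_iff,
      Nat.pos_iff_ne_zero]
  rw [h1, (content_hook_eq_iff T α).1 h, Multiset.mem_cons, Multiset.mem_add, mem_map_univ,
    mem_map_univ]

lemma corner_eq_min {T : SemistandardYoungTableau (hook a b)} {α : ℕ →₀ ℕ}
    (h : content T = α) (h0 : α.support.Nonempty) : T 0 0 = α.support.min' h0 := by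
  apply le_antisymm
  · rcases (mem_support_iff_of_content h _).1 (α.support.min'_mem h0) with h1 | ⟨j, h1⟩ | ⟨j, h1⟩
    · exact h1.ge
    · rw [← h1]; exact corner_le_armEntries T j
    · rw [← h1]; exact (corner_lt_legEntries T j).le
  · exact α.support.min'_le _ ((mem_support_iff_of_content h _).2 (Or.inl rfl))

/-- The set of the entries of the leg. -/
def legSet (T : SemistandardYoungTableau (hook a b)) : Finset ℕ :=
  Finset.univ.image (legEntries T)

lemma legSet_val (T : SemistandardYoungTableau (hook a b)) :
    (legSet T).val = Finset.univ.val.map (legEntries T) := by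
  rw [legSet, Finset.image_val_of_injOn (strictMono_legEntries T).injective.injOn]

lemma legSet_mem {T : SemistandardYoungTableau (hook a b)} {α : ℕ →₀ ℕ} (h : content T = α)
    (h0 : α.support.Nonempty) :
    legSet T ∈ (α.support.erase (α.support.min' h0)).powersetCard b := by
  rw [Finset.mem_powersetCard]
  constructor
  · intro i hi
    obtain ⟨j, -, rfl⟩ := Finset.mem_image.1 hi
    rw [Finset.mem_erase, ← corner_eq_min h h0]
    exact ⟨(corner_lt_legEntries T j).ne',
      (mem_support_iff_of_content h _).2 (Or.inr (Or.inr ⟨j, rfl⟩))⟩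
  · rw [legSet, Finset.card_image_of_injective _ (strictMono_legEntries T).injective,
      Finset.card_univ, Fintype.card_fin]

lemma eq_of_legSet_eq {T T' : SemistandardYoungTableau (hook a b)} {α : ℕ →₀ ℕ}
    (h : content T = α) (h' : content T' = α) (h0 : α.support.Nonempty)
    (hl : legSet T = legSet T') : T = T' := by
  have hc : T 0 0 = T' 0 0 := (corner_eq_min h h0).trans (corner_eq_min h' h0).symm
  have hleg' : Finset.univ.val.map (legEntries T) = Finset.univ.val.map (legEntries T') := by
    rw [← legSet_val, ← legSet_val, hl]
  have hleg := monotone_eq_of_map_eq (OrderIso.refl (Fin b)) (strictMono_legEntries T).monotone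
    (strictMono_legEntries T').monotone hleg'
  have harm := monotone_eq_of_map_eq (OrderIso.refl (Fin a)) (monotone_armEntries T)
    (monotone_armEntries T') (by
      have h1 := ((content_hook_eq_iff T α).1 h).symm.trans ((content_hook_eq_iff T' α).1 h')
      rw [hc, hleg'] at h1
      exact add_right_cancel ((Multiset.cons_inj_right _).1 h1))
  refine SemistandardYoungTableau.ext fun i j => ?_
  by_cases hij : (i, j) ∈ hook a b
  · rcases mem_hook.1 hij with ⟨rfl, hj⟩ | ⟨rfl, hi⟩
    · rcases j with _ | j
      · exact hc
      · exact congrFun harm ⟨j, hj⟩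
    · rcases i with _ | i
      · exact hc
      · exact congrFun hleg ⟨i, hi⟩
  · rw [T.zeros hij, T'.zeros hij]

/-- The filling of a hook with given corner, arm and leg. -/
def hookTableau (x : ℕ) (ρ : Fin a → ℕ) (κ : Fin b → ℕ) (hρ : Monotone ρ) (hκ : StrictMono κ)
    (hxρ : ∀ j, x ≤ ρ j) (hxκ : ∀ i, x < κ i) : SemistandardYoungTableau (hook a b) where
  entry i j := if i = 0 then if j = 0 then x else if hj : j - 1 < a then ρ ⟨j - 1, hj⟩ else 0
    else if j = 0 then if hi : i - 1 < b then κ ⟨i - 1, hi⟩ else 0 else 0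
  row_weak' {i j1 j2} hlt hmem := by
    obtain ⟨rfl, hj⟩ : i = 0 ∧ j2 ≤ a := by
      rcases mem_hook.1 hmem with h | h <;> omega
    have h1 : j2 - 1 < a := by omega
    have h2 : j2 ≠ 0 := by omega
    simp only [if_true, if_neg h2, dif_pos h1]
    split_ifs
    · exact hxρ _
    · exact hρ (Fin.mk_le_mk.2 (by omega))
    · exact Nat.zero_le _
  col_strict' {i1 i2 j} hlt hmem := by
    obtain ⟨rfl, hi⟩ : j = 0 ∧ i2 ≤ b := by
      rcases mem_hook.1 hmem with h | h <;> omega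
    have h1 : i2 - 1 < b := by omega
    have h2 : i2 ≠ 0 := by omega
    simp only [if_true, if_neg h2, dif_pos h1]
    split_ifs
    · exact hxκ _
    · exact hκ (Fin.mk_lt_mk.2 (by omega))
    · omega
  zeros' {i j} h := by
    rw [mem_hook] at h
    split_ifs <;> first | rfl | (exfalso; omega)

lemma hookTableau_apply (x : ℕ) (ρ : Fin a → ℕ) (κ : Fin b → ℕ) (hρ : Monotone ρ)
    (hκ : StrictMono κ) (hxρ : ∀ j, x ≤ ρ j) (hxκ : ∀ i, x < κ i) (i j : ℕ) :
    hookTableau x ρ κ hρ hκ hxρ hxκ i j =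
      if i = 0 then if j = 0 then x else if hj : j - 1 < a then ρ ⟨j - 1, hj⟩ else 0
      else if j = 0 then if hi : i - 1 < b then κ ⟨i - 1, hi⟩ else 0 else 0 := rfl

lemma exists_legSet_eq {α : ℕ →₀ ℕ} (hα : α.degree = a + b + 1) (h0 : α.support.Nonempty)
    {B : Finset ℕ} (hB : B ∈ (α.support.erase (α.support.min' h0)).powersetCard b) :
    ∃ T : SemistandardYoungTableau (hook a b), content T = α ∧ legSet T = B := by
  rw [Finset.mem_powersetCard] at hB
  set x := α.support.min' h0 with hx
  have hxB : x ∉ B := fun h => Finset.notMem_erase _ _ (hB.1 h)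
  have hle : x ::ₘ B.val ≤ Finsupp.toMultiset α := by
    have h1 := val_le_toMultiset (γ := α) (S := Finset.cons x B hxB) (by
      intro i hi
      rcases Finset.mem_cons.1 hi with rfl | hi
      · exact α.support.min'_mem h0
      · exact Finset.mem_of_mem_erase (hB.1 hi))
    rwa [Finset.cons_val] at h1
  have hcard : Multiset.card (Finsupp.toMultiset α - x ::ₘ B.val) = a := by
    rw [Multiset.card_sub hle, Multiset.card_cons, Finset.card_val, hB.2, Finsupp.card_toMultiset]
    change α.degree - _ = a
    omega
  obtain ⟨ρ, hρ, hρs⟩ := exists_monotone_map_eq (OrderIso.refl (Fin a)) _ hcard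
  obtain ⟨κ, hκ, hκs⟩ := exists_monotone_map_eq (OrderIso.refl (Fin b)) B.val hB.2
  have hκ' : StrictMono κ := hκ.strictMono_of_injective fun i i' h => by
    have h1 : (Finset.univ.val.map κ).Nodup := by rw [hκs]; exact B.nodup
    exact Multiset.inj_on_of_nodup_map h1 i (Finset.mem_univ_val _) i' (Finset.mem_univ_val _) h
  have hxκ : ∀ i, x < κ i := by
    intro i
    have h1 : κ i ∈ B.val := by
      rw [← hκs]
      exact mem_map_univ.2 ⟨i, rfl⟩
    obtain ⟨h2, h3⟩ := Finset.mem_erase.1 (hB.1 h1)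
    exact lt_of_le_of_ne (α.support.min'_le _ h3) h2.symm
  have hxρ : ∀ j, x ≤ ρ j := by
    intro j
    have h1 : ρ j ∈ Finsupp.toMultiset α := by
      refine Multiset.mem_of_le (Multiset.sub_le_self _ (x ::ₘ B.val)) ?_
      rw [← hρs]
      exact mem_map_univ.2 ⟨j, rfl⟩
    rw [← Multiset.count_pos, Finsupp.count_toMultiset, Nat.pos_iff_ne_zero,
      ← Finsupp.mem_support_iff] at h1
    exact α.support.min'_le _ h1
  set T := hookTableau x ρ κ hρ hκ' hxρ hxκ with hT
  have harm : armEntries T = ρ := funext fun j => by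
    change T 0 (j + 1) = ρ j
    rw [hT, hookTableau_apply]
    simp
  have hleg : legEntries T = κ := funext fun i => by
    change T (i + 1) 0 = κ i
    rw [hT, hookTableau_apply]
    simp
  refine ⟨T, (content_hook_eq_iff T α).2 ?_, ?_⟩
  · rw [harm, hleg, hρs, hκs]
    change _ = x ::ₘ _
    rw [← Multiset.add_cons, tsub_add_cancel_of_le hle]
  · apply Finset.val_injective
    rw [legSet_val, hleg, hκs]

/-- The number in the corner of a tableau of hook shape with content `α` is the least one in use;
the leg contains any `b` of the other numbers in use, and these determine the tableau. -/
lemma coeff_schur_hook {α : ℕ →₀ ℕ} (hα : α.degree = a + b + 1) :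
    MvPowerSeries.coeff α (schur (hook a b)) = ((α.support.card - 1).choose b : Polynomial ℤ) := by
  have h0 : α.support.Nonempty := by
    rw [Finsupp.support_nonempty_iff]
    rintro rfl
    simp at hα
  rw [coeff_schur]
  congr 1
  rw [← Finset.card_erase_of_mem (α.support.min'_mem h0), ← Finset.card_powersetCard,
    ← Fintype.card_coe, ← Nat.card_eq_fintype_card]
  refine Nat.card_eq_of_bijective (fun T => ⟨legSet T.1, legSet_mem T.2 h0⟩) ⟨?_, ?_⟩
  · intro T T' h
    exact Subtype.ext (eq_of_legSet_eq T.2 T'.2 h0 (congrArg Subtype.val h))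
  · rintro ⟨B, hB⟩
    obtain ⟨T, hT, hTB⟩ := exists_legSet_eq hα h0 hB
    exact ⟨⟨T, hT⟩, Subtype.ext hTB⟩

lemma coeff_schur_bot : MvPowerSeries.coeff 0 (schur ⊥) = 1 := by
  have h := coeff_schur_rowExponent_ne_zero ⊥
  have h0 : rowExponent ⊥ = 0 := by
    ext i
    change (⊥ : YoungDiagram).rowLen i = 0
    rw [YoungDiagram.rowLen_eq_card]
    simp [YoungDiagram.row]
  rw [h0, coeff_schur, Nat.cast_ne_zero, Nat.card_ne_zero] at h
  have hsub : Subsingleton {T : SemistandardYoungTableau ⊥ // content T = (0 : ℕ →₀ ℕ)} := by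
    refine ⟨fun T T' => Subtype.ext (SemistandardYoungTableau.ext fun i j => ?_)⟩
    rw [T.1.zeros (YoungDiagram.notMem_bot _), T'.1.zeros (YoungDiagram.notMem_bot _)]
  rw [coeff_schur, Nat.card_eq_one_iff_unique.2 ⟨hsub, h.1⟩, Nat.cast_one]

open Classical in
/-- The family of coefficients that are `φ b k` at a hook with `k` cells of which `b` lie below the
corner, `ε` at the empty diagram, and zero otherwise. -/
noncomputable def hookFamily (φ : ℕ → ℕ → Polynomial ℤ) (ε : Polynomial ℤ) :
    YoungDiagram → Polynomial ℤ :=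
  Function.extend (fun p : ℕ × ℕ => hook p.1 p.2) (fun p => φ p.2 (p.1 + p.2 + 1))
    fun D => if D = ⊥ then ε else 0

lemma hookFamily_hook (φ : ℕ → ℕ → Polynomial ℤ) (ε : Polynomial ℤ) (a b : ℕ) :
    hookFamily φ ε (hook a b) = φ b (a + b + 1) := by
  have hinj : Function.Injective fun p : ℕ × ℕ => hook p.1 p.2 := fun p q h =>
    Prod.ext (hook_inj h).1 (hook_inj h).2
  exact hinj.extend_apply _ _ (a, b)

lemma hook_ne_bot (a b : ℕ) : hook a b ≠ ⊥ := by
  intro h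
  have := card_hook a b
  rw [h] at this
  simp [YoungDiagram.card] at this

lemma hookFamily_bot (φ : ℕ → ℕ → Polynomial ℤ) (ε : Polynomial ℤ) : hookFamily φ ε ⊥ = ε := by
  rw [hookFamily, Function.extend_apply', if_pos rfl]
  rintro ⟨p, hp⟩
  exact hook_ne_bot _ _ hp

lemma exists_of_hookFamily_ne_zero {φ : ℕ → ℕ → Polynomial ℤ} {ε : Polynomial ℤ}
    {D : YoungDiagram} (h : hookFamily φ ε D ≠ 0) : D = ⊥ ∨ ∃ a b, D = hook a b := by
  by_contra! h'
  apply h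
  rw [hookFamily, Function.extend_apply', if_neg h'.1]
  rintro ⟨p, hp⟩
  exact h'.2 p.1 p.2 hp.symm

lemma finsum_hookFamily_zero (φ : ℕ → ℕ → Polynomial ℤ) (ε : Polynomial ℤ)
    (u : YoungDiagram → Polynomial ℤ) (hu : ∀ D, D.card ≠ 0 → u D = 0) :
    ∑ᶠ D, u D * hookFamily φ ε D = u ⊥ * ε := by
  rw [finsum_eq_single _ ⊥, hookFamily_bot]
  intro D hD
  by_contra h
  rcases exists_of_hookFamily_ne_zero (right_ne_zero_of_mul h) with h1 | ⟨a, b, rfl⟩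
  · exact hD h1
  · exact left_ne_zero_of_mul h (hu _ (by rw [card_hook]; omega))

lemma finsum_hookFamily_succ (φ : ℕ → ℕ → Polynomial ℤ) (ε : Polynomial ℤ)
    (u : YoungDiagram → Polynomial ℤ) (k : ℕ) (hu : ∀ D, D.card ≠ k + 1 → u D = 0) :
    ∑ᶠ D, u D * hookFamily φ ε D =
      ∑ b ∈ Finset.range (k + 1), u (hook (k - b) b) * φ b (k + 1) := by
  classical
  rw [finsum_eq_sum_of_support_subset (s := (Finset.range (k + 1)).image fun b => hook (k - b) b),
    Finset.sum_image fun b _ b' _ h => (hook_inj h).2]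
  · refine Finset.sum_congr rfl fun b hb => ?_
    rw [Finset.mem_range] at hb
    rw [hookFamily_hook, Nat.sub_add_cancel (by omega)]
  · intro D hD
    rw [Function.mem_support] at hD
    have hcard : D.card = k + 1 := by
      by_contra h
      exact left_ne_zero_of_mul hD (hu D h)
    rcases exists_of_hookFamily_ne_zero (right_ne_zero_of_mul hD) with rfl | ⟨a, b, rfl⟩
    · simp [YoungDiagram.card] at hcard
    · rw [card_hook] at hcard
      rw [Finset.mem_coe, Finset.mem_image]
      exact ⟨b, Finset.mem_range.2 (by omega), by rw [show k - b = a by omega]⟩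

lemma transpose_card (D : YoungDiagram) : D.transpose.card = D.card := by
  rw [YoungDiagram.card, YoungDiagram.card, YoungDiagram.transpose]
  simp

/-- The effect of `ω` on a combination of the Schur functions of hooks. -/
lemma omega_hookFamily (φ : ℕ → ℕ → Polynomial ℤ) (ε : Polynomial ℤ) {f g : PS}
    (hf0 : MvPowerSeries.coeff 0 f = ε) (hg0 : MvPowerSeries.coeff 0 g = ε)
    (hf : ∀ (α : ℕ →₀ ℕ) (k : ℕ), α.degree = k + 1 → MvPowerSeries.coeff α f =
      ∑ b ∈ Finset.range (k + 1), ((α.support.card - 1).choose b : Polynomial ℤ) * φ b (k + 1))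
    (hg : ∀ (α : ℕ →₀ ℕ) (k : ℕ), α.degree = k + 1 → MvPowerSeries.coeff α g =
      ∑ b ∈ Finset.range (k + 1),
        ((α.support.card - 1).choose b : Polynomial ℤ) * φ (k - b) (k + 1)) :
    omega f = g := by
  refine omega_eq (hookFamily φ ε) (fun α => ?_) fun α => ?_
  · simp only [smul_eq_mul]
    rcases hk : α.degree with _ | k
    · rw [Finsupp.degree_eq_zero_iff] at hk
      subst hk
      rw [hf0, finsum_hookFamily_zero, coeff_schur_bot, one_mul]
      intro D hD
      exact coeff_schur_eq_zero (by simpa using hD)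
    · rw [hf α k hk, finsum_hookFamily_succ φ ε _ k]
      · refine Finset.sum_congr rfl fun b hb => ?_
        rw [Finset.mem_range] at hb
        rw [coeff_schur_hook (by omega)]
      · exact fun D hD => coeff_schur_eq_zero (by rw [hk]; exact hD)
  · simp only [mul_comm (hookFamily φ ε _)]
    rcases hk : α.degree with _ | k
    · rw [Finsupp.degree_eq_zero_iff] at hk
      subst hk
      rw [hg0, finsum_hookFamily_zero φ ε fun D => MvPowerSeries.coeff 0 (schur D.transpose)]
      · have h : (⊥ : YoungDiagram).transpose = ⊥ := by
          ext x
          rw [YoungDiagram.mem_cells, YoungDiagram.mem_transpose]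
          simp
        rw [h, coeff_schur_bot, one_mul]
      · intro D hD
        exact coeff_schur_eq_zero (by rw [transpose_card]; simpa using hD)
    · rw [hg α k hk, finsum_hookFamily_succ φ ε
        (fun D => MvPowerSeries.coeff α (schur D.transpose)) k]
      · rw [← Finset.sum_range_reflect]
        refine Finset.sum_congr rfl fun b hb => ?_
        rw [Finset.mem_range] at hb
        rw [hook_transpose, coeff_schur_hook (by omega), show k + 1 - 1 - b = k - b by omega,
          show k - (k - b) = b by omega]
      · exact fun D hD => coeff_schur_eq_zero (by rw [hk, transpose_card]; exact hD)

end Hooks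

/-! ### The closed forms and the coefficients of hooks -/

/-- Pascal's rule inside a sum against binomial coefficients. -/
lemma sum_choose_succ_mul (r : ℕ) (f : ℕ → ℕ) :
    ∑ j ∈ Finset.range (r + 1 + 1), (r + 1).choose j * f j =
      ∑ b ∈ Finset.range (r + 1), r.choose b * (f b + f (b + 1)) := by
  rw [Finset.sum_range_succ']
  simp only [Nat.choose_succ_succ, add_mul, mul_add, Finset.sum_add_distrib]
  rw [Finset.sum_range_succ' (fun b => r.choose b * f b),
    Finset.sum_range_succ (fun b => r.choose (b + 1) * f (b + 1)),
    Nat.choose_succ_self]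
  simp only [Nat.choose_zero_right]
  ring

lemma sum_choose_mul_extend {r k : ℕ} (h : r ≤ k) (f : ℕ → ℕ) :
    ∑ b ∈ Finset.range (r + 1), r.choose b * f b =
      ∑ b ∈ Finset.range (k + 1), r.choose b * f b := by
  refine Finset.sum_subset (Finset.range_mono (Nat.succ_le_succ h)) fun b _ hb => ?_
  rw [Nat.choose_eq_zero_of_lt (by simpa using hb), zero_mul]

lemma onePlusPowCoeff_eq_sum {r k : ℕ} (hr : 0 < r) (hrk : r ≤ k + 1) (M : ℕ) :
    onePlusPowCoeff r M = ∑ b ∈ Finset.range (k + 1),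
    (r - 1).choose b * (b.multichoose M + (b + 1).multichoose M) := by
  obtain ⟨r, rfl⟩ := Nat.exists_eq_succ_of_ne_zero hr.ne'
  exact (sum_choose_succ_mul r fun j => j.multichoose M).trans
    (sum_choose_mul_extend (Nat.le_of_succ_le_succ hrk) _)

lemma barCoeff_eq_sum {r k : ℕ} (hr : 0 < r) (hrk : r ≤ k + 1) (M : ℕ) :
    barCoeff r (k + 1) M = ∑ b ∈ Finset.range (k + 1),
    (r - 1).choose b * ((k - b).multichoose M + (k - b + 1).multichoose M) := by
  obtain ⟨r, rfl⟩ := Nat.exists_eq_succ_of_ne_zero hr.ne'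
  refine (sum_choose_succ_mul r fun j => (k + 1 - j).multichoose M).trans
    ((sum_choose_mul_extend (Nat.le_of_succ_le_succ hrk) _).trans ?_)
  refine Finset.sum_congr rfl fun b hb => ?_
  have hb' : b ≤ k := Nat.lt_succ_iff.1 (Finset.mem_range.1 hb)
  rw [Nat.add_sub_add_right, Nat.sub_add_comm hb', add_comm (Nat.multichoose (k - b + 1) M)]
  rfl

lemma onePlusPowCoeff'_eq_sum {r k : ℕ} (hr : 0 < r) (hrk : r ≤ k + 1) (M : ℕ) :
    onePlusPowCoeff' r M = ∑ b ∈ Finset.range (k + 1),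
    (r - 1).choose b * (b + 1).multichoose M := by
  obtain ⟨r, rfl⟩ := Nat.exists_eq_succ_of_ne_zero hr.ne'
  exact sum_choose_mul_extend (Nat.le_of_succ_le_succ hrk) _

lemma barCoeff'_eq_sum {r k : ℕ} (hr : 0 < r) (hrk : r ≤ k + 1) (M : ℕ) :
    barCoeff' r (k + 1) M = ∑ b ∈ Finset.range (k + 1),
    (r - 1).choose b * (k - b + 1).multichoose M := by
  obtain ⟨r, rfl⟩ := Nat.exists_eq_succ_of_ne_zero hr.ne'
  refine (sum_choose_mul_extend (Nat.le_of_succ_le_succ hrk) _).trans ?_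
  refine Finset.sum_congr rfl fun b hb => ?_
  have hb' : b ≤ k := Nat.lt_succ_iff.1 (Finset.mem_range.1 hb)
  rw [Nat.sub_add_comm hb']
  rfl

lemma card_support_le_degree (γ : ℕ →₀ ℕ) : γ.support.card ≤ γ.degree := by
  rw [Finset.card_eq_sum_ones, Finsupp.degree_apply]
  exact Finset.sum_le_sum fun i hi => Nat.pos_of_ne_zero (Finsupp.mem_support_iff.1 hi)

/-- The series with the closed form `u` is the combination of hooks with the coefficients
`(-β)^{N-k} f b (N-k)`, for hooks with `k` cells of which `b` lie below the corner, and the series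
with the closed form `v` is that of the transposed hooks. -/
lemma omega_eq_of_closed_form (N : ℕ) (u v : ℕ → ℕ → ℕ → ℕ) (f : ℕ → ℕ → ℕ)
    (h0 : u 0 0 N = v 0 0 N)
    (hu : ∀ r k M, 0 < r → r ≤ k + 1 → u r (k + 1) M =
      ∑ b ∈ Finset.range (k + 1), (r - 1).choose b * f b M)
    (hv : ∀ r k M, 0 < r → r ≤ k + 1 → v r (k + 1) M =
      ∑ b ∈ Finset.range (k + 1), (r - 1).choose b * f (k - b) M) {F G : PS}
    (hF : ∀ γ : ℕ →₀ ℕ, MvPowerSeries.coeff γ F = if γ.degree ≤ N then (-β) ^ (N - γ.degree) *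
      (u γ.support.card γ.degree (N - γ.degree) : Polynomial ℤ) else 0)
    (hG : ∀ γ : ℕ →₀ ℕ, MvPowerSeries.coeff γ G = if γ.degree ≤ N then (-β) ^ (N - γ.degree) *
      (v γ.support.card γ.degree (N - γ.degree) : Polynomial ℤ) else 0) :
    omega F = G := by
  have hpos : ∀ (α : ℕ →₀ ℕ) (k : ℕ), α.degree = k + 1 →
      0 < α.support.card ∧ α.support.card ≤ k + 1 := by
    intro α k hk
    refine ⟨?_, hk ▸ card_support_le_degree α⟩
    rw [Finset.card_pos, Finsupp.support_nonempty_iff]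
    rintro rfl
    simp at hk
  refine omega_hookFamily
    (fun b k => if k ≤ N then (-β) ^ (N - k) * (f b (N - k) : Polynomial ℤ) else 0)
    (MvPowerSeries.coeff 0 F) rfl ?_ (fun α k hk => ?_) fun α k hk => ?_
  · rw [hF, hG]
    simp [h0]
  · rw [hF, hk]
    split_ifs
    · rw [hu _ _ _ (hpos α k hk).1 (hpos α k hk).2, Nat.cast_sum, Finset.mul_sum]
      exact Finset.sum_congr rfl fun b _ => by push_cast; ring
    · simp
  · rw [hG, hk]
    split_ifs
    · rw [hv _ _ _ (hpos α k hk).1 (hpos α k hk).2, Nat.cast_sum, Finset.mul_sum]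
      exact Finset.sum_congr rfl fun b _ => by push_cast; ring
    · simp

/-! ### Comparison of the functions and the tableaux -/

lemma coeff_rppGenQ (m n : ℕ) (γ : ℕ →₀ ℕ) :
    MvPowerSeries.coeff γ (rppGenQ (oneRow n) (oneRow m)) =
    if γ.degree ≤ n - m then (-β) ^ (n - m - γ.degree) *
      (onePlusPowCoeff γ.support.card (n - m - γ.degree) : Polynomial ℤ) else 0 := by
  unfold rppGenQ ShRPPQ
  -- The type of the fillings depends on the diagram, which is generalized before it is replaced.
  generalize hD : (oneRow n).skewSD (oneRow m) = D
  rw [oneRow_skewSD] at hD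
  subst hD
  exact coeff_rpp_rowDiagram_true γ _ fun _ => Iff.rfl

lemma coeff_barGenQ (m n : ℕ) (γ : ℕ →₀ ℕ) :
    MvPowerSeries.coeff γ (barGenQ (oneRow n) (oneRow m)) =
    if γ.degree ≤ n - m then (-β) ^ (n - m - γ.degree) *
      (barCoeff γ.support.card γ.degree (n - m - γ.degree) : Polynomial ℤ) else 0 := by
  unfold barGenQ ShBTQ
  generalize hD : (oneRow n).skewSD (oneRow m) = D
  rw [oneRow_skewSD] at hD
  subst hD
  exact coeff_bar_rowDiagram_true γ _ fun _ => Iff.rfl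

lemma rowDiagram_fst_ne_snd {m n : ℕ} (h : 0 < m ∨ n = 0) (b : rowDiagram m n) :
    b.1.1 ≠ b.1.2 := by
  have h1 := rowDiagram_fst b
  have h2 := rowDiagram_snd b
  omega

/-- If the skew diagram has no diagonal box, the condition on the diagonal is void. -/
lemma coeff_rppGenP {m n : ℕ} (h : 0 < m ∨ n = 0) (γ : ℕ →₀ ℕ) :
    MvPowerSeries.coeff γ (rppGenP (oneRow n) (oneRow m)) =
    if γ.degree ≤ n - m then (-β) ^ (n - m - γ.degree) *
      (onePlusPowCoeff γ.support.card (n - m - γ.degree) : Polynomial ℤ) else 0 := by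
  unfold rppGenP ShRPPP
  generalize hD : (oneRow n).skewSD (oneRow m) = D
  rw [oneRow_skewSD] at hD
  subst hD
  exact coeff_rpp_rowDiagram_true γ _ fun _ => and_iff_left fun b hb =>
    absurd hb (rowDiagram_fst_ne_snd h b)

/-- If the skew diagram has no diagonal box, the condition on the diagonal is void. -/
lemma coeff_barGenP {m n : ℕ} (h : 0 < m ∨ n = 0) (γ : ℕ →₀ ℕ) :
    MvPowerSeries.coeff γ (barGenP (oneRow n) (oneRow m)) =
    if γ.degree ≤ n - m then (-β) ^ (n - m - γ.degree) *
      (barCoeff γ.support.card γ.degree (n - m - γ.degree) : Polynomial ℤ) else 0 := by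
  unfold barGenP ShBTP
  generalize hD : (oneRow n).skewSD (oneRow m) = D
  rw [oneRow_skewSD] at hD
  subst hD
  exact coeff_bar_rowDiagram_true γ _ fun _ => and_iff_left fun b hb =>
    absurd hb (rowDiagram_fst_ne_snd h b)

lemma coeff_rppGenP_zero {n : ℕ} (hn : 0 < n) (γ : ℕ →₀ ℕ) :
    MvPowerSeries.coeff γ (rppGenP (oneRow n) (oneRow 0)) =
    if γ.degree ≤ n then (-β) ^ (n - γ.degree) *
      (onePlusPowCoeff' γ.support.card (n - γ.degree) : Polynomial ℤ) else 0 := by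
  unfold rppGenP ShRPPP
  generalize hD : (oneRow n).skewSD (oneRow 0) = D
  rw [oneRow_skewSD] at hD
  subst hD
  exact coeff_rppP_rowDiagram_zero hn γ

lemma coeff_barGenP_zero {n : ℕ} (hn : 0 < n) (γ : ℕ →₀ ℕ) :
    MvPowerSeries.coeff γ (barGenP (oneRow n) (oneRow 0)) =
    if γ.degree ≤ n then (-β) ^ (n - γ.degree) *
      (barCoeff' γ.support.card γ.degree (n - γ.degree) : Polynomial ℤ) else 0 := by
  unfold barGenP ShBTP
  generalize hD : (oneRow n).skewSD (oneRow 0) = D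
  rw [oneRow_skewSD] at hD
  subst hD
  exact coeff_barP_rowDiagram_zero hn γ

/-- If the skew diagram has no diagonal box, then `gp` and `gq` have the same closed form. -/
lemma gpSkew_oneRow_eq_gqSkew {m n : ℕ} (hmn : m ≤ n) (h : 0 < m ∨ n = 0) :
    gpSkew (oneRow n) (oneRow m) = gqSkew (oneRow n) (oneRow m) := by
  rw [gqSkew_oneRow hmn]
  rcases m with _ | m
  · obtain rfl : n = 0 := by omega
    rw [gpSkew_oneRow_zero, coeff_cauchyKernel_zero]
  · exact gpSkew_oneRow_succ hmn

lemma gqSkew_oneRow_eq_rppGenQ {m n : ℕ} (h : m ≤ n) :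
    gqSkew (oneRow n) (oneRow m) = rppGenQ (oneRow n) (oneRow m) := by
  ext1 γ
  rw [gqSkew_oneRow h, coeff_cauchyKernel_eq, coeff_rppGenQ]

lemma gpSkew_oneRow_eq_rppGenP {m n : ℕ} (hmn : m ≤ n) :
    gpSkew (oneRow n) (oneRow m) = rppGenP (oneRow n) (oneRow m) := by
  ext1 γ
  by_cases h : 0 < m ∨ n = 0
  · rw [gpSkew_oneRow_eq_gqSkew hmn h, gqSkew_oneRow hmn, coeff_cauchyKernel_eq, coeff_rppGenP h]
  · obtain ⟨rfl, hn⟩ : m = 0 ∧ 0 < n := by omega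
    rw [gpSkew_oneRow_zero, coeff_gpOneRow_eq hn, coeff_rppGenP_zero hn]

lemma omega_eq_of_onePlusPowCoeff (N : ℕ) {F G : PS}
    (hF : ∀ γ : ℕ →₀ ℕ, MvPowerSeries.coeff γ F = if γ.degree ≤ N then (-β) ^ (N - γ.degree) *
      (onePlusPowCoeff γ.support.card (N - γ.degree) : Polynomial ℤ) else 0)
    (hG : ∀ γ : ℕ →₀ ℕ, MvPowerSeries.coeff γ G = if γ.degree ≤ N then (-β) ^ (N - γ.degree) *
      (barCoeff γ.support.card γ.degree (N - γ.degree) : Polynomial ℤ) else 0) :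
    omega F = G :=
  omega_eq_of_closed_form N (fun r _ M => onePlusPowCoeff r M) barCoeff
    (fun b M => b.multichoose M + (b + 1).multichoose M) rfl
    (fun _ _ M hr hrk => onePlusPowCoeff_eq_sum hr hrk M)
    (fun _ _ M hr hrk => barCoeff_eq_sum hr hrk M) hF hG

lemma jqSkew_oneRow_eq_barGenQ {m n : ℕ} (h : m ≤ n) :
    jqSkew (oneRow n) (oneRow m) = barGenQ (oneRow n) (oneRow m) := by
  rw [jqSkew, gqSkew_oneRow h]
  exact omega_eq_of_onePlusPowCoeff (n - m) (coeff_cauchyKernel_eq _) (coeff_barGenQ m n)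

lemma jpSkew_oneRow_eq_barGenP {m n : ℕ} (hmn : m ≤ n) :
    jpSkew (oneRow n) (oneRow m) = barGenP (oneRow n) (oneRow m) := by
  rw [jpSkew]
  by_cases h : 0 < m ∨ n = 0
  · rw [gpSkew_oneRow_eq_gqSkew hmn h, gqSkew_oneRow hmn]
    exact omega_eq_of_onePlusPowCoeff (n - m) (coeff_cauchyKernel_eq _) (coeff_barGenP h)
  · obtain ⟨rfl, hn⟩ : m = 0 ∧ 0 < n := by omega
    rw [gpSkew_oneRow_zero]
    exact omega_eq_of_closed_form n (fun r _ M => onePlusPowCoeff' r M) barCoeff'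
      (fun b M => (b + 1).multichoose M) rfl
      (fun _ _ M hr hrk => onePlusPowCoeff'_eq_sum hr hrk M)
      (fun _ _ M hr hrk => barCoeff'_eq_sum hr hrk M) (coeff_gpOneRow_eq hn)
      (coeff_barGenP_zero hn)

lemma length_le_of_subset {lam mu : StrictPartition} (h : mu ⊆ lam) :
    mu.length ≤ lam.length := by
  by_contra! hlt
  have hlt' : lam.parts.length < mu.parts.length := hlt
  have h1 : mu.parts.getD lam.parts.length 0 ≤ lam.parts.getD lam.parts.length 0 := h _
  rw [List.getD_eq_getElem _ _ hlt', List.getD_eq_default _ _ le_rfl] at h1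
  exact absurd (mu.pos _ (List.getElem_mem hlt')) (by omega)

end KSchur

theorem mainTheorem11 (lam mu : KSchur.StrictPartition) (hlen : lam.length ≤ 1) (hsub : mu ⊆ lam) :
    KSchur.gpSkew lam mu = KSchur.rppGenP lam mu ∧
    KSchur.gqSkew lam mu = KSchur.rppGenQ lam mu ∧
    KSchur.jpSkew lam mu = KSchur.barGenP lam mu ∧
    KSchur.jqSkew lam mu = KSchur.barGenQ lam mu := by
  have h0 : mu.part 0 ≤ lam.part 0 := hsub 0
  rw [KSchur.eq_oneRow_of_length_le hlen,
    KSchur.eq_oneRow_of_length_le ((KSchur.length_le_of_subset hsub).trans hlen)]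
  exact ⟨KSchur.gpSkew_oneRow_eq_rppGenP h0, KSchur.gqSkew_oneRow_eq_rppGenQ h0,
    KSchur.jpSkew_oneRow_eq_barGenP h0, KSchur.jqSkew_oneRow_eq_barGenQ h0⟩
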